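/- **Setting.** Let $n\ge 1$, let $(N^{n+1},g)$ be a connected oriented Riemannian spin manifold with complex spinor bundle $\Sigma N$, built from an irreducible complex Clifford module with $v\cdot v=-|v|^2$ and a Hermitian product for which Clifford multiplication by vectors is skew, and let $M^n$ be a nonempty compact oriented manifold, isometrically immersed in $N$ as a hypersurface. Let $\nu$ be the unit normal such that $(e_1,\dots,e_n)$ is a positive orthonormal frame of $M$ if and only if $(e_1,\dots,e_n,\nu)$ is a positive frame of $N$; let $h(X,Y)=g(\nabla^N_XY,\nu)=-g(\nabla^N_X\nu,Y)$ be the second fundamental form and $H=\frac1n\operatorname{tr}h$ the mean curvature. $M$ carries the spin structure induced from $N$, i.e. the pull-back of that of $N$ under $(e_1,\dots,e_n)\mapsto(e_1,\dots,e_n,\nu)$. If $n$ is even, put $\Sigma^\varepsilon=\Sigma N|_M$ for both signs $\varepsilon=\pm1$; if $n$ is odd, let $\Sigma^\varepsilon\subset\Sigma N|_M$ be the eigenspace, for the eigenvalue $\varepsilon$, of the complex volume element $i^{[(n+2)/2]}e_1\cdots e_{n}\cdot\nu$. With the Clifford multiplication $X\otimes\varphi\mapsto X\cdot\nu\cdot\varphi$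 by $X\in TM$, $\Sigma^\varepsilon$ is the spinor bundle of $M$. For a spinor field $\Phi$ on $N$ let $\psi_\varepsilon$ be the orthogonal projection of $\Phi|_M$ to $\Sigma^\varepsilon$, regarded as a spinor field on $M$ (so $\psi_\varepsilon=\Phi|_M$ if $n$ is even). Where $\psi\ne0$, the energy-momentum tensor of a spinor field $\psi$ on $M$ is $$T^\psi(X,Y)=\tfrac12\operatorname{Re}\big(X\cdot\nabla_Y\psi+Y\cdot\nabla_X\psi,\ \psi/|\psi|^2\big).$$ **Statement.** Assume that $H$ is constant and that $\Phi\not\equiv0$ is a parallel spinor field on $N$. Then $\psi_\varepsilon\not\equiv0$ for at least one sign $\varepsilon$, and for every $\varepsilon$ with $\psi_\varepsilon\not\equiv0$ the spinor field $\psi=\psi_\varepsilon$ on $M$ is smooth, has no zeros, and has the following properties. 1. It attains equality in Hijazi's inequality: there is $\lambda\in\mathbb R$ with $D\psi=\lambda\psi$, $D$ being the Dirac operator of $M$, and $$\lambda^2=\inf_M\Big(\tfrac14S+|T^\psi|^2\Big),$$ where $S$ is the scalar curvature of $M$. 2. $2T^\psi=h$. -/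

import Mathlib

open scoped Manifold ContDiff Topology
open Bundle VectorField

noncomputable section

section LeviCivita

variable {E : Type*} [NormedAddCommGroup E] [NormedSpace ℝ E] [FiniteDimensional ℝ E]
  {H : Type*} [TopologicalSpace H] {I : ModelWithCorners ℝ E H}
  {M : Type*} [TopologicalSpace M] [ChartedSpace H M] [IsManifold I ∞ M]

lemma metric_contMDiffWithinAt
    (g : ContMDiffRiemannianMetric I ∞ E (fun x : M ↦ TangentSpace I x))
    {X Y : Π x : M, TangentSpace I x} {s : Set M} {x : M}
    (hX : ContMDiffWithinAt I I.tangent ∞ (fun y ↦ (X y : TangentBundle I M)) s x)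
    (hY : ContMDiffWithinAt I I.tangent ∞ (fun y ↦ (Y y : TangentBundle I M)) s x) :
    ContMDiffWithinAt I 𝓘(ℝ, ℝ) ∞ (fun y ↦ g.inner y (X y) (Y y)) s x := by
  have : ContMDiffWithinAt I (I.prod 𝓘(ℝ)) ∞
      (fun m ↦ TotalSpace.mk' ℝ (E := Bundle.Trivial M ℝ) m (g.inner m (X m) (Y m))) s x := by
    apply ContMDiffWithinAt.clm_bundle_apply₂ (F₁ := E) (F₂ := E)
    · exact g.contMDiff.contMDiffAt.contMDiffWithinAt
    · exact hX
    · exact hY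
  simp only [contMDiffWithinAt_totalSpace] at this
  exact this.2

lemma metric_mdifferentiableAt
    (g : ContMDiffRiemannianMetric I ∞ E (fun x : M ↦ TangentSpace I x))
    {X Y : Π x : M, TangentSpace I x} {x : M} (hX : MDiffAt (T% X) x) (hY : MDiffAt (T% Y) x) :
    MDiffAt (fun y ↦ g.inner y (X y) (Y y)) x := by
  have : MDifferentiableAt I (I.prod 𝓘(ℝ))
      (fun m ↦ TotalSpace.mk' ℝ (E := Bundle.Trivial M ℝ) m (g.inner m (X m) (Y m))) x := by
    apply MDifferentiableAt.clm_bundle_apply₂ (F₁ := E) (F₂ := E)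
    · exact g.contMDiff.contMDiffAt.mdifferentiableAt (by simp)
    · exact hX
    · exact hY
  simp only [mdifferentiableAt_totalSpace] at this
  exact this.2

/-- `D` is the Levi-Civita connection of `g`: it is compatible with `g` and torsion free.
(`D Y x v` is `∇_v Y` at `x`.) -/
structure IsLeviCivita (g : ContMDiffRiemannianMetric I ∞ E (fun x : M ↦ TangentSpace I x))
    (D : CovariantDerivative I E (fun x : M ↦ TangentSpace I x)) : Prop where
  metric : ∀ (Y Z : Π x : M, TangentSpace I x) (x : M) (v : TangentSpace I x),
    MDiffAt (T% Y) x → MDiffAt (T% Z) x →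
      mvfderiv I (fun y ↦ g.inner y (Y y) (Z y)) x v
        = g.inner x (D Y x v) (Z x) + g.inner x (Y x) (D Z x v)
  torsion_free : ∀ (X Y : Π x : M, TangentSpace I x) (x : M),
    MDiffAt (T% X) x → MDiffAt (T% Y) x →
      D Y x (X x) - D X x (Y x) = mlieBracket I X Y x

/-- The right hand side of the Koszul formula for `g(∇_X Y, Z)`. -/
def koszul (g : ContMDiffRiemannianMetric I ∞ E (fun x : M ↦ TangentSpace I x))
    (X Y Z : Π x : M, TangentSpace I x) (x : M) : ℝ :=
  (1 / 2 : ℝ) * (mvfderiv I (fun y ↦ g.inner y (Y y) (Z y)) x (X x)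
    + mvfderiv I (fun y ↦ g.inner y (X y) (Z y)) x (Y x)
    - mvfderiv I (fun y ↦ g.inner y (X y) (Y y)) x (Z x)
    + g.inner x (mlieBracket I X Y x) (Z x)
    - g.inner x (mlieBracket I X Z x) (Y x)
    - g.inner x (mlieBracket I Y Z x) (X x))

variable (g : ContMDiffRiemannianMetric I ∞ E (fun x : M ↦ TangentSpace I x))
  {X X' Y Y' Z Z' : Π x : M, TangentSpace I x} {x : M}

lemma koszul_add_right
    (hX : MDiffAt (T% X) x) (hY : MDiffAt (T% Y) x) (hZ : MDiffAt (T% Z) x)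
    (hZ' : MDiffAt (T% Z') x) :
    koszul g X Y (Z + Z') x = koszul g X Y Z x + koszul g X Y Z' x := by
  unfold koszul
  simp only [Pi.add_apply, map_add, mlieBracket_add_right hZ hZ', add_apply]
  rw [mvfderiv_fun_add (metric_mdifferentiableAt g hY hZ) (metric_mdifferentiableAt g hY hZ'),
    mvfderiv_fun_add (metric_mdifferentiableAt g hX hZ) (metric_mdifferentiableAt g hX hZ')]
  simp only [add_apply]
  ring

lemma koszul_add_mid
    (hX : MDiffAt (T% X) x) (hY : MDiffAt (T% Y) x) (hY' : MDiffAt (T% Y') x)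
    (hZ : MDiffAt (T% Z) x) :
    koszul g X (Y + Y') Z x = koszul g X Y Z x + koszul g X Y' Z x := by
  unfold koszul
  simp only [Pi.add_apply, map_add, mlieBracket_add_right hY hY',
    mlieBracket_add_left hY hY', add_apply]
  rw [mvfderiv_fun_add (metric_mdifferentiableAt g hY hZ) (metric_mdifferentiableAt g hY' hZ),
    mvfderiv_fun_add (metric_mdifferentiableAt g hX hY) (metric_mdifferentiableAt g hX hY')]
  simp only [add_apply]
  ring

lemma koszul_add_left
    (hX : MDiffAt (T% X) x) (hX' : MDiffAt (T% X') x) (hY : MDiffAt (T% Y) x)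
    (hZ : MDiffAt (T% Z) x) :
    koszul g (X + X') Y Z x = koszul g X Y Z x + koszul g X' Y Z x := by
  unfold koszul
  simp only [Pi.add_apply, map_add, mlieBracket_add_left hX hX', add_apply]
  rw [mvfderiv_fun_add (metric_mdifferentiableAt g hX hZ) (metric_mdifferentiableAt g hX' hZ),
    mvfderiv_fun_add (metric_mdifferentiableAt g hX hY) (metric_mdifferentiableAt g hX' hY)]
  simp only [add_apply]
  ring

lemma koszul_smul_right {f : M → ℝ} (hg : MDiffAt f x)
    (hX : MDiffAt (T% X) x) (hY : MDiffAt (T% Y) x) (hZ : MDiffAt (T% Z) x) :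
    koszul g X Y (f • Z) x = f x * koszul g X Y Z x := by
  unfold koszul
  simp only [Pi.smul_apply', map_smul, mlieBracket_smul_right hg hZ, map_add,
    add_apply, smul_apply, smul_eq_mul]
  rw [mvfderiv_fun_mul hg (metric_mdifferentiableAt g hY hZ),
    mvfderiv_fun_mul hg (metric_mdifferentiableAt g hX hZ)]
  simp only [add_apply, smul_apply, smul_eq_mul]
  rw [g.symm x (Z x) (Y x), g.symm x (Z x) (X x)]
  ring

lemma koszul_smul_left {f : M → ℝ} (hg : MDiffAt f x)
    (hX : MDiffAt (T% X) x) (hY : MDiffAt (T% Y) x) (hZ : MDiffAt (T% Z) x) :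
    koszul g (f • X) Y Z x = f x * koszul g X Y Z x := by
  unfold koszul
  simp only [Pi.smul_apply', map_smul, mlieBracket_smul_left hg hX, map_add, neg_smul, map_neg,
    add_apply, smul_apply, smul_eq_mul,
    neg_apply]
  rw [mvfderiv_fun_mul hg (metric_mdifferentiableAt g hX hZ),
    mvfderiv_fun_mul hg (metric_mdifferentiableAt g hX hY)]
  simp only [add_apply, smul_apply, smul_eq_mul]
  ring

lemma koszul_smul_mid {f : M → ℝ} (hg : MDiffAt f x)
    (hX : MDiffAt (T% X) x) (hY : MDiffAt (T% Y) x) (hZ : MDiffAt (T% Z) x) :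
    koszul g X (f • Y) Z x =
      f x * koszul g X Y Z x + mvfderiv I f x (X x) * g.inner x (Y x) (Z x) := by
  unfold koszul
  simp only [Pi.smul_apply', map_smul, mlieBracket_smul_left hg hY, mlieBracket_smul_right hg hY,
    map_add, neg_smul, map_neg, add_apply, smul_apply,
    smul_eq_mul, neg_apply]
  rw [mvfderiv_fun_mul hg (metric_mdifferentiableAt g hY hZ),
    mvfderiv_fun_mul hg (metric_mdifferentiableAt g hX hY)]
  simp only [add_apply, smul_apply, smul_eq_mul]
  rw [g.symm x (Y x) (X x)]
  ring

lemma koszul_tensorial_left (hY : MDiffAt (T% Y) x) (hZ : MDiffAt (T% Z) x) :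
    TensorialAt I E (fun X : Π x : M, TangentSpace I x ↦ koszul g X Y Z x) x where
  smul hf hX := koszul_smul_left g hf hX hY hZ
  add hX hX' := koszul_add_left g hX hX' hY hZ

lemma koszul_tensorial_right (hX : MDiffAt (T% X) x) (hY : MDiffAt (T% Y) x) :
    TensorialAt I E (fun Z : Π x : M, TangentSpace I x ↦ koszul g X Y Z x) x where
  smul hf hZ := koszul_smul_right g hf hX hY hZ
  add hZ hZ' := koszul_add_right g hX hY hZ hZ'

/-- The Koszul formula as a bilinear form. -/
def koszulForm (hY : MDiffAt (T% Y) x) : TangentSpace I x →L[ℝ] TangentSpace I x →L[ℝ] ℝ :=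
  TensorialAt.mkHom₂ (I := I) (F := E) (F' := E) (fun X Z ↦ koszul g X Y Z x) x
    (fun _ hZ ↦ koszul_tensorial_left g hY hZ) (fun _ hX ↦ koszul_tensorial_right g hX hY)

lemma koszulForm_apply (hY : MDiffAt (T% Y) x) (hX : MDiffAt (T% X) x) (hZ : MDiffAt (T% Z) x) :
    koszulForm g hY (X x) (Z x) = koszul g X Y Z x :=
  TensorialAt.mkHom₂_apply (I := I) (F := E) (F' := E) (Φ := fun X Z ↦ koszul g X Y Z x)
    (fun _ hZ ↦ koszul_tensorial_left g hY hZ) (fun _ hX ↦ koszul_tensorial_right g hX hY) hX hZ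

instance (x : M) : FiniteDimensional ℝ (TangentSpace I x) :=
  inferInstanceAs (FiniteDimensional ℝ E)

instance (x : M) : T2Space (TangentSpace I x) :=
  inferInstanceAs (T2Space E)

/-- The isomorphism `T_x M ≃ (T_x M)*` given by the metric. -/
def metricEquiv (x : M) : TangentSpace I x ≃ₗ[ℝ] Module.Dual ℝ (TangentSpace I x) :=
  LinearEquiv.ofBijective
    (LinearMap.mk₂ ℝ (fun u v ↦ g.inner x u v) (by simp) (by simp) (by simp) (by simp)) (by
      have hinj : Function.Injective
          (LinearMap.mk₂ ℝ (fun u v ↦ g.inner x u v) (by simp) (by simp) (by simp) (by simp) :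
            TangentSpace I x →ₗ[ℝ] Module.Dual ℝ (TangentSpace I x)) := by
        rw [← LinearMap.ker_eq_bot, LinearMap.ker_eq_bot']
        intro u hu
        by_contra hne
        have h1 : 0 < g.inner x u u := g.pos x u hne
        have h2 : g.inner x u u = 0 := congrArg (fun φ ↦ φ u) hu
        exact h1.ne' h2
      exact ⟨hinj, (LinearMap.injective_iff_surjective_of_finrank_eq_finrank
        Subspace.dual_finrank_eq.symm).1 hinj⟩)

lemma metricEquiv_apply (u v : TangentSpace I x) : metricEquiv g x u v = g.inner x u v := rfl

lemma inner_metricEquiv_symm (φ : Module.Dual ℝ (TangentSpace I x)) (v : TangentSpace I x) :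
    g.inner x ((metricEquiv g x).symm φ) v = φ v := by
  rw [← metricEquiv_apply, LinearEquiv.apply_symm_apply]

lemma metric_ext {u v : TangentSpace I x} (h : ∀ w, g.inner x u w = g.inner x v w) : u = v :=
  (metricEquiv g x).injective (LinearMap.ext h)

open scoped Classical in
/-- The vector-valued one-form `v ↦ ∇_v Y` determined by the Koszul formula. -/
def leviCivitaFun (Y : Π x : M, TangentSpace I x) (x : M) :
    TangentSpace I x →L[ℝ] TangentSpace I x :=
  if hY : MDiffAt (T% Y) x then
    LinearMap.toContinuousLinearMap ((metricEquiv g x).symm.toLinearMap ∘ₗ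
      (LinearMap.mk₂ ℝ (fun u v ↦ koszulForm g hY u v)
        (by simp) (by simp) (by simp) (by simp)))
  else 0

lemma inner_leviCivitaFun (hY : MDiffAt (T% Y) x) (u v : TangentSpace I x) :
    g.inner x (leviCivitaFun g Y x u) v = koszulForm g hY u v := by
  simp only [leviCivitaFun, hY, dif_pos]
  exact inner_metricEquiv_symm g _ v

lemma inner_leviCivitaFun_apply (hX : MDiffAt (T% X) x) (hY : MDiffAt (T% Y) x)
    (hZ : MDiffAt (T% Z) x) :
    g.inner x (leviCivitaFun g Y x (X x)) (Z x) = koszul g X Y Z x := by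
  rw [inner_leviCivitaFun g hY, koszulForm_apply g hY hX hZ]

lemma exists_field (v : TangentSpace I x) :
    ∃ V : Π x : M, TangentSpace I x, MDiffAt (T% V) x ∧ V x = v :=
  ⟨FiberBundle.extend E v, FiberBundle.mdifferentiableAt_extend I E v, by simp⟩

lemma leviCivita_ext {u v : TangentSpace I x}
    (h : ∀ Z : Π x : M, TangentSpace I x, MDiffAt (T% Z) x →
      g.inner x u (Z x) = g.inner x v (Z x)) : u = v := by
  refine metric_ext g fun w ↦ ?_
  obtain ⟨W, hW, rfl⟩ := exists_field w
  exact h W hW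

/-- The Levi-Civita connection. -/
def leviCivita : CovariantDerivative I E (fun x : M ↦ TangentSpace I x) where
  toFun := leviCivitaFun g
  isCovariantDerivativeOnUniv :=
    { add := by
        intro Y Y' x hY hY' _
        ext u
        obtain ⟨X, hX, rfl⟩ := exists_field u
        refine leviCivita_ext g fun Z hZ ↦ ?_
        rw [inner_leviCivitaFun_apply g hX (mdifferentiableAt_add_section hY hY') hZ,
          koszul_add_mid g hX hY hY' hZ, ← inner_leviCivitaFun_apply g hX hY hZ,
          ← inner_leviCivitaFun_apply g hX hY' hZ]
        simp
      leibniz := by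
        intro Y f x hY hf _
        ext u
        obtain ⟨X, hX, rfl⟩ := exists_field u
        refine leviCivita_ext g fun Z hZ ↦ ?_
        rw [inner_leviCivitaFun_apply g hX (hf.smul_section hY) hZ,
          koszul_smul_mid g hf hX hY hZ, ← inner_leviCivitaFun_apply g hX hY hZ]
        simp }

/-- The connection just constructed is metric and torsion free. -/
theorem isLeviCivita_leviCivita : IsLeviCivita g (leviCivita g) where
  metric := by
    intro Y Z x v hY hZ
    obtain ⟨X, hX, rfl⟩ := exists_field v
    change _ = g.inner x (leviCivitaFun g Y x (X x)) (Z x)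
      + g.inner x (Y x) (leviCivitaFun g Z x (X x))
    rw [g.symm x (Y x), inner_leviCivitaFun_apply g hX hY hZ, inner_leviCivitaFun_apply g hX hZ hY]
    have h : (fun y ↦ g.inner y (Z y) (Y y)) = fun y ↦ g.inner y (Y y) (Z y) :=
      funext fun y ↦ g.symm y _ _
    simp only [koszul, h]
    rw [mlieBracket_swap_apply (V := Z) (W := Y)]
    simp only [map_neg, neg_apply]
    ring
  torsion_free := by
    intro X Y x hX hY
    refine leviCivita_ext g fun Z hZ ↦ ?_
    change g.inner x (leviCivitaFun g Y x (X x) - leviCivitaFun g X x (Y x)) (Z x) = _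
    rw [map_sub, sub_apply, inner_leviCivitaFun_apply g hX hY hZ,
      inner_leviCivitaFun_apply g hY hX hZ]
    have h : (fun y ↦ g.inner y (Y y) (X y)) = fun y ↦ g.inner y (X y) (Y y) :=
      funext fun y ↦ g.symm y _ _
    simp only [koszul, h]
    rw [mlieBracket_swap_apply (V := Y) (W := X)]
    simp only [map_neg, neg_apply]
    ring


variable (g : ContMDiffRiemannianMetric I ∞ E (fun x : M ↦ TangentSpace I x))
lemma exists_gramSchmidt {U : Set M} (k : ℕ) (s : Fin k → Π x : M, TangentSpace I x)
    (hs : ∀ i, ContMDiffOn I I.tangent ∞ (fun y ↦ (s i y : TangentBundle I M)) U)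
    (hli : ∀ y ∈ U, LinearIndependent ℝ (fun i ↦ s i y)) :
    ∃ e : Fin k → Π x : M, TangentSpace I x,
      (∀ i, ContMDiffOn I I.tangent ∞ (fun y ↦ (e i y : TangentBundle I M)) U) ∧
      (∀ y ∈ U, ∀ i j, g.inner y (e i y) (e j y) = if i = j then 1 else 0) ∧
      (∀ y ∈ U, ∀ i, e i y ∈ Submodule.span ℝ (Set.range fun i ↦ s i y)) := by
  induction k with
  | zero => exact ⟨s, hs, fun _ _ i ↦ i.elim0, fun _ _ i ↦ i.elim0⟩
  | succ k ih =>
    obtain ⟨e, he, hon, hspan⟩ := ih (fun i ↦ s i.castSucc) (fun i ↦ hs _)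
      (fun y hy ↦ (hli y hy).comp _ (Fin.castSucc_injective k))
    set v : Π x : M, TangentSpace I x :=
      fun y ↦ s (Fin.last k) y - ∑ i, g.inner y (s (Fin.last k) y) (e i y) • e i y with hv
    have hvs : ContMDiffOn I I.tangent ∞ (fun y ↦ (v y : TangentBundle I M)) U := by
      refine (hs _).sub_section (ContMDiffOn.sum_section fun i _ ↦ ?_)
      exact ContMDiffOn.smul_section
        (fun y hy ↦ metric_contMDiffWithinAt g (hs _ y hy) (he i y hy)) (he i)
    have hvsp : ∀ y ∈ U, v y ≠ 0 := by
      intro y hy h0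
      have h1 := (linearIndependent_finSucc'.1 (hli y hy)).2
      apply h1
      have h2 : s (Fin.last k) y = ∑ i, g.inner y (s (Fin.last k) y) (e i y) • e i y :=
        sub_eq_zero.1 h0
      rw [h2]
      exact Submodule.sum_mem _ fun i _ ↦ Submodule.smul_mem _ _ (hspan y hy i)
    have hpos : ∀ y ∈ U, 0 < g.inner y (v y) (v y) := fun y hy ↦ g.pos y _ (hvsp y hy)
    have hve : ∀ y ∈ U, ∀ j, g.inner y (v y) (e j y) = 0 := by
      intro y hy j
      simp only [hv, map_sub, map_sum, map_smul, sub_apply, sum_apply, smul_apply, smul_eq_mul,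
        hon y hy]
      simp
    set w : Π x : M, TangentSpace I x :=
      fun y ↦ (Real.sqrt (g.inner y (v y) (v y)))⁻¹ • v y with hw
    have hws : ContMDiffOn I I.tangent ∞ (fun y ↦ (w y : TangentBundle I M)) U := by
      refine ContMDiffOn.smul_section (fun y hy ↦ ?_) hvs
      have h1 : ContMDiffWithinAt I 𝓘(ℝ, ℝ) ∞ (fun y ↦ g.inner y (v y) (v y)) U y :=
        metric_contMDiffWithinAt g (hvs y hy) (hvs y hy)
      have h2 : ContDiffAt ℝ ∞ (fun t : ℝ ↦ (Real.sqrt t)⁻¹) (g.inner y (v y) (v y)) :=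
        (Real.contDiffAt_sqrt (hpos y hy).ne').inv (Real.sqrt_pos.2 (hpos y hy)).ne'
      exact ContMDiffAt.comp_contMDiffWithinAt (I' := 𝓘(ℝ, ℝ)) (g := fun t : ℝ ↦ (Real.sqrt t)⁻¹) y h2.contMDiffAt h1
    refine ⟨Fin.snoc (α := fun _ ↦ Π x : M, TangentSpace I x) e w, ?_, ?_, ?_⟩
    · intro i
      refine Fin.lastCases ?_ (fun i ↦ ?_) i
      · simpa using hws
      · simpa using he i
    · intro y hy i j
      have hwe : ∀ j, g.inner y (w y) (e j y) = 0 := fun j ↦ by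
        simp [hw, hve y hy j]
      have hww : g.inner y (w y) (w y) = 1 := by
        have h3 := hpos y hy
        simp only [hw, map_smul, smul_apply, smul_eq_mul]
        rw [← mul_assoc, ← mul_inv, Real.mul_self_sqrt h3.le, inv_mul_cancel₀ h3.ne']
      refine Fin.lastCases ?_ (fun i ↦ ?_) i <;> refine Fin.lastCases ?_ (fun j ↦ ?_) j
      · simpa using hww
      · simpa [(Fin.castSucc_ne_last j).symm] using hwe j
      · rw [g.symm]; simpa using hwe i
      · simpa using hon y hy i j
    · intro y hy i
      have hsub : Submodule.span ℝ (Set.range fun i : Fin k ↦ s i.castSucc y) ≤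
          Submodule.span ℝ (Set.range fun i ↦ s i y) :=
        Submodule.span_mono (by rintro _ ⟨i, rfl⟩; exact ⟨_, rfl⟩)
      refine Fin.lastCases ?_ (fun i ↦ ?_) i
      · simp only [Fin.snoc_last]
        refine Submodule.smul_mem _ _ (Submodule.sub_mem _ (Submodule.subset_span ⟨_, rfl⟩)
          (Submodule.sum_mem _ fun i _ ↦ Submodule.smul_mem _ _ (hsub (hspan y hy i))))
      · simp only [Fin.snoc_castSucc]
        exact hsub (hspan y hy i)

lemma exists_orthonormal_frame {m : ℕ} (hm : Module.finrank ℝ E = m) (x : M) :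
    ∃ (U : Set M) (e : Fin m → Π x : M, TangentSpace I x), IsOpen U ∧ x ∈ U ∧
      (∀ i, ContMDiffOn I I.tangent ∞ (fun y ↦ (e i y : TangentBundle I M)) U) ∧
      (∀ y ∈ U, ∀ i j, g.inner y (e i y) (e j y) = if i = j then 1 else 0) := by
  set t := trivializationAt E (fun x : M ↦ TangentSpace I x) x
  let b : Module.Basis (Fin m) ℝ E := Module.finBasisOfFinrankEq ℝ E hm
  have ht := t.isLocalFrameOn_localFrame_baseSet I ∞ b
  obtain ⟨e, he, hon, -⟩ := exists_gramSchmidt g (U := t.baseSet) m (t.localFrame b)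
    ht.contMDiffOn (fun y hy ↦ ht.linearIndependent hy)
  exact ⟨t.baseSet, e, t.open_baseSet, FiberBundle.mem_baseSet_trivializationAt' x, he, hon⟩
end LeviCivita

section Clifford

/-- The quadratic form `v ↦ -|v|²` on `ℝᵐ`. -/
def cliffordForm (m : ℕ) : QuadraticForm ℝ (Fin m → ℝ) :=
  QuadraticMap.weightedSumSquares ℝ (fun _ : Fin m ↦ (-1 : ℝ))

lemma cliffordForm_apply {m : ℕ} (v : Fin m → ℝ) : cliffordForm m v = -∑ i, v i * v i := by
  simp [cliffordForm, QuadraticMap.weightedSumSquares_apply]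

/-- The real Clifford algebra `Cl_m`, generated by `ℝᵐ` with `v * v = -|v|²`. -/
abbrev Cl (m : ℕ) := CliffordAlgebra (cliffordForm m)

/-- The standard generators of `Cl_m`. -/
def clGen {m : ℕ} (i : Fin m) : Cl m := CliffordAlgebra.ι (cliffordForm m) (Pi.single i 1)

instance (m : ℕ) : Module.Finite ℝ (Cl m) :=
  haveI : Module.Finite ℝ (ExteriorAlgebra ℝ (Fin m → ℝ)) :=
    Module.Finite.of_basis (Pi.basisFun ℝ (Fin m)).ExteriorAlgebra
  Module.Finite.equiv (CliffordAlgebra.equivExterior (cliffordForm m)).symm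

/-- `Cl_m` carries its topology as a finite dimensional real vector space. -/
instance (m : ℕ) : TopologicalSpace (Cl m) := moduleTopology ℝ (Cl m)

instance (m : ℕ) : IsModuleTopology ℝ (Cl m) := ⟨rfl⟩

/-- The group `Spin(m)`, inside `Cl_m`. -/
abbrev Spin (m : ℕ) := spinGroup (cliffordForm m)

/-- The component of degree one of an element of the Clifford algebra. -/
def vecPart (m : ℕ) : Cl m →ₗ[ℝ] (Fin m → ℝ) :=
  ExteriorAlgebra.ιInv.comp (CliffordAlgebra.equivExterior (cliffordForm m)).toLinearMap

lemma vecPart_ι {m : ℕ} (v : Fin m → ℝ) :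
    vecPart m (CliffordAlgebra.ι (cliffordForm m) v) = v := by
  have : CliffordAlgebra.equivExterior (cliffordForm m) (CliffordAlgebra.ι (cliffordForm m) v)
      = ExteriorAlgebra.ι ℝ v := by
    simp [CliffordAlgebra.equivExterior, CliffordAlgebra.changeFormEquiv,
      CliffordAlgebra.changeForm_ι]
  simp only [vecPart, LinearMap.comp_apply, LinearEquiv.coe_coe, this]
  exact ExteriorAlgebra.ι_leftInverse v

lemma cl_continuous_of_linear {m : ℕ} {V : Type*} [AddCommGroup V] [Module ℝ V]
    [TopologicalSpace V] [ContinuousAdd V] [ContinuousSMul ℝ V] (f : Cl m →ₗ[ℝ] V) :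
    Continuous f :=
  IsModuleTopology.continuous_of_linearMap f

lemma cl_continuous_mul (m : ℕ) : Continuous (fun p : Cl m × Cl m ↦ p.1 * p.2) :=
  IsModuleTopology.continuous_mul_of_finite ℝ (Cl m)

lemma cl_continuous_star (m : ℕ) : Continuous (star : Cl m → Cl m) := by
  have : ContinuousAdd (Cl m) := IsModuleTopology.toContinuousAdd ℝ (Cl m)
  have : (star : Cl m → Cl m) = (CliffordAlgebra.reverse.comp
      (CliffordAlgebra.involute (Q := cliffordForm m)).toLinearMap) := by
    ext x; simp [CliffordAlgebra.star_def]
  rw [this]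
  exact cl_continuous_of_linear _

/-- The matrix of the vector representation `v ↦ s v s⁻¹` of `Spin(m)` on `ℝᵐ`; this is the
double cover `Spin(m) → SO(m)`. -/
def spinMatrix {m : ℕ} (s : Spin m) : Matrix (Fin m) (Fin m) ℝ :=
  Matrix.of fun i j ↦ vecPart m ((s : Cl m) * clGen j * star (s : Cl m)) i

lemma spin_conj_mem {m : ℕ} (s : Spin m) (v : Fin m → ℝ) :
    ∃ w, CliffordAlgebra.ι (cliffordForm m) w
      = (s : Cl m) * CliffordAlgebra.ι (cliffordForm m) v * star (s : Cl m) := by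
  have h := spinGroup.conjAct_smul_ι_mem_range_ι (x := spinGroup.toUnits s) s.2 v
  obtain ⟨w, hw⟩ := h
  refine ⟨w, ?_⟩
  rw [hw, ConjAct.units_smul_def]
  rfl

lemma spinMatrix_mulVec {m : ℕ} (s : Spin m) (v : Fin m → ℝ) :
    CliffordAlgebra.ι (cliffordForm m) ((spinMatrix s).mulVec v)
      = (s : Cl m) * CliffordAlgebra.ι (cliffordForm m) v * star (s : Cl m) := by
  obtain ⟨w, hw⟩ := spin_conj_mem s v
  rw [← hw]
  congr 1
  have h1 : w = vecPart m ((s : Cl m) * CliffordAlgebra.ι (cliffordForm m) v * star (s : Cl m)) := by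
    rw [← hw, vecPart_ι]
  rw [h1]
  have h2 : v = ∑ j, v j • (Pi.single j 1 : Fin m → ℝ) := by
    ext i; simp [Finset.sum_apply, Pi.single_apply]
  conv_rhs => rw [h2]
  ext i
  simp only [map_sum, map_smul, Finset.mul_sum, Finset.sum_mul, Finset.sum_apply, Matrix.mulVec,
    dotProduct, spinMatrix, Matrix.of_apply, mul_smul_comm, smul_mul_assoc, Pi.smul_apply, smul_eq_mul, clGen]
  exact Finset.sum_congr rfl fun j _ ↦ mul_comm _ _

lemma ι_cl_injective (m : ℕ) : Function.Injective (CliffordAlgebra.ι (cliffordForm m)) :=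
  Function.LeftInverse.injective (g := vecPart m) vecPart_ι

lemma spinMatrix_mul {m : ℕ} (s t : Spin m) :
    spinMatrix (s * t) = spinMatrix s * spinMatrix t := by
  apply Matrix.mulVec_injective
  funext v
  apply ι_cl_injective
  rw [← Matrix.mulVec_mulVec, spinMatrix_mulVec, spinMatrix_mulVec, spinMatrix_mulVec]
  simp [mul_assoc]

lemma spinMatrix_one {m : ℕ} : spinMatrix (1 : Spin m) = 1 := by
  apply Matrix.mulVec_injective
  funext v
  apply ι_cl_injective
  rw [spinMatrix_mulVec]
  simp

lemma spinMatrix_orthogonal {m : ℕ} (s : Spin m) (j k : Fin m) :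
    ∑ i, spinMatrix s i j * spinMatrix s i k = if j = k then 1 else 0 := by
  have hQ : ∀ v, cliffordForm m ((spinMatrix s).mulVec v) = cliffordForm m v := by
    intro v
    have h1 := CliffordAlgebra.ι_sq_scalar (cliffordForm m) ((spinMatrix s).mulVec v)
    rw [spinMatrix_mulVec] at h1
    have h2 : (s : Cl m) * CliffordAlgebra.ι (cliffordForm m) v * star (s : Cl m) *
        ((s : Cl m) * CliffordAlgebra.ι (cliffordForm m) v * star (s : Cl m))
        = algebraMap ℝ _ (cliffordForm m v) := by
      calc _ = (s : Cl m) * CliffordAlgebra.ι (cliffordForm m) v * (star (s : Cl m) *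
        (s : Cl m)) * CliffordAlgebra.ι (cliffordForm m) v * star (s : Cl m) := by
              simp only [mul_assoc]
        _ = (s : Cl m) * (CliffordAlgebra.ι (cliffordForm m) v
              * CliffordAlgebra.ι (cliffordForm m) v) * star (s : Cl m) := by
              rw [spinGroup.star_mul_self_of_mem s.2]; simp only [mul_assoc, mul_one]
        _ = _ := by
          rw [CliffordAlgebra.ι_sq_scalar, ← Algebra.commutes, mul_assoc,
            spinGroup.mul_star_self_of_mem s.2, mul_one]
    rw [h2] at h1
    have hinj : Function.Injective (algebraMap ℝ (Cl m)) := FaithfulSMul.algebraMap_injective ℝ (Cl m)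

    exact (hinj h1).symm
  have hpol := congrArg₂ (fun a b ↦ a - b)
    (congrArg₂ (fun a b ↦ a - b) (hQ (Pi.single j 1 + Pi.single k 1)) (hQ (Pi.single j 1)))
    (hQ (Pi.single k 1))
  simp only [Matrix.mulVec_add, Matrix.mulVec_single_one, cliffordForm_apply, Pi.add_apply,
    Matrix.col_apply] at hpol
  have e1 : ∀ a b : Fin m → ℝ, -∑ i, (a i + b i) * (a i + b i) - -∑ i, a i * a i
      - -∑ i, b i * b i = -2 * ∑ i, a i * b i := by
    intro a b
    rw [Finset.mul_sum, ← Finset.sum_neg_distrib, ← Finset.sum_neg_distrib,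
      ← Finset.sum_neg_distrib, ← Finset.sum_sub_distrib, ← Finset.sum_sub_distrib]
    exact Finset.sum_congr rfl fun i _ ↦ by ring
  have e2 := e1 (fun i ↦ spinMatrix s i j) (fun i ↦ spinMatrix s i k)
  have e3 := e1 (Pi.single j 1) (Pi.single k 1)
  have e4 : ∑ i, spinMatrix s i j * spinMatrix s i k
      = ∑ i, (Pi.single j 1 : Fin m → ℝ) i * (Pi.single k 1 : Fin m → ℝ) i := by
    have : -2 * ∑ i, spinMatrix s i j * spinMatrix s i k
      = -2 * ∑ i, (Pi.single j 1 : Fin m → ℝ) i * (Pi.single k 1 : Fin m → ℝ) i := by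
      rw [← e2, ← e3]; exact hpol
    linarith
  rw [e4]
  simp [Pi.single_apply, eq_comm]

lemma continuous_spinMatrix (m : ℕ) (i j : Fin m) :
    Continuous (fun s : Spin m ↦ spinMatrix s i j) := by
  have : ContinuousAdd (Cl m) := IsModuleTopology.toContinuousAdd ℝ (Cl m)
  have h1 : Continuous (fun s : Spin m ↦ (s : Cl m) * clGen j * star (s : Cl m)) :=
    (cl_continuous_mul m).comp (((cl_continuous_mul m).comp
      (continuous_subtype_val.prodMk continuous_const)).prodMk
        ((cl_continuous_star m).comp continuous_subtype_val))
  exact (continuous_apply i).comp ((cl_continuous_of_linear (vecPart m)).comp h1)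

/-- The element `-1` of `Spin(m)`, for `m ≥ 1`. -/
def spinNegOne (m : ℕ) [NeZero m] : Spin m :=
  ⟨-1, by
    have h0 : (clGen (0 : Fin m) : Cl m) * clGen (0 : Fin m) = -1 := by
      rw [clGen, CliffordAlgebra.ι_sq_scalar, cliffordForm_apply]
      simp [Pi.single_apply]
    let u : (Cl m)ˣ := ⟨clGen 0, -clGen 0, by simp [h0], by simp [h0]⟩
    have hu : u ∈ lipschitzGroup (cliffordForm m) := Subgroup.subset_closure ⟨_, rfl⟩
    rw [spinGroup.mem_iff, pinGroup.mem_iff]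
    refine ⟨⟨⟨u * u, mul_mem hu hu, ?_⟩, ?_⟩, ?_⟩
    · simpa [u] using h0
    · rw [Unitary.mem_iff]; simp
    · exact neg_mem (one_mem _)⟩

/-- The inclusion `v ↦ (v, 0)` of `ℝⁿ` into `ℝⁿ⁺¹`, as an isometry of quadratic forms. -/
def snocZero (n : ℕ) : cliffordForm n →qᵢ cliffordForm (n + 1) where
  toFun v := Fin.snoc (α := fun _ ↦ ℝ) v 0
  map_add' v w := by
    ext i; refine Fin.lastCases ?_ (fun i ↦ ?_) i <;> simp
  map_smul' c v := by
    ext i; refine Fin.lastCases ?_ (fun i ↦ ?_) i <;> simp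
  map_app' v := by
    simp [cliffordForm_apply, Fin.sum_univ_castSucc]

/-- The inclusion `Cl_n → Cl_{n+1}`, sending the `i`-th generator to the `i`-th generator. -/
def clIncl (n : ℕ) : Cl n →ₐ[ℝ] Cl (n + 1) := CliffordAlgebra.map (snocZero n)

lemma clIncl_ι {n : ℕ} (v : Fin n → ℝ) :
    clIncl n (CliffordAlgebra.ι (cliffordForm n) v)
      = CliffordAlgebra.ι (cliffordForm (n + 1)) (Fin.snoc (α := fun _ ↦ ℝ) v 0) :=
  CliffordAlgebra.map_apply_ι _ _

lemma snoc_single {n : ℕ} (i : Fin n) :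
    Fin.snoc (α := fun _ ↦ ℝ) (Pi.single i 1) 0 = Pi.single (M := fun _ ↦ ℝ) i.castSucc 1 := by
  ext j
  refine Fin.lastCases ?_ (fun j ↦ ?_) j
  · simp [(Fin.castSucc_lt_last i).ne']
  · simp [Pi.single_apply]

lemma clIncl_clGen {n : ℕ} (i : Fin n) : clIncl n (clGen i) = clGen i.castSucc := by
  rw [clGen, clIncl_ι, snoc_single, clGen]

lemma clIncl_star {n : ℕ} (x : Cl n) : clIncl n (star x) = star (clIncl n x) := by
  induction x using CliffordAlgebra.induction with
  | algebraMap r => simp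
  | ι v => rw [CliffordAlgebra.star_ι, map_neg, clIncl_ι, CliffordAlgebra.star_ι]
  | mul a b ha hb => rw [star_mul, map_mul, map_mul, star_mul, ha, hb]
  | add a b ha hb => rw [star_add, map_add, map_add, star_add, ha, hb]

lemma clGen_last_anticomm {n : ℕ} (v : Fin n → ℝ) :
    CliffordAlgebra.ι (cliffordForm (n + 1)) (Fin.snoc (α := fun _ ↦ ℝ) v 0) * clGen (Fin.last n)
      = -(clGen (Fin.last n)
        * CliffordAlgebra.ι (cliffordForm (n + 1)) (Fin.snoc (α := fun _ ↦ ℝ) v 0)) := by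
  rw [eq_neg_iff_add_eq_zero, clGen, CliffordAlgebra.ι_mul_ι_add_swap, QuadraticMap.polar]
  simp only [cliffordForm_apply, Fin.sum_univ_castSucc]
  simp

lemma clIncl_even_induction {n : ℕ} {x : Cl n} (hx : x ∈ CliffordAlgebra.even (cliffordForm n)) :
    clIncl n x ∈ CliffordAlgebra.even (cliffordForm (n + 1))
      ∧ clIncl n x * clGen (Fin.last n) = clGen (Fin.last n) * clIncl n x := by
  induction x, hx using CliffordAlgebra.even_induction with
  | algebraMap r => simp [Algebra.commutes]
  | add x y hx hy h1 h2 =>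
    rw [map_add]
    exact ⟨add_mem h1.1 h2.1, by rw [add_mul, mul_add, h1.2, h2.2]⟩
  | ι_mul_ι_mul v w x hx h =>
    rw [map_mul, map_mul, clIncl_ι, clIncl_ι]
    refine ⟨mul_mem (CliffordAlgebra.ι_mul_ι_mem_evenOdd_zero _ _ _) h.1, ?_⟩
    rw [mul_assoc, h.2, ← mul_assoc, mul_assoc _ _ (clGen _), clGen_last_anticomm, mul_neg,
      ← mul_assoc, clGen_last_anticomm]
    simp only [mul_assoc, neg_mul, neg_neg]

/-- The inclusion `Spin(n) → Spin(n + 1)` covering `SO(n) → SO(n + 1)`, `A ↦ diag(A, 1)`. -/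
def spinIncl {n : ℕ} (s : Spin n) : Spin (n + 1) :=
  ⟨clIncl n s, by
    have h := (spinGroup.mem_iff.1 s.2)
    rw [spinGroup.mem_iff, pinGroup.mem_iff]
    obtain ⟨⟨⟨u, hu, hus⟩, h2⟩, h3⟩ := h
    refine ⟨⟨⟨Units.map (clIncl n).toRingHom.toMonoidHom u, ?_, by simp [← hus]⟩, ?_⟩,
      (clIncl_even_induction h3).1⟩
    · have : lipschitzGroup (cliffordForm n) ≤ (lipschitzGroup (cliffordForm (n + 1))).comap
          (Units.map (clIncl n).toRingHom.toMonoidHom) := by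
        refine (Subgroup.closure_le _).2 ?_
        rintro a ⟨v, hv⟩
        refine Subgroup.subset_closure ⟨Fin.snoc (α := fun _ ↦ ℝ) v 0, ?_⟩
        rw [← clIncl_ι, hv]
        rfl
      exact this hu
    · have h2 := Unitary.mem_iff.1 h2
      rw [Unitary.mem_iff]
      rw [← clIncl_star, ← map_mul, ← map_mul, h2.1, h2.2, map_one]
      exact ⟨rfl, rfl⟩⟩

lemma spinIncl_one {n : ℕ} : spinIncl (1 : Spin n) = 1 := Subtype.ext (map_one (clIncl n))

lemma spinIncl_mul {n : ℕ} (s t : Spin n) : spinIncl (s * t) = spinIncl s * spinIncl t :=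
  Subtype.ext (map_mul (clIncl n) _ _)

lemma spinIncl_negOne {n : ℕ} [NeZero n] : spinIncl (spinNegOne n) = spinNegOne (n + 1) :=
  Subtype.ext (by simp [spinIncl, spinNegOne])

lemma continuous_spinIncl (n : ℕ) : Continuous (spinIncl : Spin n → Spin (n + 1)) := by
  have : ContinuousAdd (Cl (n + 1)) := IsModuleTopology.toContinuousAdd ℝ (Cl (n + 1))
  have : ContinuousSMul ℝ (Cl (n + 1)) := IsModuleTopology.toContinuousSMul ℝ (Cl (n + 1))
  exact Continuous.subtype_mk
    ((cl_continuous_of_linear (clIncl n).toLinearMap).comp continuous_subtype_val) _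

lemma ι_spinIncl_mulVec {n : ℕ} (s : Spin n) (v : Fin n → ℝ) :
    (spinMatrix (spinIncl s)).mulVec (Fin.snoc (α := fun _ ↦ ℝ) v 0)
      = Fin.snoc (α := fun _ ↦ ℝ) ((spinMatrix s).mulVec v) 0 := by
  apply ι_cl_injective
  rw [spinMatrix_mulVec, ← clIncl_ι, ← clIncl_ι, spinMatrix_mulVec, map_mul, map_mul, clIncl_star]
  rfl

lemma spinMatrix_spinIncl_castSucc {n : ℕ} (s : Spin n) (i : Fin (n + 1)) (j : Fin n) :
    spinMatrix (spinIncl s) i j.castSucc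
      = Fin.snoc (α := fun _ ↦ ℝ) (fun i ↦ spinMatrix s i j) 0 i := by
  have h := congrFun (ι_spinIncl_mulVec s (Pi.single j 1)) i
  rw [snoc_single, Matrix.mulVec_single_one, Matrix.mulVec_single_one] at h
  exact h

lemma spinMatrix_spinIncl_last {n : ℕ} (s : Spin n) (i : Fin (n + 1)) :
    spinMatrix (spinIncl s) i (Fin.last n) = if i = Fin.last n then 1 else 0 := by
  have h : (spinMatrix (spinIncl s)).mulVec (Pi.single (Fin.last n) 1)
      = Pi.single (Fin.last n) 1 := by
    apply ι_cl_injective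
    rw [spinMatrix_mulVec]
    change clIncl n s * clGen _ * star (clIncl n (s : Cl n)) = clGen _
    rw [(clIncl_even_induction (spinGroup.mem_even s.2)).2, mul_assoc]
    have := spinGroup.mul_star_self_of_mem (spinIncl s).2
    change clIncl n s * star (clIncl n (s : Cl n)) = 1 at this
    rw [this, mul_one]
  have h := congrFun h i
  rw [Matrix.mulVec_single_one] at h
  simpa [Pi.single_apply] using h

end Clifford

section Frames

variable {m : ℕ} {M : Type*} [TopologicalSpace M] [ChartedSpace (EuclideanSpace ℝ (Fin m)) M]
  [IsManifold (𝓡 m) ∞ M]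

/-- Riemannian metrics on an `m`-dimensional manifold. -/
abbrev RiemMetric (m : ℕ) (M : Type*) [TopologicalSpace M]
    [ChartedSpace (EuclideanSpace ℝ (Fin m)) M] [IsManifold (𝓡 m) ∞ M] :=
  ContMDiffRiemannianMetric (𝓡 m) ∞ (EuclideanSpace ℝ (Fin m))
    (fun x : M ↦ TangentSpace (𝓡 m) x)

/-- An orthonormal frame of the tangent space of `M` at some point. -/
@[ext]
structure ONFrame (g : RiemMetric m M) where
  /-- The base point. -/
  base : M
  /-- The vectors of the frame. -/
  vec : Fin m → TangentSpace (𝓡 m) base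
  orthonormal : ∀ i j, g.inner base (vec i) (vec j) = if i = j then 1 else 0

variable {g : RiemMetric m M}

lemma ONFrame.linearIndependent (u : ONFrame g) : LinearIndependent ℝ u.vec := by
  rw [Fintype.linearIndependent_iff]
  intro c hc i
  have h := congrArg (g.inner u.base (u.vec i)) hc
  simpa [map_sum, u.orthonormal] using h

/-- An orthonormal frame as a basis. -/
def ONFrame.basis (u : ONFrame g) : Module.Basis (Fin m) ℝ (TangentSpace (𝓡 m) u.base) :=
  basisOfLinearIndependentOfCardEqFinrank' u.vec u.linearIndependent
    (by
      have : Module.finrank ℝ (TangentSpace (𝓡 m) u.base) = m :=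
        finrank_euclideanSpace_fin (𝕜 := ℝ) (n := m)
      simp [this])

/-- The point of the `m`-fold product of the tangent bundle given by a frame. -/
def ONFrame.toProd (u : ONFrame g) : M × (Fin m → TangentBundle (𝓡 m) M) :=
  (u.base, fun i ↦ ⟨u.base, u.vec i⟩)

/-- The bundle of orthonormal frames is topologized as a subset of the `m`-fold product of the
tangent bundle. -/
instance : TopologicalSpace (ONFrame g) := .induced ONFrame.toProd inferInstance

lemma ONFrame.continuous_iff {Z : Type*} [TopologicalSpace Z] {f : Z → ONFrame g} :
    Continuous f ↔ Continuous (fun z ↦ (f z).base) ∧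
      ∀ i, Continuous (fun z ↦ (⟨(f z).base, (f z).vec i⟩ : TangentBundle (𝓡 m) M)) := by
  rw [continuous_induced_rng, continuous_prodMk, continuous_pi_iff]
  rfl

lemma ONFrame.continuousOn_iff {Z : Type*} [TopologicalSpace Z] {f : Z → ONFrame g} {s : Set Z} :
    ContinuousOn f s ↔ ContinuousOn (fun z ↦ (f z).base) s ∧
      ∀ i, ContinuousOn (fun z ↦ (⟨(f z).base, (f z).vec i⟩ : TangentBundle (𝓡 m) M)) s := by
  simp only [continuousOn_iff_continuous_domRestrict]
  exact ONFrame.continuous_iff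

lemma continuous_tangent_sum {Z : Type*} [TopologicalSpace Z] {b : Z → M} {k : ℕ}
    {v : Fin k → Π z, TangentSpace (𝓡 m) (b z)} {a : Fin k → Z → ℝ} (hb : Continuous b)
    (hv : ∀ i, Continuous (fun z ↦ (⟨b z, v i z⟩ : TangentBundle (𝓡 m) M)))
    (ha : ∀ i, Continuous (a i)) :
    Continuous (fun z ↦ (⟨b z, ∑ i, a i z • v i z⟩ : TangentBundle (𝓡 m) M)) := by
  rw [continuous_iff_continuousAt]
  intro z₀
  rw [FiberBundle.continuousAt_totalSpace]
  refine ⟨hb.continuousAt, ?_⟩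
  have h1 : ∀ i, ContinuousAt (fun z ↦ ((trivializationAt (EuclideanSpace ℝ (Fin m))
      (TangentSpace (𝓡 m)) (b z₀)) (⟨b z, v i z⟩ : TangentBundle (𝓡 m) M)).2) z₀ :=
    fun i ↦ ((FiberBundle.continuousAt_totalSpace _ _).1 (hv i).continuousAt).2
  have h2 : ContinuousAt (fun z ↦ ∑ i, a i z • ((trivializationAt (EuclideanSpace ℝ (Fin m))
      (TangentSpace (𝓡 m)) (b z₀)) (⟨b z, v i z⟩ : TangentBundle (𝓡 m) M)).2) z₀ :=
    tendsto_finsetSum _ fun i _ ↦ ((ha i).continuousAt).smul (h1 i)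
  refine h2.congr ?_
  have h3 : ∀ᶠ z in 𝓝 z₀, b z ∈ (trivializationAt (EuclideanSpace ℝ (Fin m))
      (TangentSpace (𝓡 m)) (b z₀)).baseSet :=
    hb.continuousAt.eventually_mem ((trivializationAt (EuclideanSpace ℝ (Fin m))
      (TangentSpace (𝓡 m)) (b z₀)).open_baseSet.mem_nhds (FiberBundle.mem_baseSet_trivializationAt' _))
  filter_upwards [h3] with z hz
  have h4 := (trivializationAt (EuclideanSpace ℝ (Fin m))
      (TangentSpace (𝓡 m)) (b z₀)).linear ℝ hz
  have h5 := map_sum h4.mk' (fun i ↦ a i z • v i z) Finset.univ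
  simp only [map_smul, IsLinearMap.mk'_apply] at h5
  exact h5.symm

/-- The right action of `Spin(m)` on orthonormal frames, through `SO(m)`. -/
def ONFrame.act (u : ONFrame g) (s : Spin m) : ONFrame g where
  base := u.base
  vec j := ∑ i, spinMatrix s i j • u.vec i
  orthonormal j k := by
    rw [← spinMatrix_orthogonal s j k]
    simp [map_sum, sum_apply, u.orthonormal, mul_comm]

lemma ONFrame.act_eq (u : ONFrame g) (s : Spin m) (v : Fin m → TangentSpace (𝓡 m) u.base)
    (hv : ∀ j, v j = ∑ i, spinMatrix s i j • u.vec i) (h) : u.act s = ⟨u.base, v, h⟩ := by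
  obtain rfl : v = fun j ↦ ∑ i, spinMatrix s i j • u.vec i := funext hv
  rfl

lemma ONFrame.act_one (u : ONFrame g) : u.act 1 = u :=
  u.act_eq 1 u.vec (fun j ↦ by simp [spinMatrix_one, Matrix.one_apply]) u.orthonormal

lemma ONFrame.act_mul (u : ONFrame g) (s t : Spin m) : u.act (s * t) = (u.act s).act t := by
  refine u.act_eq (s * t) ((u.act s).act t).vec (fun j ↦ ?_) ((u.act s).act t).orthonormal
  change ∑ k, spinMatrix t k j • ∑ i, spinMatrix s i k • u.vec i = _
  simp only [spinMatrix_mul, Matrix.mul_apply, Finset.sum_smul, Finset.smul_sum, smul_smul]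
  rw [Finset.sum_comm]
  simp only [mul_comm]

lemma spinMatrix_negOne [NeZero m] : spinMatrix (spinNegOne m) = 1 := by
  rw [← spinMatrix_one]
  ext i j
  simp [spinMatrix, spinNegOne]

lemma ONFrame.act_negOne [NeZero m] (u : ONFrame g) : u.act (spinNegOne m) = u :=
  u.act_eq _ u.vec (fun j ↦ by simp [spinMatrix_negOne, Matrix.one_apply]) u.orthonormal

lemma ONFrame.continuous_act : Continuous (fun p : ONFrame g × Spin m ↦ p.1.act p.2) := by
  have hid := ONFrame.continuous_iff.1 (continuous_id (X := ONFrame g))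
  rw [ONFrame.continuous_iff]
  have hb : Continuous (fun p : ONFrame g × Spin m ↦ p.1.base) :=
    Continuous.comp (g := fun u : ONFrame g ↦ u.base) hid.1 continuous_fst
  refine ⟨hb, fun j ↦ ?_⟩
  exact continuous_tangent_sum (b := fun p : ONFrame g × Spin m ↦ p.1.base)
    (v := fun i p ↦ p.1.vec i) (a := fun i p ↦ spinMatrix p.2 i j)
    hb
    (fun i ↦ Continuous.comp (g := fun u : ONFrame g ↦
      (⟨u.base, u.vec i⟩ : TangentBundle (𝓡 m) M)) (hid.2 i) continuous_fst)
    (fun i ↦ (continuous_spinMatrix m i j).comp continuous_snd)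

/-- A frame is positively oriented for a choice `o` of orientations of the tangent spaces. -/
def ONFrame.IsPositive (o : Π x : M, Orientation ℝ (TangentSpace (𝓡 m) x) (Fin m))
    (u : ONFrame g) : Prop :=
  u.basis.orientation = o u.base

/-- A spin structure on the Riemannian manifold `(M, g)`, oriented by `o`: a principal
`Spin(m)`-bundle `P` with a double cover `frame`, equivariant along `Spin(m) → SO(m)`, onto the
bundle of positively oriented orthonormal frames. As `frame` is a local homeomorphism into the
bundle of all orthonormal frames, the orientations `o x` depend continuously on `x`. -/
structure SpinStructure [NeZero m] (g : RiemMetric m M)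
    (o : Π x : M, Orientation ℝ (TangentSpace (𝓡 m) x) (Fin m)) where
  /-- The total space of the principal bundle. -/
  P : Type*
  /-- Its topology. -/
  top : TopologicalSpace P
  /-- The right action of `Spin(m)`. -/
  act : P → Spin m → P
  act_one : ∀ p, act p 1 = p
  act_mul : ∀ p s t, act p (s * t) = act (act p s) t
  continuous_act : Continuous (fun q : P × Spin m ↦ act q.1 q.2)
  /-- The covering of the frame bundle. -/
  frame : P → ONFrame g
  frame_act : ∀ p s, frame (act p s) = (frame p).act s
  isLocalHomeomorph_frame : IsLocalHomeomorph frame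
  range_frame : ∀ u : ONFrame g, (∃ p, frame p = u) ↔ u.IsPositive o
  frame_eq_iff : ∀ p q, frame p = frame q ↔ q = p ∨ q = act p (spinNegOne m)
  act_negOne_ne : ∀ p, act p (spinNegOne m) ≠ p

attribute [instance] SpinStructure.top

variable [NeZero m] {o : Π x : M, Orientation ℝ (TangentSpace (𝓡 m) x) (Fin m)}

/-- A local section `lift` of a spin structure over an open set `dom`, lying over the smooth
orthonormal frame field `vec`. -/
structure LocalSpinFrame (S : SpinStructure g o) where
  /-- The domain. -/
  dom : Set M
  isOpen_dom : IsOpen dom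
  /-- The orthonormal frame field. -/
  vec : Fin m → Π x : M, TangentSpace (𝓡 m) x
  smooth_vec : ∀ i, ContMDiffOn (𝓡 m) (𝓡 m).tangent ∞
    (fun x ↦ (⟨x, vec i x⟩ : TangentBundle (𝓡 m) M)) dom
  /-- The section of the spin structure. -/
  lift : M → S.P
  continuousOn_lift : ContinuousOn lift dom
  frame_lift : ∀ x ∈ dom,
    ∃ h : ∀ i j, g.inner x (vec i x) (vec j x) = if i = j then 1 else 0,
      S.frame (lift x) = ⟨x, fun i ↦ vec i x, h⟩

lemma exists_positive_frame (g : RiemMetric m M)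
    (o : Π x : M, Orientation ℝ (TangentSpace (𝓡 m) x) (Fin m)) (x : M) :
    ∃ (U : Set M) (e : Fin m → Π x : M, TangentSpace (𝓡 m) x), IsOpen U ∧ x ∈ U ∧
      (∀ i, ContMDiffOn (𝓡 m) (𝓡 m).tangent ∞
        (fun y ↦ (⟨y, e i y⟩ : TangentBundle (𝓡 m) M)) U) ∧
      (∀ y ∈ U, ∀ i j, g.inner y (e i y) (e j y) = if i = j then 1 else 0) ∧
      ∀ h, (⟨x, fun i ↦ e i x, h⟩ : ONFrame g).IsPositive o := by
  obtain ⟨U, e, hU, hx, hs, hon⟩ :=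
    exists_orthonormal_frame g (m := m) (finrank_euclideanSpace_fin (𝕜 := ℝ)) x
  let u : ONFrame g := ⟨x, fun i ↦ e i x, hon x hx⟩
  by_cases hp : u.IsPositive o
  · exact ⟨U, e, hU, hx, hs, hon, fun _ ↦ hp⟩
  let w : Fin m → ℝˣ := Function.update 1 0 (-1)
  have hw : ∀ i, ((w i : ℝˣ) : ℝ) * (w i : ℝˣ) = 1 := by
    intro i
    by_cases hi : i = 0
    · subst hi; simp [w]
    · simp [w, hi]
  refine ⟨U, fun i y ↦ ((w i : ℝˣ) : ℝ) • e i y, hU, hx,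
    fun i ↦ ContMDiffOn.const_smul_section (hs i), fun y hy i j ↦ ?_, fun h ↦ ?_⟩
  · have := hon y hy i j
    simp only [map_smul, smul_apply, smul_eq_mul, this]
    split_ifs with hij
    · subst hij; rw [mul_one, hw]
    · simp
  · have h1 := (u.basis.orientation_eq_or_eq_neg (o x)).resolve_left (fun h ↦ hp h.symm)
    rw [← Module.Basis.orientation_neg_single u.basis 0] at h1
    unfold ONFrame.IsPositive
    rw [h1]
    congr 1
    apply Module.Basis.eq_of_apply_eq
    intro i
    rw [Module.Basis.unitsSMul_apply]
    simp only [ONFrame.basis, coe_basisOfLinearIndependentOfCardEqFinrank']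
    rfl

lemma exists_localSpinFrame (S : SpinStructure g o) (x : M) :
    ∃ s : LocalSpinFrame S, x ∈ s.dom := by
  classical
  obtain ⟨U, e, hU, hx, hs, hon, hp⟩ := exists_positive_frame g o x
  obtain ⟨p₀, hp₀⟩ := (S.range_frame ⟨x, fun i ↦ e i x, hon x hx⟩).2 (hp _)
  obtain ⟨φ, hpφ, hφ⟩ := S.isLocalHomeomorph_frame p₀
  let τ : M → ONFrame g := fun y ↦
    if h : y ∈ U then ⟨y, fun i ↦ e i y, hon y h⟩ else ⟨x, fun i ↦ e i x, hon x hx⟩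
  have hτ : ∀ y (h : y ∈ U), τ y = ⟨y, fun i ↦ e i y, hon y h⟩ := fun y h ↦ dif_pos h
  have hτc : ContinuousOn τ U := by
    rw [ONFrame.continuousOn_iff]
    refine ⟨continuousOn_id.congr fun y hy ↦ by rw [hτ y hy]; rfl, fun i ↦ ?_⟩
    exact (hs i).continuousOn.congr fun y hy ↦ by rw [hτ y hy]
  have hmem : τ x ∈ φ.target := by
    rw [hτ x hx, ← hp₀, hφ]; exact φ.map_source hpφ
  refine ⟨⟨U ∩ τ ⁻¹' φ.target, hτc.isOpen_inter_preimage hU φ.open_target, e,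
    fun i ↦ (hs i).mono Set.inter_subset_left, fun y ↦ φ.symm (τ y), ?_, ?_⟩, hx, hmem⟩
  · exact φ.continuousOn_symm.comp (hτc.mono Set.inter_subset_left) fun y hy ↦ hy.2
  · rintro y ⟨hy, hy'⟩
    refine ⟨hon y hy, ?_⟩
    rw [← hτ y hy, hφ]
    exact φ.right_inv hy'

/-- A chosen local spin frame around a point. -/
def spinFrameAt (S : SpinStructure g o) (x : M) : LocalSpinFrame S :=
  (exists_localSpinFrame S x).choose

end Frames

section Curvature

variable {m : ℕ} {M : Type*} [TopologicalSpace M] [ChartedSpace (EuclideanSpace ℝ (Fin m)) M]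
  [IsManifold (𝓡 m) ∞ M]

/-- The curvature `R(X, Y)Z = ∇_X ∇_Y Z - ∇_Y ∇_X Z - ∇_[X,Y] Z` of the Levi-Civita connection,
for vector fields `X`, `Y`, `Z`. -/
def curvature (g : RiemMetric m M) (X Y Z : Π x : M, TangentSpace (𝓡 m) x) (x : M) :
    TangentSpace (𝓡 m) x :=
  leviCivita g (fun y ↦ leviCivita g Z y (Y y)) x (X x)
    - leviCivita g (fun y ↦ leviCivita g Z y (X y)) x (Y x)
    - leviCivita g Z x (mlieBracket (𝓡 m) X Y x)

/-- A chosen orthonormal frame field, smooth near `x`. -/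
def onFieldAt (g : RiemMetric m M) (x : M) : Fin m → Π y : M, TangentSpace (𝓡 m) y :=
  (exists_orthonormal_frame g (m := m) (finrank_euclideanSpace_fin (𝕜 := ℝ)) x).choose_spec.choose

/-- The scalar curvature. -/
def scalarCurvature (g : RiemMetric m M) (x : M) : ℝ :=
  ∑ i, ∑ j, g.inner x (curvature g (onFieldAt g x i) (onFieldAt g x j) (onFieldAt g x j) x)
    (onFieldAt g x i x)

/-- The trace, with respect to `g`, of a bilinear form on a tangent space. -/
def metricTrace (g : RiemMetric m M) (x : M)
    (T : TangentSpace (𝓡 m) x → TangentSpace (𝓡 m) x → ℝ) : ℝ :=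
  ∑ i, T (onFieldAt g x i x) (onFieldAt g x i x)

/-- The squared norm, with respect to `g`, of a bilinear form on a tangent space. -/
def metricNormSq (g : RiemMetric m M) (x : M)
    (T : TangentSpace (𝓡 m) x → TangentSpace (𝓡 m) x → ℝ) : ℝ :=
  ∑ i, ∑ j, T (onFieldAt g x i x) (onFieldAt g x j x) ^ 2

end Curvature

section Spinors

/-- A Clifford multiplication of `ℝᵐ` on the finite dimensional Hermitian vector space `V`, for
which multiplication by vectors is skew-Hermitian. -/
structure CliffordModule (m : ℕ) (V : Type*) [NormedAddCommGroup V] [InnerProductSpace ℂ V] where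
  /-- Clifford multiplication by the standard basis vectors of `ℝᵐ`. -/
  gamma : Fin m → V →ₗ[ℂ] V
  anticomm : ∀ i j v,
    gamma i (gamma j v) + gamma j (gamma i v) = if i = j then (-2 : ℂ) • v else 0
  skew : ∀ i v w, inner ℂ (gamma i v) w = -inner ℂ v (gamma i w)

variable {m : ℕ} {V : Type*} [NormedAddCommGroup V] [InnerProductSpace ℂ V]

/-- The Clifford module is an irreducible complex representation of the Clifford algebra; these
are the modules from which the complex spinor bundle is built. -/
def CliffordModule.IsIrreducible (c : CliffordModule m V) : Prop :=
  Nontrivial V ∧ ∀ W : Submodule ℂ V, (∀ i, ∀ v ∈ W, c.gamma i v ∈ W) → W = ⊥ ∨ W = ⊤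

/-- Clifford multiplication by a vector of `ℝᵐ`. -/
def CliffordModule.mulVec (c : CliffordModule m V) : (Fin m → ℝ) →ₗ[ℝ] Module.End ℂ V where
  toFun v := ∑ i, v i • c.gamma i
  map_add' v w := by simp [add_smul, Finset.sum_add_distrib]
  map_smul' r v := by simp [Finset.smul_sum, smul_smul]

lemma CliffordModule.mulVec_sq (c : CliffordModule m V) (v : Fin m → ℝ) :
    c.mulVec v * c.mulVec v = algebraMap ℝ (Module.End ℂ V) (cliffordForm m v) := by
  have h : ∀ i j, c.gamma i * c.gamma j + c.gamma j * c.gamma i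
      = if i = j then (-2 : ℝ) • (1 : Module.End ℂ V) else 0 := by
    intro i j
    ext w
    have := c.anticomm i j w
    rw [LinearMap.add_apply, Module.End.mul_apply, Module.End.mul_apply, this]
    split_ifs
    · simp only [LinearMap.smul_apply, Module.End.one_apply]
      rw [← Complex.coe_smul]; norm_num
    · rfl
  have h2 : (2 : ℝ) • (c.mulVec v * c.mulVec v)
      = (2 : ℝ) • algebraMap ℝ (Module.End ℂ V) (cliffordForm m v) := by
    calc (2 : ℝ) • (c.mulVec v * c.mulVec v)
        = ∑ i, ∑ j, (v i * v j) • (c.gamma i * c.gamma j)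
          + ∑ i, ∑ j, (v i * v j) • (c.gamma j * c.gamma i) := by
          have e1 : c.mulVec v * c.mulVec v = ∑ i, ∑ j, (v i * v j) • (c.gamma i * c.gamma j) := by
            simp only [CliffordModule.mulVec, LinearMap.coe_mk, AddHom.coe_mk, Finset.sum_mul,
              Finset.mul_sum, smul_mul_smul_comm]
            rw [Finset.sum_comm]
          rw [two_smul]
          congr 1
          rw [e1, Finset.sum_comm]
          simp only [mul_comm]
      _ = ∑ i, ∑ j, (v i * v j) • (c.gamma i * c.gamma j + c.gamma j * c.gamma i) := by
          simp only [smul_add, Finset.sum_add_distrib]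
      _ = _ := by
          simp only [h, smul_ite, smul_zero, Finset.sum_ite_eq, Finset.mem_univ, if_true,
            Algebra.algebraMap_eq_smul_one, cliffordForm_apply, smul_smul]
          rw [← Finset.sum_smul]
          congr 1
          rw [← Finset.sum_mul]; ring
  exact smul_right_injective _ (two_ne_zero (α := ℝ)) h2

/-- The action of the Clifford algebra. -/
def CliffordModule.clAction (c : CliffordModule m V) : Cl m →ₐ[ℝ] Module.End ℂ V :=
  CliffordAlgebra.lift (cliffordForm m) ⟨c.mulVec, c.mulVec_sq⟩

variable {M : Type*} [TopologicalSpace M] [ChartedSpace (EuclideanSpace ℝ (Fin m)) M]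
  [IsManifold (𝓡 m) ∞ M] [NeZero m] {g : RiemMetric m M}
  {o : Π x : M, Orientation ℝ (TangentSpace (𝓡 m) x) (Fin m)}

/-- Smooth sections of the vector bundle `P ×_{Spin(m)} V`, as equivariant functions on `P`. -/
structure IsSpinorField (S : SpinStructure g o) (c : CliffordModule m V) (ψ : S.P → V) : Prop where
  equivariant : ∀ p (a : Spin m), ψ (S.act p a) = c.clAction (a⁻¹ : Spin m) (ψ p)
  smooth : ∀ s : LocalSpinFrame S,
    ContMDiffOn (𝓡 m) 𝓘(ℝ, V) ∞ (fun x ↦ ψ (s.lift x)) s.dom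

namespace LocalSpinFrame

variable {S : SpinStructure g o}

/-- Clifford multiplication by a tangent vector `X` at `x`, in a local spin frame. -/
def mul (s : LocalSpinFrame S) (c : CliffordModule m V) (x : M) (X : TangentSpace (𝓡 m) x)
    (v : V) : V :=
  ∑ i, g.inner x X (s.vec i x) • c.gamma i v

/-- The spinorial Levi-Civita connection in a local spin frame,
`∇_X ψ = X(ψ) + (1/4) ∑_{i,j} g(∇_X e_i, e_j) e_i ⬝ e_j ⬝ ψ`. -/
def nabla (s : LocalSpinFrame S) (c : CliffordModule m V) (ψ : S.P → V) (x : M)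
    (X : TangentSpace (𝓡 m) x) : V :=
  mvfderiv (𝓡 m) (fun y ↦ ψ (s.lift y)) x X
    + (1 / 4 : ℝ) • ∑ i, ∑ j, g.inner x (leviCivita g (s.vec i) x X) (s.vec j x) •
        c.gamma i (c.gamma j (ψ (s.lift x)))

end LocalSpinFrame

/-- The spinor field `ψ` is parallel. -/
def IsParallelSpinor (S : SpinStructure g o) (c : CliffordModule m V) (ψ : S.P → V) : Prop :=
  ∀ s : LocalSpinFrame S, ∀ x ∈ s.dom, ∀ X : TangentSpace (𝓡 m) x, s.nabla c ψ x X = 0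

/-- `D ψ = lam ψ` for the Dirac operator `D = ∑ e_i ⬝ ∇_{e_i}`. -/
def IsDiracEigenspinor (S : SpinStructure g o) (c : CliffordModule m V) (ψ : S.P → V)
    (lam : ℝ) : Prop :=
  ∀ s : LocalSpinFrame S, ∀ x ∈ s.dom,
    ∑ i, s.mul c x (s.vec i x) (s.nabla c ψ x (s.vec i x)) = lam • ψ (s.lift x)

/-- The energy-momentum tensor
`T(X, Y) = (1/2) Re (X ⬝ ∇_Y ψ + Y ⬝ ∇_X ψ, ψ / |ψ|²)` of a spinor field `ψ` at a point where
it does not vanish, computed in a local spin frame around the point. -/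
def energyMomentum (S : SpinStructure g o) (c : CliffordModule m V) (ψ : S.P → V) (x : M)
    (X Y : TangentSpace (𝓡 m) x) : ℝ :=
  let s := spinFrameAt S x
  (1 / 2) * (inner ℂ (s.mul c x X (s.nabla c ψ x Y) + s.mul c x Y (s.nabla c ψ x X))
    (ψ (s.lift x))).re / ‖ψ (s.lift x)‖ ^ 2

end Spinors

section Hypersurface

variable {n : ℕ}
  {M : Type*} [TopologicalSpace M] [ChartedSpace (EuclideanSpace ℝ (Fin n)) M]
  [IsManifold (𝓡 n) ∞ M]
  {N : Type*} [TopologicalSpace N] [ChartedSpace (EuclideanSpace ℝ (Fin (n + 1))) N]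
  [IsManifold (𝓡 (n + 1)) ∞ N]

/-- The Levi-Civita connection of `N` pulled back along `f : M → N`: the derivative in the
direction `X` of a vector field `V` along `f`. With `w` the components of `V` in the local
trivialization of `TN` around `f x`, and `∂_a` the coordinate fields, it is
`∑ a, X(w_a) ∂_a + w_a ∇_{df X} ∂_a`. -/
def covAlong (gN : RiemMetric (n + 1) N) (f : M → N)
    (V : Π x : M, TangentSpace (𝓡 (n + 1)) (f x)) (x : M) (X : TangentSpace (𝓡 n) x) :
    TangentSpace (𝓡 (n + 1)) (f x) :=
  let t := trivializationAt (EuclideanSpace ℝ (Fin (n + 1))) (TangentSpace (𝓡 (n + 1))) (f x)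
  let w : M → EuclideanSpace ℝ (Fin (n + 1)) :=
    fun y ↦ (t (⟨f y, V y⟩ : TangentBundle (𝓡 (n + 1)) N)).2
  t.symm (f x) (mvfderiv (𝓡 n) w x X)
    + leviCivita gN (fun z ↦ t.symm z (w x)) (f x) (mfderiv (𝓡 n) (𝓡 (n + 1)) f x X)

/-- An isometric immersion `map : M → N` of codimension one with a smooth unit normal field. -/
structure CoorientedImmersion (gM : RiemMetric n M) (gN : RiemMetric (n + 1) N) where
  /-- The immersion. -/
  map : M → N
  smooth_map : ContMDiff (𝓡 n) (𝓡 (n + 1)) ∞ map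
  isometric : ∀ x (X Y : TangentSpace (𝓡 n) x),
    gN.inner (map x) (mfderiv (𝓡 n) (𝓡 (n + 1)) map x X) (mfderiv (𝓡 n) (𝓡 (n + 1)) map x Y)
      = gM.inner x X Y
  /-- The unit normal. -/
  normal : Π x : M, TangentSpace (𝓡 (n + 1)) (map x)
  smooth_normal : ContMDiff (𝓡 n) (𝓡 (n + 1)).tangent ∞
    (fun x ↦ (⟨map x, normal x⟩ : TangentBundle (𝓡 (n + 1)) N))
  normal_unit : ∀ x, gN.inner (map x) (normal x) (normal x) = 1
  normal_orth : ∀ x (X : TangentSpace (𝓡 n) x),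
    gN.inner (map x) (mfderiv (𝓡 n) (𝓡 (n + 1)) map x X) (normal x) = 0

namespace CoorientedImmersion

variable {gM : RiemMetric n M} {gN : RiemMetric (n + 1) N}

/-- The second fundamental form `h(X, Y) = g(∇_X Y, ν) = -g(∇_X ν, Y)`, where `ν` is the unit
normal and `∇` the Levi-Civita connection of `N`. -/
def secondFundamentalForm (f : CoorientedImmersion gM gN) (x : M)
    (X Y : TangentSpace (𝓡 n) x) : ℝ :=
  -gN.inner (f.map x) (covAlong gN f.map f.normal x X)
    (mfderiv (𝓡 n) (𝓡 (n + 1)) f.map x Y)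

/-- The mean curvature `H = (1/n) tr h`. -/
def meanCurvature (f : CoorientedImmersion gM gN) (x : M) : ℝ :=
  (1 / n) * metricTrace gM x (f.secondFundamentalForm x)

/-- The frame `(df(u_1), …, df(u_n), ν)` of `N` obtained from a frame `u` of `M`. -/
def extendFrame (f : CoorientedImmersion gM gN) (u : ONFrame gM) : ONFrame gN where
  base := f.map u.base
  vec := Fin.snoc (α := fun _ ↦ TangentSpace (𝓡 (n + 1)) (f.map u.base))
    (fun i ↦ mfderiv (𝓡 n) (𝓡 (n + 1)) f.map u.base (u.vec i)) (f.normal u.base)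
  orthonormal := by
    intro i j
    refine Fin.lastCases ?_ (fun i ↦ ?_) i <;> refine Fin.lastCases ?_ (fun j ↦ ?_) j
    · simpa using f.normal_unit u.base
    · rw [gN.symm]
      simpa [(Fin.castSucc_lt_last j).ne'] using f.normal_orth u.base (u.vec j)
    · simpa [(Fin.castSucc_lt_last i).ne] using f.normal_orth u.base (u.vec i)
    · simpa [f.isometric] using u.orthonormal i j

lemma sum_snoc {W : Type*} [AddCommGroup W] [Module ℝ W] (c : Fin (n + 1) → ℝ) (a : Fin n → W)
    (b : W) : ∑ i, c i • (Fin.snoc (α := fun _ ↦ W) a b i)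
      = ∑ i, c (Fin.castSucc i) • a i + c (Fin.last n) • b := by
  rw [Fin.sum_univ_castSucc]
  simp

lemma extendFrame_act (f : CoorientedImmersion gM gN) (u : ONFrame gM) (s : Spin n) :
    f.extendFrame (u.act s) = (f.extendFrame u).act (spinIncl s) := by
  symm
  refine (f.extendFrame u).act_eq _ (f.extendFrame (u.act s)).vec (fun j ↦ ?_)
    (f.extendFrame (u.act s)).orthonormal
  refine Eq.trans ?_ (sum_snoc (W := TangentSpace (𝓡 (n + 1)) (f.map u.base))
    (fun i ↦ spinMatrix (spinIncl s) i j)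
    (fun i ↦ mfderiv (𝓡 n) (𝓡 (n + 1)) f.map u.base (u.vec i)) (f.normal u.base)).symm
  refine Fin.lastCases ?_ (fun j ↦ ?_) j
  · simp only [spinMatrix_spinIncl_last, extendFrame, Fin.snoc_last,
      (Fin.castSucc_lt_last _).ne, if_false, if_true, zero_smul, one_smul, Finset.sum_const_zero,
      zero_add]
    rfl
  · simp only [spinMatrix_spinIncl_castSucc, Fin.snoc_last, Fin.snoc_castSucc,
      zero_smul, add_zero]
    have h := map_sum (mfderiv (𝓡 n) (𝓡 (n + 1)) f.map u.base)
      (fun i ↦ spinMatrix s i j • u.vec i) Finset.univ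
    simp only [map_smul] at h
    rw [← h]
    simp only [extendFrame, Fin.snoc_castSucc]
    rfl

lemma continuous_extendFrame (f : CoorientedImmersion gM gN) : Continuous f.extendFrame := by
  have hid := ONFrame.continuous_iff.1 (continuous_id (X := ONFrame gM))
  have hb : Continuous (fun u : ONFrame gM ↦ u.base) := hid.1
  rw [ONFrame.continuous_iff]
  refine ⟨f.smooth_map.continuous.comp hb, fun i ↦ ?_⟩
  refine Fin.lastCases ?_ (fun i ↦ ?_) i
  · have := f.smooth_normal.continuous.comp hb
    simpa [extendFrame, Function.comp_def] using this
  · have h1 : Continuous (fun u : ONFrame gM ↦ (⟨u.base, u.vec i⟩ : TangentBundle (𝓡 n) M)) :=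
      hid.2 i
    have := (f.smooth_map.continuous_tangentMap (by simp)).comp h1
    simpa [extendFrame, tangentMap, Function.comp_def] using this

end CoorientedImmersion

/-- An oriented hypersurface: the orientations of `M` and `N` and the unit normal `ν` are related
by the rule that `u` is a positive frame of `M` if and only if `(df(u), ν)` is a positive frame
of `N`. -/
structure OrientedHypersurface (gM : RiemMetric n M)
    (oM : Π x : M, Orientation ℝ (TangentSpace (𝓡 n) x) (Fin n)) (gN : RiemMetric (n + 1) N)
    (oN : Π x : N, Orientation ℝ (TangentSpace (𝓡 (n + 1)) x) (Fin (n + 1)))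
    extends CoorientedImmersion gM gN where
  isPositive_iff : ∀ u : ONFrame gM,
    u.IsPositive oM ↔ (toCoorientedImmersion.extendFrame u).IsPositive oN

lemma isLocalHomeomorph_pullback {A B C : Type*} [TopologicalSpace A] [TopologicalSpace B]
    [TopologicalSpace C] {e : A → B} {pr : C → B} (he : Continuous e) (hp : IsLocalHomeomorph pr) :
    IsLocalHomeomorph (fun q : {q : A × C // e q.1 = pr q.2} ↦ q.1.1) := by
  classical
  refine IsLocalHomeomorph.mk _ fun q₀ ↦ ?_
  obtain ⟨φ, hφ0, hφ⟩ := hp q₀.1.2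
  have hsec : ∀ a, e a ∈ φ.target → e a = pr (φ.symm (e a)) := fun a ha ↦ by
    rw [hφ, φ.right_inv ha]
  have hφ' : ∀ c, pr c = φ c := congrFun hφ
  let inv : A → {q : A × C // e q.1 = pr q.2} := fun a ↦
    if h : e a ∈ φ.target then ⟨(a, φ.symm (e a)), hsec a h⟩ else q₀
  have hinv : ∀ a (h : e a ∈ φ.target), inv a = ⟨(a, φ.symm (e a)), hsec a h⟩ :=
    fun a h ↦ dif_pos h
  refine ⟨{
    toFun := fun q ↦ q.1.1
    invFun := inv
    source := {q | q.1.2 ∈ φ.source}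
    target := {a | e a ∈ φ.target}
    map_source' := fun q hq ↦ by
      change e q.1.1 ∈ φ.target
      rw [q.2, hφ']; exact φ.map_source hq
    map_target' := fun a ha ↦ by
      change (inv a).1.2 ∈ φ.source
      rw [hinv a ha]; exact φ.map_target ha
    left_inv' := fun q hq ↦ by
      have h : e q.1.1 ∈ φ.target := by rw [q.2, hφ']; exact φ.map_source hq
      rw [hinv _ h]
      apply Subtype.ext
      refine Prod.ext rfl ?_
      change φ.symm (e q.1.1) = q.1.2
      rw [q.2, hφ']; exact φ.left_inv hq
    right_inv' := fun a ha ↦ by rw [hinv a ha]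
    open_source := φ.open_source.preimage (continuous_snd.comp continuous_subtype_val)
    open_target := φ.open_target.preimage he
    continuousOn_toFun := (continuous_fst.comp continuous_subtype_val).continuousOn
    continuousOn_invFun := by
      rw [Topology.IsEmbedding.subtypeVal.isInducing.continuousOn_iff]
      refine (continuousOn_id.prodMk (φ.continuousOn_symm.comp he.continuousOn
        fun a ha ↦ ha)).congr fun a ha ↦ ?_
      simp only [Function.comp_apply, hinv a ha]
      rfl }, hφ0, fun _ _ ↦ rfl⟩

variable [NeZero n] {gM : RiemMetric n M}
  {oM : Π x : M, Orientation ℝ (TangentSpace (𝓡 n) x) (Fin n)} {gN : RiemMetric (n + 1) N}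
  {oN : Π x : N, Orientation ℝ (TangentSpace (𝓡 (n + 1)) x) (Fin (n + 1))}

/-- The spin structure induced on an oriented hypersurface: the pull-back of the spin structure
of `N` under `u ↦ (df(u), ν)`. -/
def SpinStructure.induced (S : SpinStructure gN oN) (f : OrientedHypersurface gM oM gN oN) :
    SpinStructure gM oM where
  P := {q : ONFrame gM × S.P // f.extendFrame q.1 = S.frame q.2}
  top := inferInstance
  act q s := ⟨(q.1.1.act s, S.act q.1.2 (spinIncl s)), by
    rw [f.extendFrame_act, S.frame_act, q.2]⟩
  act_one q := by
    apply Subtype.ext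
    simp only [ONFrame.act_one, spinIncl_one, S.act_one]
  act_mul q s t := by
    apply Subtype.ext
    simp only [ONFrame.act_mul, spinIncl_mul, S.act_mul]
  continuous_act := by
    refine Continuous.subtype_mk (Continuous.prodMk ?_ ?_) _
    · exact ONFrame.continuous_act.comp
        ((continuous_fst.comp (continuous_subtype_val.comp continuous_fst)).prodMk continuous_snd)
    · exact S.continuous_act.comp
        ((continuous_snd.comp (continuous_subtype_val.comp continuous_fst)).prodMk
          ((continuous_spinIncl n).comp continuous_snd))
  frame q := q.1.1
  frame_act _ _ := rfl
  isLocalHomeomorph_frame :=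
    isLocalHomeomorph_pullback f.continuous_extendFrame S.isLocalHomeomorph_frame
  range_frame u := by
    rw [f.isPositive_iff, ← S.range_frame]
    constructor
    · rintro ⟨q, rfl⟩
      exact ⟨q.1.2, q.2.symm⟩
    · rintro ⟨p, hp⟩
      exact ⟨⟨(u, p), hp.symm⟩, rfl⟩
  frame_eq_iff p q := by
    simp only [Subtype.ext_iff, Prod.ext_iff, ONFrame.act_negOne, spinIncl_negOne]
    constructor
    · intro h
      have := (S.frame_eq_iff p.1.2 q.1.2).1 (by rw [← p.2, ← q.2, h])
      exact this.imp (fun h' ↦ ⟨h.symm, h'⟩) (fun h' ↦ ⟨h.symm, h'⟩)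
    · rintro (h | h) <;> exact h.1.symm
  act_negOne_ne p h := by
    have h2 := congrArg (fun q ↦ q.1.2) h
    simp only [spinIncl_negOne] at h2
    exact S.act_negOne_ne _ h2

end Hypersurface

section Restriction

namespace CliffordModule

variable {V : Type*} [NormedAddCommGroup V] [InnerProductSpace ℂ V]

/-- The action of the complex volume element `i^[(m+1)/2] e_1 ⬝ … ⬝ e_m`. -/
def volumeElement {m : ℕ} (c : CliffordModule m V) : Module.End ℂ V :=
  Complex.I ^ ((m + 1) / 2) • ((List.finRange m).map c.gamma).prod

lemma gamma_mul_prod {m : ℕ} (c : CliffordModule m V) (i : Fin m) (l : List (Fin m)) :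
    c.gamma i * (l.map c.gamma).prod
      = (-1 : ℂ) ^ (l.countP (· ≠ i)) • ((l.map c.gamma).prod * c.gamma i) := by
  have h : ∀ i j, i ≠ j → c.gamma i * c.gamma j = -(c.gamma j * c.gamma i) := by
    intro i j hij
    rw [eq_neg_iff_add_eq_zero]
    ext v
    simpa [hij] using c.anticomm i j v
  induction l with
  | nil => simp
  | cons j l ih =>
    simp only [List.map_cons, List.prod_cons, List.countP_cons]
    by_cases hij : j = i
    · subst hij
      simp only [ne_eq, not_true_eq_false, decide_false, Bool.false_eq_true, if_false, add_zero,
        mul_assoc] at ih ⊢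
      rw [ih, mul_smul_comm]
    · have hij' : (decide (j ≠ i)) = true := by simpa using hij
      simp only [hij', if_true, pow_succ]
      rw [← mul_assoc, h i j (Ne.symm hij), neg_mul, mul_assoc, ih, mul_smul_comm, mul_neg_one,
        neg_smul, mul_assoc]

lemma gamma_mul_volumeElement {m : ℕ} (c : CliffordModule m V) (hm : Even m) (i : Fin m) :
    c.gamma i * c.volumeElement = -(c.volumeElement * c.gamma i) := by
  have hm0 : 0 < m := i.pos
  have hc : (List.finRange m).countP (· ≠ i) = m - 1 := by
    have h1 := List.length_eq_countP_add_countP (· = i) (l := List.finRange m)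
    have h2 : (List.finRange m).countP (· = i) = 1 := by
      have := List.count_eq_one_of_mem (List.nodup_finRange m) (List.mem_finRange i)
      rw [← this, List.count]
      congr 1
    simp only [List.length_finRange, h2] at h1
    have h3 : (List.finRange m).countP (· ≠ i)
        = (List.finRange m).countP (fun a ↦ decide (¬ (decide (a = i)) = true)) := by
      congr 1; funext a; simp
    omega
  have hodd : Odd (m - 1) := Nat.Even.sub_odd (by omega) hm odd_one
  rw [volumeElement, mul_smul_comm, gamma_mul_prod, hc, hodd.neg_one_pow, smul_mul_assoc]
  simp

variable {n : ℕ}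

/-- The space of spinors of a hypersurface of dimension `n`, inside the space `V` of spinors of
the ambient manifold: all of `V` if `n` is even, and the half spinors of sign `ε` (the eigenspace
of the complex volume element for the eigenvalue `ε`) if `n` is odd. -/
def hypersurfaceSpinors (c : CliffordModule (n + 1) V) (ε : ℤˣ) : Submodule ℂ V :=
  if Even n then ⊤ else Module.End.eigenspace c.volumeElement ((ε : ℤ) : ℂ)

lemma gamma_last_mem (c : CliffordModule (n + 1) V) (ε : ℤˣ) (i : Fin n) :
    ∀ v ∈ c.hypersurfaceSpinors ε,
      (c.gamma i.castSucc * c.gamma (Fin.last n)) v ∈ c.hypersurfaceSpinors ε := by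
  intro v hv
  unfold hypersurfaceSpinors at hv ⊢
  split_ifs at hv ⊢ with hn
  · trivial
  · have hm : Even (n + 1) := by rw [Nat.even_add_one]; exact hn
    rw [Module.End.mem_eigenspace_iff] at hv ⊢
    have hcomm : c.volumeElement * (c.gamma i.castSucc * c.gamma (Fin.last n))
        = (c.gamma i.castSucc * c.gamma (Fin.last n)) * c.volumeElement := by
      have h1 := c.gamma_mul_volumeElement hm i.castSucc
      have h2 := c.gamma_mul_volumeElement hm (Fin.last n)
      rw [mul_assoc, h2, mul_neg, ← mul_assoc _ c.volumeElement, h1, neg_mul, neg_neg, mul_assoc]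
    rw [← Module.End.mul_apply, hcomm, Module.End.mul_apply, hv, map_smul]

/-- The Clifford multiplication `X ⬝ ψ := X ⬝ ν ⬝ ψ` of `ℝⁿ` on the spinors of the hypersurface,
`ν` being the last basis vector. It is irreducible if the Clifford module `V` is. -/
def induced (c : CliffordModule (n + 1) V) (ε : ℤˣ) :
    CliffordModule n (c.hypersurfaceSpinors ε) where
  gamma i := (c.gamma i.castSucc * c.gamma (Fin.last n)).restrict (c.gamma_last_mem ε i)
  anticomm i j v := by
    apply Subtype.ext
    have h1 : ∀ w, c.gamma (Fin.last n) (c.gamma j.castSucc w)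
        = -c.gamma j.castSucc (c.gamma (Fin.last n) w) := fun w ↦ by
      rw [eq_neg_iff_add_eq_zero]
      simpa [(Fin.castSucc_lt_last _).ne'] using c.anticomm (Fin.last n) j.castSucc w
    have h2 : ∀ w, c.gamma (Fin.last n) (c.gamma i.castSucc w)
        = -c.gamma i.castSucc (c.gamma (Fin.last n) w) := fun w ↦ by
      rw [eq_neg_iff_add_eq_zero]
      simpa [(Fin.castSucc_lt_last _).ne'] using c.anticomm (Fin.last n) i.castSucc w
    have h3 : ∀ w, c.gamma (Fin.last n) (c.gamma (Fin.last n) w) = -w := fun w ↦ by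
      have := c.anticomm (Fin.last n) (Fin.last n) w
      rw [if_pos rfl, ← two_smul ℂ] at this
      have h4 : (2 : ℂ) • c.gamma (Fin.last n) (c.gamma (Fin.last n) w) = (2 : ℂ) • (-w) := by
        rw [this]; simp
      exact smul_right_injective _ (two_ne_zero (α := ℂ)) h4
    have h5 := c.anticomm i.castSucc j.castSucc (v : V)
    simp only [Submodule.coe_add, LinearMap.coe_restrict_apply, Module.End.mul_apply, h1, h2, h3,
      map_neg, neg_neg, Fin.castSucc_inj] at h5 ⊢
    rw [h5]
    split_ifs <;> simp
  skew i v w := by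
    have h1 : ∀ w, c.gamma (Fin.last n) (c.gamma i.castSucc w)
        = -c.gamma i.castSucc (c.gamma (Fin.last n) w) := fun w ↦ by
      rw [eq_neg_iff_add_eq_zero]
      simpa [(Fin.castSucc_lt_last _).ne'] using c.anticomm (Fin.last n) i.castSucc w
    simp only [Submodule.coe_inner, LinearMap.coe_restrict_apply, Module.End.mul_apply]
    rw [c.skew, c.skew, h1]
    simp

end CliffordModule

variable {n : ℕ} [NeZero n]
  {M : Type*} [TopologicalSpace M] [ChartedSpace (EuclideanSpace ℝ (Fin n)) M]
  [IsManifold (𝓡 n) ∞ M]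
  {N : Type*} [TopologicalSpace N] [ChartedSpace (EuclideanSpace ℝ (Fin (n + 1))) N]
  [IsManifold (𝓡 (n + 1)) ∞ N] {gM : RiemMetric n M}
  {oM : Π x : M, Orientation ℝ (TangentSpace (𝓡 n) x) (Fin n)} {gN : RiemMetric (n + 1) N}
  {oN : Π x : N, Orientation ℝ (TangentSpace (𝓡 (n + 1)) x) (Fin (n + 1))}
  {V : Type*} [NormedAddCommGroup V] [InnerProductSpace ℂ V] [FiniteDimensional ℂ V]

/-- The restriction of a spinor field of `N` to a hypersurface: the field itself if `n` is even,
and its part of chirality `ε` if `n` is odd. -/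
def restrictSpinor (S : SpinStructure gN oN) (f : OrientedHypersurface gM oM gN oN)
    (c : CliffordModule (n + 1) V) (ε : ℤˣ) (Φ : S.P → V) (q : (S.induced f).P) :
    c.hypersurfaceSpinors ε :=
  (c.hypersurfaceSpinors ε).orthogonalProjectionOnto (Φ q.1.2)

end Restriction

end

/-! Let ψ be the part of Φ on M. In a frame (e_1, …, e_n, ν) along M the ambient connection form
splits into the connection form of M and the components of h. Since (X·ν)(Y·ν) = X·Y on tangent
vectors, ∇Φ = 0 becomes ∇_X ψ = -(1/2) h(X)·ψ for the intrinsic connection and Clifford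
multiplication of M, with h(X) the vector dual to h(X, ·) (`IsParallelSpinor.nabla_restrictSpinor`).

Everything else follows from this equation. As h is symmetric, ∑ e_k·h(e_k) = -tr h, so Dψ = (nH/2)
ψ (`IsParallelSpinor.dirac_restrictSpinor`). As Re(e_i·e_j·ψ, ψ) = -δ_ij |ψ|², pairing X·∇_Y ψ with
ψ gives 2T = h (`IsParallelSpinor.two_mul_energyMomentum`).

The remaining point is S = (nH)² - |h|² (`IsParallelSpinor.scalarCurvature_eq`). It is the traced
Gauss equation of a hypersurface in a Ricci-flat manifold, but it is derived on M alone, as the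
integrability condition of the equation for ψ. The commutator of two derivatives of ψ consists of a
curvature term, the Codazzi tensor of h, and a commutator of the vectors h(e_k), h(e_l). Multiplying
by e_k·e_l, summing, and taking the real part of the product with ψ leaves the scalar curvature from
the first term (by the Bianchi identity) and |h|² - (tr h)² from the third. The second contracts to
a vector, which acts skewly, so no Codazzi equation is needed
(`CliffordModule.curvature_contraction`, `IsONFrameOn.scalar_identity`). Consequently S/4 + |T|² =
n²H²/4 = λ² at every point, and the infimum is that of a constant.

The absence of zeros comes from N. Projection to Σ^ε commutes with even Clifford elements, hence
with Spin(n+1) and with the spin connection, so the length of the projected parallel spinor is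
constant on the connected manifold N (`projectedLength_const`). The two projections cannot both
vanish, because v ± ωv are eigenvectors of the volume element ω.

The formalization works in frames. Since f is only an immersion, a frame along f is extended to an
open set of N through a local retraction (`exists_extend_frame`), and its lift is matched with that
of the hypersurface frame (`exists_adapted_frame`). -/

noncomputable section

/-! ### Calculus of directional derivatives of vector-valued functions. -/

section DirectionalDerivative

variable {E : Type*} [NormedAddCommGroup E] [NormedSpace ℝ E]
  {H : Type*} [TopologicalSpace H] {I : ModelWithCorners ℝ E H}
  {M : Type*} [TopologicalSpace M] [ChartedSpace H M]
  {E' : Type*} [NormedAddCommGroup E'] [NormedSpace ℝ E']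
  {H' : Type*} [TopologicalSpace H'] {I' : ModelWithCorners ℝ E' H'}
  {M' : Type*} [TopologicalSpace M'] [ChartedSpace H' M']
  {F : Type*} [NormedAddCommGroup F] [NormedSpace ℝ F]
  {F' : Type*} [NormedAddCommGroup F'] [NormedSpace ℝ F']

lemma mvfderiv_comp_mfderiv {u : M' → F} {f : M → M'} {x : M} (hu : MDiffAt u (f x))
    (hf : MDiffAt f x) (X : TangentSpace I x) :
    mvfderiv I (fun y ↦ u (f y)) x X = mvfderiv I' u (f x) (mfderiv I I' f x X) :=
  mfderiv_comp_apply x hu hf X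

lemma mvfderiv_congr_of_eventuallyEq {u v : M → F} {x : M} (h : u =ᶠ[𝓝 x] v) :
    mvfderiv I u x = mvfderiv I v x := by
  ext X
  exact congrArg (fun L : E →L[ℝ] F ↦ L X) (h.mfderiv_eq (I := I) (I' := 𝓘(ℝ, F)))

lemma mvfderiv_clm_comp (L : F →L[ℝ] F') {u : M → F} {x : M} (hu : MDiffAt u x)
    (X : TangentSpace I x) :
    mvfderiv I (fun y ↦ L (u y)) x X = L (mvfderiv I u x X) := by
  rw [mvfderiv_comp_mfderiv (I' := 𝓘(ℝ, F)) (u := L) L.mdifferentiableAt hu]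
  simp only [mvfderiv, ContinuousLinearMap.coe_comp, Function.comp_apply,
    mfderiv_eq_fderiv, ContinuousLinearMap.fderiv]
  rfl

lemma mvfderiv_sum {ι : Type*} (s : Finset ι) {u : ι → M → F} {x : M}
    (hu : ∀ i ∈ s, MDiffAt (u i) x) :
    MDiffAt (fun y ↦ ∑ i ∈ s, u i y) x ∧
    ∀ X : TangentSpace I x,
      mvfderiv I (fun y ↦ ∑ i ∈ s, u i y) x X = ∑ i ∈ s, mvfderiv I (u i) x X := by
  classical
  induction s using Finset.induction_on with
  | empty =>
    simp only [Finset.sum_empty]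
    exact ⟨mdifferentiableAt_const, fun X ↦ by rw [mvfderiv_const]; rfl⟩
  | insert a s ha ih =>
    have h1 := hu a (Finset.mem_insert_self a s)
    obtain ⟨h2, h3⟩ := ih fun i hi ↦ hu i (Finset.mem_insert_of_mem hi)
    simp only [Finset.sum_insert ha]
    exact ⟨h1.add h2, fun X ↦ by rw [mvfderiv_fun_add h1 h2, add_apply, h3]⟩

lemma mvfderiv_smul_clm (L : F →L[ℝ] F') {a : M → ℝ} {u : M → F} {x : M} (ha : MDiffAt a x)
    (hu : MDiffAt u x) :
    MDiffAt (fun y ↦ a y • L (u y)) x ∧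
    ∀ X : TangentSpace I x, mvfderiv I (fun y ↦ a y • L (u y)) x X
      = mvfderiv I a x X • L (u x) + a x • L (mvfderiv I u x X) := by
  have hL : MDiffAt (fun y ↦ L (u y)) x :=
    MDifferentiableAt.comp (I' := 𝓘(ℝ, F)) x (g := L) L.mdifferentiableAt hu
  refine ⟨ha.smul hL, fun X ↦ ?_⟩
  rw [mvfderiv_fun_smul ha hL]
  simp only [add_apply, smul_apply, ContinuousLinearMap.smulRight_apply]
  rw [mvfderiv_clm_comp L hu, add_comm]

variable [I.Boundaryless] [IsManifold I ∞ M]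

lemma contMDiffAt_extChartAt_symm_self (x : M) :
    ContMDiffAt 𝓘(ℝ, E) I ∞ (extChartAt I x).symm (extChartAt I x x) :=
  (contMDiffOn_extChartAt_symm x).contMDiffAt (extChartAt_target_mem_nhds x)

lemma isInvertible_mfderiv_extChartAt_symm {x : M} {z : E} (hz : z ∈ (extChartAt I x).target) :
    (mfderiv 𝓘(ℝ, E) I (extChartAt I x).symm z).IsInvertible := by
  have := IsManifold.of_le (I := I) (M := M) (m := 1) (n := ∞) (by simp)
  have := isInvertible_mfderivWithin_extChartAt_symm (I := I) hz
  rwa [I.range_eq_univ, mfderivWithin_univ] at this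

/-- In a chart this is the symmetry of the second derivative of `u`. Values in a normed space are
needed because `u` will be a spinor in a frame, and also a coordinate chart; the vector fields are
only assumed differentiable at the one point. -/
lemma mvfderiv_mlieBracket [CompleteSpace E] {u : M → F} {V W : Π x : M, TangentSpace I x} {x : M}
    (hu : ContMDiffAt I 𝓘(ℝ, F) ∞ u x) (hV : MDiffAt (T% V) x) (hW : MDiffAt (T% W) x) :
    mvfderiv I u x (mlieBracket I V W x)
      = mvfderiv I (fun y ↦ mvfderiv I u y (W y)) x (V x)
        - mvfderiv I (fun y ↦ mvfderiv I u y (V y)) x (W x) := by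
  have h2 : (2 : ℕ∞ω) ≤ ∞ := WithTop.coe_le_coe.2 le_top
  have := IsManifold.of_le (I := I) (M := M) h2
  have : IsManifold I (minSmoothness ℝ 2) M := by
    simpa only [minSmoothness_of_isRCLikeNormedField] using this
  have := IsManifold.of_le (I := I) (M := M) (m := 1) (n := ∞) (by simp)
  set φ := extChartAt I x with hφ
  set ξ := φ x with hξ
  have hxξ : φ.symm ξ = x := extChartAt_to_inv x
  have hsm : ContMDiffAt 𝓘(ℝ, E) I ∞ φ.symm ξ := contMDiffAt_extChartAt_symm_self x
  have hinv : (mfderiv 𝓘(ℝ, E) I φ.symm ξ).IsInvertible :=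
    isInvertible_mfderiv_extChartAt_symm (mem_extChartAt_target x)
  have hpb := mpullback_mlieBracket (I := 𝓘(ℝ, E)) (I' := I) (f := φ.symm) (x₀ := ξ)
    (V := V) (W := W) (n := ∞) (by rwa [hxξ]) (by rwa [hxξ]) hsm
      (by rw [minSmoothness_of_isRCLikeNormedField]; exact h2)
  set V' := mpullback 𝓘(ℝ, E) I φ.symm V with hV'
  set W' := mpullback 𝓘(ℝ, E) I φ.symm W with hW'
  set v : E → F := fun z ↦ u (φ.symm z) with hv
  have hu' : ∀ᶠ z in 𝓝 ξ, MDifferentiableAt I 𝓘(ℝ, F) u (φ.symm z) ∧ z ∈ φ.target := by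
    have h3 : ∀ᶠ y in 𝓝 (φ.symm ξ), MDifferentiableAt I 𝓘(ℝ, F) u y := by
      rw [hxξ]
      -- Smoothness of finite order at a point holds on a neighbourhood; for order `∞` the
      -- neighbourhoods may shrink with the order, hence the passage through order 2.
      have h9 := (contMDiffAt_iff_contMDiffAt_nhds (n := 2)
        (WithTop.coe_injective.ne (by decide))).1 (hu.of_le h2)
      filter_upwards [h9] with y hy
      exact hy.mdifferentiableAt (by simp)
    exact (hsm.continuousAt.eventually h3).and (extChartAt_target_mem_nhds x)
  have hmd : ∀ z ∈ φ.target, MDifferentiableAt 𝓘(ℝ, E) I φ.symm z := fun z hz ↦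
    mdifferentiableAt_of_isInvertible_mfderiv (isInvertible_mfderiv_extChartAt_symm hz)
  have hpull : ∀ (Z : Π x : M, TangentSpace I x), ∀ z ∈ φ.target,
      mfderiv 𝓘(ℝ, E) I φ.symm z (mpullback 𝓘(ℝ, E) I φ.symm Z z) = Z (φ.symm z) := by
    intro Z z hz
    exact (isInvertible_mfderiv_extChartAt_symm hz).self_apply_inverse _
  have hder : ∀ (Z : Π x : M, TangentSpace I x),
      (fun z ↦ fderiv ℝ v z (mpullback 𝓘(ℝ, E) I φ.symm Z z))
        =ᶠ[𝓝 ξ] fun z ↦ (fun y ↦ mvfderiv I u y (Z y)) (φ.symm z) := by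
    intro Z
    filter_upwards [hu'] with z hz
    have h4 := mvfderiv_comp_mfderiv (I := 𝓘(ℝ, E)) hz.1 (hmd z hz.2)
      (mpullback 𝓘(ℝ, E) I φ.symm Z z)
    rw [hpull Z z hz.2] at h4
    rw [← h4]
    simp only [mvfderiv, mfderiv_eq_fderiv]
    rfl
  have hξt : ξ ∈ φ.target := mem_extChartAt_target x
  have hvs : ContDiffAt ℝ ∞ v ξ := by
    have : ContMDiffAt 𝓘(ℝ, E) 𝓘(ℝ, F) ∞ v ξ :=
      ContMDiffAt.comp ξ (I' := I) (g := u) (by rwa [hxξ]) hsm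
    exact this.contDiffAt
  have hdiff : ∀ {Z : Π x : M, TangentSpace I x}, MDiffAt (T% Z) x →
      DifferentiableAt ℝ (mpullback 𝓘(ℝ, E) I φ.symm Z) ξ := by
    intro Z hZ
    have := MDifferentiableWithinAt.differentiableWithinAt_mpullbackWithin_vectorField
      (s := Set.univ) hZ.mdifferentiableWithinAt
    simp only [Set.preimage_univ, I.range_eq_univ, Set.univ_inter, mpullbackWithin_univ] at this
    exact differentiableWithinAt_univ.1 this
  have hsecond : ∀ (Z Y : Π x : M, TangentSpace I x), MDiffAt (T% Z) x →
      fderiv ℝ (fun z ↦ fderiv ℝ v z (mpullback 𝓘(ℝ, E) I φ.symm Z z)) ξ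
        (mpullback 𝓘(ℝ, E) I φ.symm Y ξ)
        = mvfderiv I (fun y ↦ mvfderiv I u y (Z y)) x (Y x) := by
    intro Z Y hZ
    have hd1 : DifferentiableAt ℝ
        (fun z ↦ fderiv ℝ v z (mpullback 𝓘(ℝ, E) I φ.symm Z z)) ξ :=
      ((hvs.fderiv_right (m := 1) (WithTop.coe_le_coe.2 le_top)).differentiableAt
        (by simp)).clm_apply (hdiff hZ)
    -- The chain rule below needs this differentiability on the manifold; it is carried over from
    -- the chart, where it is a derivative of `v` applied to a differentiable field.
    have hG : MDifferentiableAt I 𝓘(ℝ, F) (fun y ↦ mvfderiv I u y (Z y)) x := by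
      have h5 : MDifferentiableAt I 𝓘(ℝ, F)
          (fun y ↦ (fun z ↦ fderiv ℝ v z (mpullback 𝓘(ℝ, E) I φ.symm Z z)) (φ y)) x :=
        MDifferentiableAt.comp (I' := 𝓘(ℝ, E)) x hd1.mdifferentiableAt
          (mdifferentiableAt_extChartAt (mem_chart_source H x))
      refine h5.congr_of_eventuallyEq ?_
      have h6 := (continuousAt_extChartAt (I := I) x).eventually (hder Z)
      filter_upwards [h6, extChartAt_source_mem_nhds (I := I) x] with y hy hy'
      have := hy.symm
      rwa [φ.left_inv hy'] at this
    rw [(hder Z).fderiv_eq]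
    have h7 := mvfderiv_comp_mfderiv (I := 𝓘(ℝ, E)) (u := fun y ↦ mvfderiv I u y (Z y))
      (f := φ.symm) (by rwa [hxξ]) (hmd ξ hξt) (mpullback 𝓘(ℝ, E) I φ.symm Y ξ)
    rw [hpull Y ξ hξt] at h7
    refine Eq.trans ?_ (h7.trans ?_)
    · simp only [mvfderiv, ContinuousLinearMap.coe_comp, Function.comp_apply,
        mfderiv_eq_fderiv]
      rfl
    · exact congrArg (fun x ↦ mvfderiv I (fun y ↦ mvfderiv I u y (Z y)) x (Y x)) hxξ
  have hlie := fderiv_apply_lieBracket hvs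
    (by rw [minSmoothness_of_isRCLikeNormedField]; exact h2) (hdiff hW) (hdiff hV)
  rw [hsecond W V hW, hsecond V W hV] at hlie
  rw [← hlie]
  have h8 := (hder (mlieBracket I V W)).eq_of_nhds
  simp only at h8
  have h10 : mlieBracket 𝓘(ℝ, E) V' W' ξ = lieBracket ℝ V' W' ξ :=
    (congrFun (mlieBracketWithin_eq_lieBracketWithin (V := V') (W := W') (s := Set.univ)) ξ).trans
      (congrFun lieBracketWithin_univ ξ)
  rw [hpb, h10] at h8
  exact (congrArg (fun x ↦ mvfderiv I u x (mlieBracket I V W x)) hxξ).symm.trans h8.symm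

end DirectionalDerivative

/-! ### The Levi-Civita connection and its curvature in orthonormal frames. -/

section OrthonormalFrames

variable {m : ℕ} {M : Type*} [TopologicalSpace M] [ChartedSpace (EuclideanSpace ℝ (Fin m)) M]
  [IsManifold (𝓡 m) ∞ M]

/-- `e` is a smooth orthonormal frame field over the open set `U`. -/
structure IsONFrameOn (g : RiemMetric m M) (U : Set M)
    (e : Fin m → Π x : M, TangentSpace (𝓡 m) x) : Prop where
  isOpen : IsOpen U
  smooth : ∀ i, ContMDiffOn (𝓡 m) (𝓡 m).tangent ∞
    (fun x ↦ (⟨x, e i x⟩ : TangentBundle (𝓡 m) M)) U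
  orthonormal : ∀ x ∈ U, ∀ i j, g.inner x (e i x) (e j x) = if i = j then 1 else 0

/-- Differentiability at a point of a vector field. -/
abbrev VectorFieldMDiffAt (X : Π x : M, TangentSpace (𝓡 m) x) (x : M) : Prop :=
  MDifferentiableAt (𝓡 m) (𝓡 m).tangent (fun y ↦ (⟨y, X y⟩ : TangentBundle (𝓡 m) M)) x

lemma ONFrame.sum_inner_smul {g : RiemMetric m M} (u : ONFrame g)
    (X : TangentSpace (𝓡 m) u.base) : ∑ i, g.inner u.base X (u.vec i) • u.vec i = X := by
  have hb : ∀ i, u.basis i = u.vec i := fun i ↦ by simp [ONFrame.basis]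
  have h := u.basis.sum_repr X
  simp only [hb] at h
  have h2 : ∀ j, g.inner u.base X (u.vec j) = u.basis.repr X j := by
    intro j
    conv_lhs => rw [← h]
    simp [map_sum, sum_apply, u.orthonormal]
  simp only [h2, h]

/-- The components `g(∇_{e_k} e_i, e_j)` of the Levi-Civita connection in a frame. -/
def connCoeff (g : RiemMetric m M) (e : Fin m → Π x : M, TangentSpace (𝓡 m) x)
    (k i j : Fin m) (x : M) : ℝ :=
  g.inner x (leviCivita g (e i) x (e k x)) (e j x)

/-- The components `g([e_k, e_i], e_j)` of the Lie brackets of a frame. -/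
def structCoeff (g : RiemMetric m M) (e : Fin m → Π x : M, TangentSpace (𝓡 m) x)
    (k i j : Fin m) (x : M) : ℝ :=
  g.inner x (mlieBracket (𝓡 m) (e k) (e i) x) (e j x)

lemma leviCivita_congr (g : RiemMetric m M) {X Y : Π x : M, TangentSpace (𝓡 m) x} {x : M}
    (hX : VectorFieldMDiffAt X x) (hY : VectorFieldMDiffAt Y x) (h : ∀ᶠ y in 𝓝 x, X y = Y y) :
    leviCivita g X x = leviCivita g Y x :=
  (leviCivita g).isCovariantDerivativeOnUniv.congr_of_eventuallyEq hX hY Filter.univ_mem h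

lemma leviCivita_fun_add (g : RiemMetric m M) {X Y : Π x : M, TangentSpace (𝓡 m) x} {x : M}
    (hX : VectorFieldMDiffAt X x) (hY : VectorFieldMDiffAt Y x) :
    leviCivita g (fun y ↦ X y + Y y) x = leviCivita g X x + leviCivita g Y x :=
  (leviCivita g).isCovariantDerivativeOnUniv.add hX hY

lemma leviCivita_fun_smul (g : RiemMetric m M) {X : Π x : M, TangentSpace (𝓡 m) x} {a : M → ℝ}
    {x : M} (ha : MDifferentiableAt (𝓡 m) 𝓘(ℝ, ℝ) a x) (hX : VectorFieldMDiffAt X x) :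
    leviCivita g (fun y ↦ a y • X y) x
      = a x • leviCivita g X x + (mvfderiv (𝓡 m) a x).smulRight (X x) :=
  (leviCivita g).isCovariantDerivativeOnUniv.leibniz hX ha

lemma leviCivita_sum_smul (g : RiemMetric m M) {ι : Type*} (s : Finset ι)
    {X : ι → Π x : M, TangentSpace (𝓡 m) x} {a : ι → M → ℝ}
    {x : M} (ha : ∀ i, MDifferentiableAt (𝓡 m) 𝓘(ℝ, ℝ) (a i) x)
    (hX : ∀ i, VectorFieldMDiffAt (X i) x) :
    VectorFieldMDiffAt (fun y ↦ ∑ i ∈ s, a i y • X i y) x ∧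
    ∀ v, leviCivita g (fun y ↦ ∑ i ∈ s, a i y • X i y) x v
      = ∑ i ∈ s, (a i x • leviCivita g (X i) x v + mvfderiv (𝓡 m) (a i) x v • X i x) := by
  classical
  induction s using Finset.induction_on with
  | empty =>
    simp only [Finset.sum_empty]
    refine ⟨mdifferentiableAt_zeroSection .., fun v ↦ ?_⟩
    have := (leviCivita g).isCovariantDerivativeOnUniv.zero (x := x)
    exact congrArg (fun L ↦ L v) this
  | insert j s hj ih =>
    obtain ⟨h1, h2⟩ := ih
    have h3 : VectorFieldMDiffAt (fun y ↦ a j y • X j y) x := (ha j).smul_section (hX j)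
    simp only [Finset.sum_insert hj]
    refine ⟨mdifferentiableAt_add_section h3 h1, fun v ↦ ?_⟩
    rw [leviCivita_fun_add g h3 h1, add_apply, h2, leviCivita_fun_smul g (ha j) (hX j)]
    rfl

namespace IsONFrameOn

variable {g : RiemMetric m M} {U : Set M} {e : Fin m → Π x : M, TangentSpace (𝓡 m) x} {x : M}

lemma contMDiffAt (he : IsONFrameOn g U e) (hx : x ∈ U) (i : Fin m) :
    ContMDiffAt (𝓡 m) (𝓡 m).tangent ∞ (fun x ↦ (⟨x, e i x⟩ : TangentBundle (𝓡 m) M)) x :=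
  (he.smooth i).contMDiffAt (he.isOpen.mem_nhds hx)

lemma mdiffAt (he : IsONFrameOn g U e) (hx : x ∈ U) (i : Fin m) :
    VectorFieldMDiffAt (e i) x :=
  (he.contMDiffAt hx i).mdifferentiableAt (by simp)

lemma sum_inner_smul (he : IsONFrameOn g U e) (hx : x ∈ U) (X : TangentSpace (𝓡 m) x) :
    ∑ i, g.inner x X (e i x) • e i x = X :=
  ONFrame.sum_inner_smul ⟨x, fun i ↦ e i x, he.orthonormal x hx⟩ X

lemma inner_eq_sum (he : IsONFrameOn g U e) (hx : x ∈ U) (X Y : TangentSpace (𝓡 m) x) :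
    g.inner x X Y = ∑ i, g.inner x X (e i x) * g.inner x Y (e i x) := by
  conv_lhs => rw [← he.sum_inner_smul hx Y]
  simp [map_sum, mul_comm]

lemma connCoeff_antisymm (he : IsONFrameOn g U e) (hx : x ∈ U) (k i j : Fin m) :
    connCoeff g e k i j x = -connCoeff g e k j i x := by
  have h := (isLeviCivita_leviCivita g).metric (e i) (e j) x (e k x) (he.mdiffAt hx i)
    (he.mdiffAt hx j)
  have h2 : (fun y ↦ g.inner y (e i y) (e j y)) =ᶠ[𝓝 x] fun _ ↦ if i = j then 1 else 0 := by
    filter_upwards [he.isOpen.mem_nhds hx] with y hy using he.orthonormal y hy i j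
  rw [mvfderiv_congr_of_eventuallyEq h2, mvfderiv_const, g.symm x (e i x)] at h
  simp only [zero_apply] at h
  unfold connCoeff
  linarith

lemma structCoeff_eq (he : IsONFrameOn g U e) (hx : x ∈ U) (k i j : Fin m) :
    structCoeff g e k i j x = connCoeff g e k i j x - connCoeff g e i k j x := by
  have h := (isLeviCivita_leviCivita g).torsion_free (e k) (e i) x (he.mdiffAt hx k)
    (he.mdiffAt hx i)
  simp only [structCoeff, connCoeff, ← h, map_sub, sub_apply]

/-- Koszul's formula in a frame with constant inner products. Expressing the connection through
brackets alone gives both its smoothness and its compatibility with restriction to a hypersurface.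
-/
lemma connCoeff_eq (he : IsONFrameOn g U e) (hx : x ∈ U) (k i j : Fin m) :
    connCoeff g e k i j x = (1 / 2) * (structCoeff g e k i j x - structCoeff g e k j i x
      - structCoeff g e i j k x) := by
  simp only [he.structCoeff_eq hx]
  have h1 := he.connCoeff_antisymm hx k i j
  have h2 := he.connCoeff_antisymm hx i k j
  have h3 := he.connCoeff_antisymm hx j k i
  linarith

lemma contMDiffAt_mlieBracket (he : IsONFrameOn g U e) (hx : x ∈ U) (k i : Fin m) :
    ContMDiffAt (𝓡 m) (𝓡 m).tangent ∞
      (fun x ↦ (⟨x, mlieBracket (𝓡 m) (e k) (e i) x⟩ : TangentBundle (𝓡 m) M)) x :=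
  have : IsManifold (𝓡 m) (minSmoothness ℝ 2) M := IsManifold.of_le (n := ∞) (by
    rw [minSmoothness_of_isRCLikeNormedField]; exact WithTop.coe_le_coe.2 le_top)
  have : IsManifold (𝓡 m) (((⊤ : ℕ∞) : ℕ∞ω) + 1) M := inferInstanceAs (IsManifold (𝓡 m) ∞ M)
  ContMDiffAt.mlieBracket_vectorField (m := ⊤) (n := ⊤) (he.contMDiffAt hx k)
    (he.contMDiffAt hx i) (by rw [minSmoothness_of_isRCLikeNormedField]; rfl)

lemma contMDiffAt_structCoeff (he : IsONFrameOn g U e) (hx : x ∈ U) (k i j : Fin m) :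
    ContMDiffAt (𝓡 m) 𝓘(ℝ, ℝ) ∞ (structCoeff g e k i j) x :=
  metric_contMDiffWithinAt g (he.contMDiffAt_mlieBracket hx k i) (he.contMDiffAt hx j)

/-- The connection was built pointwise from the Koszul form, so smoothness is not part of its data;
it is inherited from the brackets of the frame fields. -/
lemma contMDiffAt_connCoeff (he : IsONFrameOn g U e) (hx : x ∈ U) (k i j : Fin m) :
    ContMDiffAt (𝓡 m) 𝓘(ℝ, ℝ) ∞ (connCoeff g e k i j) x := by
  have h : ContMDiffAt (𝓡 m) 𝓘(ℝ, ℝ) ∞ (fun x ↦ (1 / 2 : ℝ) • (structCoeff g e k i j x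
      - structCoeff g e k j i x - structCoeff g e i j k x)) x :=
    ContMDiffAt.smul (contMDiffAt_const : ContMDiffAt (𝓡 m) 𝓘(ℝ, ℝ) ∞ (fun _ : M ↦ (1 / 2 : ℝ)) x)
      (((he.contMDiffAt_structCoeff hx k i j).sub
      (he.contMDiffAt_structCoeff hx k j i)).sub (he.contMDiffAt_structCoeff hx i j k))
  refine h.congr_of_eventuallyEq ?_
  filter_upwards [he.isOpen.mem_nhds hx] with y hy using he.connCoeff_eq hy k i j

lemma mdiffAt_connCoeff (he : IsONFrameOn g U e) (hx : x ∈ U) (k i j : Fin m) :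
    MDifferentiableAt (𝓡 m) 𝓘(ℝ, ℝ) (connCoeff g e k i j) x :=
  (he.contMDiffAt_connCoeff hx k i j).mdifferentiableAt (by simp)

lemma inner_leviCivita (he : IsONFrameOn g U e) (hx : x ∈ U) (X : TangentSpace (𝓡 m) x)
    (i j : Fin m) : g.inner x (leviCivita g (e i) x X) (e j x)
      = ∑ k, g.inner x X (e k x) * connCoeff g e k i j x := by
  conv_lhs => rw [← he.sum_inner_smul hx X]
  simp only [map_sum, sum_apply, map_smul, smul_apply, smul_eq_mul, connCoeff]

lemma leviCivita_eq_sum (he : IsONFrameOn g U e) (hx : x ∈ U) (k i : Fin m) :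
    leviCivita g (e i) x (e k x) = ∑ j, connCoeff g e k i j x • e j x :=
  (he.sum_inner_smul hx _).symm

lemma mdiffAt_leviCivita (he : IsONFrameOn g U e) (hx : x ∈ U) (k i : Fin m) :
    VectorFieldMDiffAt (fun y ↦ leviCivita g (e i) y (e k y)) x := by
  have h := (leviCivita_sum_smul g Finset.univ (X := e) (a := connCoeff g e k i) (x := x)
    (he.mdiffAt_connCoeff hx k i) (he.mdiffAt hx)).1
  refine h.congr_of_eventuallyEq ?_
  filter_upwards [he.isOpen.mem_nhds hx] with y hy
  rw [he.leviCivita_eq_sum hy]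

/-- Metric compatibility trades the outer derivative for a derivative of the coefficient; the
antisymmetry of the coefficients turns the remaining product into the quadratic term. -/
lemma inner_leviCivita_leviCivita (he : IsONFrameOn g U e) (hx : x ∈ U) (k l i j : Fin m) :
    g.inner x (leviCivita g (fun y ↦ leviCivita g (e i) y (e l y)) x (e k x)) (e j x)
      = mvfderiv (𝓡 m) (connCoeff g e l i j) x (e k x)
        + ∑ p, connCoeff g e l i p x * connCoeff g e k p j x := by
  have h := (isLeviCivita_leviCivita g).metric (fun y ↦ leviCivita g (e i) y (e l y)) (e j) x
    (e k x) (he.mdiffAt_leviCivita hx l i) (he.mdiffAt hx j)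
  rw [he.inner_eq_sum hx (leviCivita g (e i) x (e l x))] at h
  have h2 : ∀ p, g.inner x (leviCivita g (e i) x (e l x)) (e p x)
      * g.inner x (leviCivita g (e j) x (e k x)) (e p x)
      = -(connCoeff g e l i p x * connCoeff g e k p j x) := by
    intro p
    have := he.connCoeff_antisymm hx k j p
    change connCoeff g e l i p x * connCoeff g e k j p x = _
    rw [this, mul_neg]
  simp only [h2, Finset.sum_neg_distrib] at h
  change mvfderiv (𝓡 m) (connCoeff g e l i j) x (e k x) = _ at h
  linarith

/-- The components of the curvature tensor in an orthonormal frame. -/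
lemma inner_curvature (he : IsONFrameOn g U e) (hx : x ∈ U) (k l i j : Fin m) :
    g.inner x (curvature g (e k) (e l) (e i) x) (e j x)
      = mvfderiv (𝓡 m) (connCoeff g e l i j) x (e k x)
        - mvfderiv (𝓡 m) (connCoeff g e k i j) x (e l x)
        + ∑ p, (connCoeff g e l i p x * connCoeff g e k p j x
          - connCoeff g e k i p x * connCoeff g e l p j x)
        - ∑ p, (connCoeff g e k l p x - connCoeff g e l k p x) * connCoeff g e p i j x := by
  simp only [curvature, map_sub, sub_apply]
  rw [he.inner_leviCivita_leviCivita hx, he.inner_leviCivita_leviCivita hx,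
    he.inner_leviCivita hx (mlieBracket (𝓡 m) (e k) (e l) x)]
  have h : ∀ p, g.inner x (mlieBracket (𝓡 m) (e k) (e l) x) (e p x)
      = connCoeff g e k l p x - connCoeff g e l k p x := he.structCoeff_eq hx k l
  simp only [h, Finset.sum_sub_distrib]
  ring

/-- Vanishing torsion used twice: first inside the derivative, on a whole neighbourhood, then for `e
k` and the bracket. Its cyclic sum reduces the Bianchi identity to the Jacobi identity. -/
lemma leviCivita_mlieBracket (he : IsONFrameOn g U e) (hx : x ∈ U) (k l i : Fin m) :
    leviCivita g (fun y ↦ leviCivita g (e i) y (e l y)) x (e k x)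
      - leviCivita g (fun y ↦ leviCivita g (e l) y (e i y)) x (e k x)
      = mlieBracket (𝓡 m) (e k) (mlieBracket (𝓡 m) (e l) (e i)) x
        + leviCivita g (e k) x (mlieBracket (𝓡 m) (e l) (e i) x) := by
  have hb : VectorFieldMDiffAt (mlieBracket (𝓡 m) (e l) (e i)) x :=
    (he.contMDiffAt_mlieBracket hx l i).mdifferentiableAt (by simp)
  have h1 := leviCivita_congr g (he.mdiffAt_leviCivita hx l i)
    (mdifferentiableAt_add_section hb (he.mdiffAt_leviCivita hx i l)) (by
      filter_upwards [he.isOpen.mem_nhds hx] with y hy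
      have := (isLeviCivita_leviCivita g).torsion_free (e l) (e i) y (he.mdiffAt hy l)
        (he.mdiffAt hy i)
      exact sub_eq_iff_eq_add.1 this)
  have h2 := leviCivita_fun_add g hb (he.mdiffAt_leviCivita hx i l)
  have h3 := (isLeviCivita_leviCivita g).torsion_free (e k) (mlieBracket (𝓡 m) (e l) (e i)) x
    (he.mdiffAt hx k) hb
  rw [h1, ← h3]
  have h4 := congrArg (fun L ↦ L (e k x)) h2
  simp only [add_apply] at h4
  refine (congrArg₂ HSub.hSub h4 rfl).trans ?_
  abel

/-- The first Bianchi identity. -/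
lemma curvature_bianchi (he : IsONFrameOn g U e) (hx : x ∈ U) (k l i : Fin m) :
    curvature g (e k) (e l) (e i) x + curvature g (e l) (e i) (e k) x
      + curvature g (e i) (e k) (e l) x = 0 := by
  have h1 := he.leviCivita_mlieBracket hx k l i
  have h2 := he.leviCivita_mlieBracket hx l i k
  have h3 := he.leviCivita_mlieBracket hx i k l
  have hs : ∀ i, ContMDiffAt (𝓡 m) (𝓡 m).tangent (minSmoothness ℝ 2)
      (fun x ↦ (⟨x, e i x⟩ : TangentBundle (𝓡 m) M)) x := fun i ↦
    (he.contMDiffAt hx i).of_le (by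
      rw [minSmoothness_of_isRCLikeNormedField]; exact WithTop.coe_le_coe.2 le_top)
  have : IsManifold (𝓡 m) (minSmoothness ℝ 3) M := IsManifold.of_le (n := ∞) (by
    rw [minSmoothness_of_isRCLikeNormedField]; exact WithTop.coe_le_coe.2 le_top)
  have hj := leibniz_identity_mlieBracket_apply (hs k) (hs l) (hs i)
  rw [mlieBracket_swap_apply (V := mlieBracket (𝓡 m) (e k) (e l)),
    mlieBracket_swap (V := e k) (W := e i)] at hj
  have h5 : mlieBracket (𝓡 m) (e l) (-mlieBracket (𝓡 m) (e i) (e k)) x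
      = -mlieBracket (𝓡 m) (e l) (mlieBracket (𝓡 m) (e i) (e k)) x := by
    have := mlieBracket_const_smul_right (I := 𝓡 m) (V := e l) (c := (-1 : ℝ))
      (W := mlieBracket (𝓡 m) (e i) (e k)) (x := x)
      ((he.contMDiffAt_mlieBracket hx i k).mdifferentiableAt (by simp))
    simpa using this
  rw [h5] at hj
  simp only [curvature]
  -- The six second derivatives are regrouped so that each pair has the same outer direction, as in
  -- `h1`, `h2`, `h3`.
  have h6 : ∀ a b c d f p q r s : TangentSpace (𝓡 m) x, a - b - p + (c - d - q) + (f - s - r)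
      = (a - s) + (c - b) + (f - d) - p - q - r := by intros; abel
  rw [h6, h1, h2, h3, hj]
  abel

lemma curvature_antisymm (he : IsONFrameOn g U e) (hx : x ∈ U) (k l i j : Fin m) :
    g.inner x (curvature g (e k) (e l) (e i) x) (e j x)
      = -g.inner x (curvature g (e l) (e k) (e i) x) (e j x) := by
  rw [he.inner_curvature hx, he.inner_curvature hx, ← sub_eq_zero]
  simp only [sub_mul, Finset.sum_sub_distrib]
  ring

lemma curvature_antisymm_right (he : IsONFrameOn g U e) (hx : x ∈ U) (k l i j : Fin m) :
    g.inner x (curvature g (e k) (e l) (e i) x) (e j x)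
      = -g.inner x (curvature g (e k) (e l) (e j) x) (e i x) := by
  -- An identity near the point, not only at it, because the curvature contains derivatives of the
  -- coefficients.
  have h : ∀ k i j, connCoeff g e k i j =ᶠ[𝓝 x] fun y ↦ -connCoeff g e k j i y := by
    intro k i j
    filter_upwards [he.isOpen.mem_nhds hx] with y hy using he.connCoeff_antisymm hy k i j
  have hd : ∀ k l i j, mvfderiv (𝓡 m) (connCoeff g e k i j) x (e l x)
      = -mvfderiv (𝓡 m) (connCoeff g e k j i) x (e l x) := by
    intro k l i j
    rw [mvfderiv_congr_of_eventuallyEq (h k i j), mvfderiv_fun_neg]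
    rfl
  rw [he.inner_curvature hx, he.inner_curvature hx, hd l k i j, hd k l i j]
  have h2 : ∀ k l, ∑ p, connCoeff g e l i p x * connCoeff g e k p j x
      = ∑ p, connCoeff g e k j p x * connCoeff g e l p i x := by
    intro k l
    refine Finset.sum_congr rfl fun p _ ↦ ?_
    rw [he.connCoeff_antisymm hx l i p, he.connCoeff_antisymm hx k p j]
    ring
  have h3 : ∀ p, connCoeff g e p i j x = -connCoeff g e p j i x :=
    fun p ↦ he.connCoeff_antisymm hx p i j
  simp only [Finset.sum_sub_distrib, h2 k l, h2 l k, h3, mul_neg, Finset.sum_neg_distrib]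
  ring

end IsONFrameOn

end OrthonormalFrames

/-! ### Algebra of the Clifford relations: triple products, the spin representation, contractions.
-/

section CliffordIdentities

lemma sum_cycle {ι : Type*} [Fintype ι] {A : Type*} [AddCommMonoid A] (F : ι → ι → ι → A) :
    ∑ k, ∑ l, ∑ j, F k l j = ∑ k, ∑ l, ∑ j, F j k l := by
  symm
  calc ∑ k, ∑ l, ∑ j, F j k l = ∑ k, ∑ j, ∑ l, F j k l :=
        Finset.sum_congr rfl fun k _ ↦ Finset.sum_comm
    _ = _ := Finset.sum_comm

lemma sum_flip {ι : Type*} [Fintype ι] {A : Type*} [AddCommMonoid A] (F : ι → ι → ι → A) :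
    ∑ k, ∑ l, ∑ j, F k l j = ∑ k, ∑ l, ∑ j, F j l k := by
  rw [sum_cycle]
  exact Finset.sum_comm

variable {ι : Type*} [DecidableEq ι] {A : Type*} [Ring A] [Algebra ℝ A]

/-- The Clifford relations `G_i G_j + G_j G_i = -2 δ_ij`. -/
def CliffordRelations (G : ι → A) : Prop :=
  ∀ i j, G i * G j + G j * G i = if i = j then (-2 : ℝ) • (1 : A) else 0

namespace CliffordRelations

variable {G : ι → A}

lemma mul_swap (hG : CliffordRelations G) (i j : ι) :
    G i * G j = -(G j * G i) + if i = j then (-2 : ℝ) • (1 : A) else 0 := by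
  rw [← hG i j]; abel

lemma sq (hG : CliffordRelations G) (i : ι) : G i * G i = -1 := by
  have h := hG i i
  rw [if_pos rfl, ← two_smul ℝ] at h
  have h2 : (2 : ℝ) • (G i * G i) = (2 : ℝ) • (-1 : A) := by rw [h]; simp
  exact smul_right_injective _ (two_ne_zero (α := ℝ)) h2

/-- `G k` is carried past two generators: the two signs cancel and each passage leaves a
contraction. -/
lemma mul_mul_eq (hG : CliffordRelations G) (k l j : ι) :
    G k * G l * G j = G l * G j * G k - (if k = l then (2 : ℝ) • G j else 0)
      + if k = j then (2 : ℝ) • G l else 0 := by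
  rw [hG.mul_swap k l, add_mul, neg_mul, mul_assoc (G l), hG.mul_swap k j, mul_add]
  split_ifs <;> simp [mul_assoc] <;> abel

variable [Fintype ι]

/-- The totally antisymmetric part of a triple product drops out when the cyclic sums of the
coefficients vanish. -/
lemma sum_triple (hG : CliffordRelations G) {Q : ι → ι → ι → ℝ} (hQ : ∀ k l j, Q k l j = -Q l k j)
    (hcyc : ∀ k l j, Q k l j + Q l j k + Q j k l = 0) :
    ∑ k, ∑ l, ∑ j, Q k l j • (G k * G l * G j) = (2 : ℝ) • ∑ k, ∑ l, Q k l k • G l := by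
  have hQ0 : ∀ k j, Q k k j = 0 := fun k j ↦ by linarith [hQ k k j]
  set T : A := ∑ k, ∑ l, Q k l k • G l with hT
  -- Cost of one cyclic rotation of the coefficients. The three rotations add up to zero by `hcyc`,
  -- so three times the sum is determined by contractions.
  have h1 : ∀ Q : ι → ι → ι → ℝ, (∑ k, ∑ l, ∑ j, Q k l j • (G k * G l * G j))
      = (∑ k, ∑ l, ∑ j, Q j k l • (G k * G l * G j)) - (2 : ℝ) • (∑ k, ∑ j, Q k k j • G j)
        + (2 : ℝ) • ∑ k, ∑ l, Q k l k • G l := by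
    intro Q
    have e1 : ∑ k, ∑ l, ∑ j, Q j k l • (G k * G l * G j)
        = ∑ k, ∑ l, ∑ j, Q k l j • (G l * G j * G k) :=
      (sum_cycle fun k l j ↦ Q k l j • (G l * G j * G k)).symm
    have e2 : ∀ k l j, Q k l j • (G k * G l * G j) = Q k l j • (G l * G j * G k)
        - (if k = l then Q k l j • (2 : ℝ) • G j else 0)
        + if k = j then Q k l j • (2 : ℝ) • G l else 0 := by
      intro k l j
      rw [hG.mul_mul_eq k l j]
      split_ifs <;> simp only [smul_add, smul_sub, smul_zero]
    rw [e1]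
    simp only [e2, smul_add, smul_sub, Finset.sum_add_distrib, Finset.sum_sub_distrib,
      smul_ite, smul_zero, Finset.sum_ite_eq, Finset.mem_univ, if_true, Finset.smul_sum]
    congr 1
    · congr 1
      refine Finset.sum_congr rfl fun k _ ↦ ?_
      rw [Finset.sum_comm]
      simp only [Finset.sum_ite_eq, Finset.mem_univ, if_true]
      exact Finset.sum_congr rfl fun j _ ↦ smul_comm _ _ _
    · exact Finset.sum_congr rfl fun k _ ↦ Finset.sum_congr rfl fun j _ ↦ smul_comm _ _ _
  have h2 := h1 Q
  have h3 := h1 (fun k l j ↦ Q j k l)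
  have h4 : (∑ k, ∑ l, ∑ j, Q k l j • (G k * G l * G j))
      + (∑ k, ∑ l, ∑ j, Q j k l • (G k * G l * G j))
      + (∑ k, ∑ l, ∑ j, Q l j k • (G k * G l * G j)) = 0 := by
    simp only [← Finset.sum_add_distrib, ← add_smul]
    refine Finset.sum_eq_zero fun k _ ↦ Finset.sum_eq_zero fun l _ ↦ Finset.sum_eq_zero fun j _ ↦ ?_
    rw [show Q k l j + Q j k l + Q l j k = 0 by linarith [hcyc k l j], zero_smul]
  have h5 : ∑ k, ∑ j, Q k k j • G j = 0 := by simp [hQ0]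
  have h6 : ∑ k, ∑ j, Q j k k • G j = -T := by
    rw [hT, Finset.sum_comm, ← Finset.sum_neg_distrib, Finset.sum_comm]
    refine Finset.sum_congr rfl fun k _ ↦ ?_
    rw [← Finset.sum_neg_distrib]
    refine Finset.sum_congr rfl fun j _ ↦ ?_
    rw [hQ j k k, neg_smul]
  have h7 : ∑ k, ∑ l, Q k k l • G l = 0 := h5
  rw [h5] at h2
  rw [h6, h7] at h3
  set S := ∑ k, ∑ l, ∑ j, Q k l j • (G k * G l * G j)
  set S' := ∑ k, ∑ l, ∑ j, Q j k l • (G k * G l * G j)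
  set S'' := ∑ k, ∑ l, ∑ j, Q l j k • (G k * G l * G j)
  -- Each rotation costs `2T`, so `S + (S - 2T) + (S - 4T) = 0`.
  have h8 : (3 : ℝ) • S = (3 : ℝ) • ((2 : ℝ) • T) := by
    have e3 : S' = S - (2 : ℝ) • T := by rw [h2, ← hT]; simp
    have e4 : S'' = S' - (2 : ℝ) • T := by rw [h3]; simp
    rw [e4, e3] at h4
    have : (3 : ℝ) • S - (3 : ℝ) • ((2 : ℝ) • T) = 0 := by rw [← h4]; module
    exact sub_eq_zero.1 this
  exact smul_right_injective _ (three_ne_zero (α := ℝ)) h8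

/-- The spin representation `(1/4) ∑ w_ij G_i G_j` of a skew matrix. -/
def spinRep (G : ι → A) (w : ι → ι → ℝ) : A :=
  (1 / 4 : ℝ) • ∑ i, ∑ j, w i j • (G i * G j)

/-- Clifford multiplication by a vector. -/
def vecRep (G : ι → A) (v : ι → ℝ) : A := ∑ i, v i • G i

/-- The isomorphism of Lie algebras spin ≅ so: bracketing with `spinRep G w` rotates vectors by `w`.
The factor `1/4` in `spinRep` is fixed by this, since each passage yields 2 and skewness doubles it.
-/
lemma spinRep_commutator_gen (hG : CliffordRelations G) {w : ι → ι → ℝ}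
    (hw : ∀ i j, w i j = -w j i) (p : ι) :
    spinRep G w * G p - G p * spinRep G w = ∑ j, w p j • G j := by
  have h : ∀ i j, w i j • (G i * G j) * G p - G p * (w i j • (G i * G j))
      = (if p = i then (2 : ℝ) • w i j • G j else 0)
        - if p = j then (2 : ℝ) • w i j • G i else 0 := by
    intro i j
    rw [smul_mul_assoc, mul_smul_comm, ← mul_assoc, hG.mul_mul_eq p i j]
    split_ifs <;> simp only [smul_add, smul_sub, smul_zero, smul_comm (w i j) (2 : ℝ)] <;> abel
  rw [spinRep, smul_mul_assoc, mul_smul_comm, ← smul_sub]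
  simp only [Finset.sum_mul, Finset.mul_sum, ← Finset.sum_sub_distrib, h]
  simp only [Finset.sum_sub_distrib, Finset.sum_ite_eq, Finset.mem_univ, if_true]
  have h2 : ∑ i, ∑ j, (if p = i then (2 : ℝ) • w i j • G j else 0)
      = (2 : ℝ) • ∑ j, w p j • G j := by
    rw [Finset.sum_comm]
    simp [Finset.smul_sum]
  have h3 : ∑ i, (2 : ℝ) • w i p • G i = -((2 : ℝ) • ∑ j, w p j • G j) := by
    rw [Finset.smul_sum, ← Finset.sum_neg_distrib]
    refine Finset.sum_congr rfl fun i _ ↦ ?_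
    rw [hw i p]; module
  rw [h2, h3]
  module

lemma spinRep_commutator_vecRep (hG : CliffordRelations G) {w : ι → ι → ℝ}
    (hw : ∀ i j, w i j = -w j i) (v : ι → ℝ) :
    spinRep G w * vecRep G v - vecRep G v * spinRep G w
      = vecRep G (fun j ↦ ∑ i, v i * w i j) := by
  simp only [vecRep, Finset.mul_sum, Finset.sum_mul, ← Finset.sum_sub_distrib, mul_smul_comm,
    smul_mul_assoc, ← smul_sub, hG.spinRep_commutator_gen hw, Finset.smul_sum, Finset.sum_smul,
    smul_smul]
  exact Finset.sum_comm

/-- A commutator is a derivation, so the rule for generators decides it. The resulting matrix is the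
quadratic part of the curvature of a connection form. -/
lemma spinRep_commutator_spinRep (hG : CliffordRelations G) {w z : ι → ι → ℝ}
    (hw : ∀ i j, w i j = -w j i) :
    spinRep G w * spinRep G z - spinRep G z * spinRep G w
      = spinRep G (fun i j ↦ ∑ p, (z i p * w p j - w i p * z p j)) := by
  have h : ∀ i j, spinRep G w * (G i * G j) - G i * G j * spinRep G w
      = ∑ p, w i p • (G p * G j) + ∑ p, w j p • (G i * G p) := by
    intro i j
    have h1 := congrArg (· * G j) (hG.spinRep_commutator_gen hw i)
    have h2 := congrArg (G i * ·) (hG.spinRep_commutator_gen hw j)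
    simp only [Finset.sum_mul, Finset.mul_sum, smul_mul_assoc, mul_smul_comm] at h1 h2
    rw [← h1, ← h2]
    noncomm_ring
  generalize spinRep G w = S at h ⊢
  simp only [spinRep]
  rw [mul_smul_comm, smul_mul_assoc, ← smul_sub]
  congr 1
  simp only [Finset.mul_sum, Finset.sum_mul, ← Finset.sum_sub_distrib, mul_smul_comm,
    smul_mul_assoc, ← smul_sub, h]
  simp only [smul_add, Finset.sum_add_distrib, Finset.smul_sum, Finset.sum_sub_distrib, sub_smul,
    Finset.sum_smul, smul_smul]
  have e1 : ∑ i, ∑ j, ∑ p, (z i j * w i p) • (G p * G j)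
      = -∑ i, ∑ j, ∑ p, (w i p * z p j) • (G i * G j) := by
    rw [sum_flip]
    simp only [← Finset.sum_neg_distrib]
    refine Finset.sum_congr rfl fun i _ ↦ Finset.sum_congr rfl fun j _ ↦
      Finset.sum_congr rfl fun p _ ↦ ?_
    rw [hw p i, ← neg_smul]
    congr 1
    ring
  have e2 : ∑ i, ∑ j, ∑ p, (z i j * w j p) • (G i * G p)
      = ∑ i, ∑ j, ∑ p, (z i p * w p j) • (G i * G j) := by
    refine Finset.sum_congr rfl fun i _ ↦ ?_
    rw [Finset.sum_comm]
  rw [e1, e2]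
  abel

/-- The algebraic source of the Gauss term. With `a k` the vector `h k`, one has `∑ G k * a k = -tr
h` and `∑ a l * a l = -|h|²`. Moving `G l` past `a k` evaluates the first half of the commutator as
`-(tr h)² + 2|h|²`; the second half factors as nested traces and equals `(tr h)²`. -/
lemma vecRep_contraction (hG : CliffordRelations G) {h : ι → ι → ℝ}
    (hh : ∀ i j, h i j = h j i) :
    ∑ k, ∑ l, G k * G l * (vecRep G (h k) * vecRep G (h l) - vecRep G (h l) * vecRep G (h k))
      = (2 * (∑ k, ∑ l, h k l ^ 2) - 2 * (∑ k, h k k) ^ 2) • (1 : A) := by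
  set a : ι → A := fun k ↦ vecRep G (h k) with ha
  have hga : ∀ k l, G l * a k = -(a k * G l) + (-2 * h k l) • (1 : A) := by
    intro k l
    simp only [ha, vecRep, Finset.mul_sum, Finset.sum_mul, mul_smul_comm, smul_mul_assoc]
    simp only [hG.mul_swap l, smul_add, Finset.sum_add_distrib, smul_neg, Finset.sum_neg_distrib,
      smul_ite, smul_zero, Finset.sum_ite_eq, Finset.mem_univ, if_true, smul_smul]
    rw [mul_comm]
  -- By symmetry of `h` the sum equals its version with the factors exchanged, so only the
  -- anticommutators survive.
  have htr : ∑ k, G k * a k = (-∑ k, h k k) • (1 : A) := by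
    have h1 : ∑ k, G k * a k = ∑ k, ∑ l, h k l • (G k * G l) := by
      simp only [ha, vecRep, Finset.mul_sum, mul_smul_comm]
    have h2 : ∑ k, ∑ l, h k l • (G k * G l)
        = -(∑ k, ∑ l, h k l • (G k * G l)) + (-2 * ∑ k, h k k) • (1 : A) := by
      conv_lhs => rw [Finset.sum_comm]
      have : ∀ k l, h l k • (G l * G k) = -(h k l • (G k * G l))
          + if k = l then (-2 * h k k) • (1 : A) else 0 := by
        intro k l
        rw [hG.mul_swap l k, smul_add, hh l k, smul_neg, smul_ite, smul_zero]
        by_cases hkl : k = l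
        · subst hkl; simp only [if_true, smul_smul]; rw [mul_comm]
        · simp [hkl, Ne.symm hkl]
      rw [Finset.sum_congr rfl fun k _ ↦ Finset.sum_congr rfl fun l _ ↦ this k l]
      simp only [Finset.sum_add_distrib, Finset.sum_neg_distrib, Finset.sum_ite_eq,
        Finset.mem_univ, if_true, Finset.mul_sum, Finset.sum_smul]
    have h3 : (2 : ℝ) • ∑ k, ∑ l, h k l • (G k * G l)
        = (2 : ℝ) • ((-∑ k, h k k) • (1 : A)) := by
      rw [two_smul]
      nth_rewrite 1 [h2]
      module
    rw [h1]
    exact smul_right_injective _ (two_ne_zero (α := ℝ)) h3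
  have hga' : ∀ l, ∑ k, h k l • G k = a l := fun l ↦ by simp only [ha, vecRep, hh _ l]
  have haa : ∀ l, a l * a l = (-∑ k, h l k ^ 2) • (1 : A) := by
    intro l
    have h1 : (2 : ℝ) • (a l * a l) = ∑ k, h l k • (G k * a l + a l * G k) := by
      have e1 : ∑ k, h l k • (G k * a l) = a l * a l := by
        simp only [← smul_mul_assoc, ← Finset.sum_mul]
        rfl
      have e2 : ∑ k, h l k • (a l * G k) = a l * a l := by
        simp only [← mul_smul_comm, ← Finset.mul_sum]
        rfl
      simp only [smul_add, Finset.sum_add_distrib]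
      rw [two_smul, e1, e2]
    have h2 : (2 : ℝ) • (a l * a l) = (2 : ℝ) • ((-∑ k, h l k ^ 2) • (1 : A)) := by
      have h3 : ∀ k, G k * a l + a l * G k = (-2 * h l k) • (1 : A) := by
        intro k; rw [hga l k]; abel
      rw [h1, smul_smul]
      simp only [h3, smul_smul]
      rw [← Finset.sum_smul]
      congr 1
      rw [mul_neg, Finset.mul_sum, ← Finset.sum_neg_distrib]
      exact Finset.sum_congr rfl fun k _ ↦ by ring
    exact smul_right_injective _ (two_ne_zero (α := ℝ)) h2
  have hsq : ∑ l, a l * a l = (-∑ k, ∑ l, h k l ^ 2) • (1 : A) := by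
    simp only [haa]
    rw [← Finset.sum_smul, Finset.sum_neg_distrib]
  have h1 : ∀ k l, G k * G l * (a k * a l - a l * a k)
      = -(G k * a k * (G l * a l)) + (-2 : ℝ) • ((h k l • G k) * a l)
        - G k * (G l * a l) * a k := by
    intro k l
    have : G k * G l * (a k * a l) = -(G k * a k * (G l * a l)) + (-2 : ℝ) • ((h k l • G k) * a l) := by
      rw [mul_assoc, ← mul_assoc (G l), hga k l, add_mul, mul_add, neg_mul, mul_neg]
      simp only [smul_mul_assoc, mul_smul_comm, one_mul, smul_smul, mul_assoc]
    rw [mul_sub, this]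
    simp only [mul_assoc]
  change ∑ k, ∑ l, G k * G l * (a k * a l - a l * a k) = _
  simp only [h1, Finset.sum_sub_distrib, Finset.sum_add_distrib, Finset.sum_neg_distrib]
  have s1 : ∑ k, ∑ l, G k * a k * (G l * a l) = (∑ k, h k k) ^ 2 • (1 : A) := by
    simp only [← Finset.mul_sum, ← Finset.sum_mul, htr]
    rw [smul_mul_smul_comm, mul_one]
    congr 1; ring
  have s2 : ∑ k, ∑ l, (-2 : ℝ) • ((h k l • G k) * a l)
      = (2 * ∑ k, ∑ l, h k l ^ 2) • (1 : A) := by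
    rw [Finset.sum_comm]
    simp only [← Finset.smul_sum, ← Finset.sum_mul, hga', hsq]
    module
  have s3 : ∑ k, ∑ l, G k * (G l * a l) * a k = (∑ k, h k k) ^ 2 • (1 : A) := by
    simp only [← Finset.mul_sum, ← Finset.sum_mul, htr, mul_smul_comm, smul_mul_assoc, mul_one]
    rw [← Finset.smul_sum, htr, smul_smul]
    congr 1; ring
  rw [s1, s2, s3]
  module

end CliffordRelations

end CliffordIdentities

/-! ### Integrability of the equation ∇_X u = -(1/2) h(X)·u. -/

section ParallelCurvature

open CliffordRelations

variable {m : ℕ} {V : Type*} [NormedAddCommGroup V] [InnerProductSpace ℂ V]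

lemma CliffordModule.cliffordRelations (c : CliffordModule m V) :
    CliffordRelations (A := Module.End ℂ V) c.gamma := by
  intro i j
  ext w
  have := c.anticomm i j w
  rw [LinearMap.add_apply, Module.End.mul_apply, Module.End.mul_apply, this]
  split_ifs
  · simp only [LinearMap.smul_apply, Module.End.one_apply]
    rw [← Complex.coe_smul]; norm_num
  · rfl

lemma CliffordModule.re_inner_gamma (c : CliffordModule m V) (i : Fin m) (u : V) :
    (inner ℂ (c.gamma i u) u).re = 0 := by
  have h := congrArg Complex.re (c.skew i u u)
  rw [← inner_conj_symm u (c.gamma i u)] at h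
  simp only [Complex.neg_re, Complex.conj_re] at h
  linarith

/-- Skewness makes the real part symmetric in `i` and `j`, hence half of that of the anticommutator.
-/
lemma CliffordModule.re_inner_gamma_gamma (c : CliffordModule m V) (i j : Fin m) (u : V) :
    (inner ℂ (c.gamma i (c.gamma j u)) u).re = if i = j then -‖u‖ ^ 2 else 0 := by
  have h1 : ∀ i j, (inner ℂ (c.gamma i (c.gamma j u)) u).re
      = (inner ℂ (c.gamma j (c.gamma i u)) u).re := by
    intro i j
    rw [c.skew, c.skew, ← inner_conj_symm u, neg_neg, Complex.conj_re]
  have h2 := congrArg (fun w ↦ (inner ℂ w u).re) (c.anticomm i j u)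
  simp only [inner_add_left, Complex.add_re, h1 j i] at h2
  split_ifs at h2 ⊢ with h
  · rw [inner_smul_left, inner_self_eq_norm_sq_to_K] at h2
    have h3 : (starRingEnd ℂ (-2 : ℂ) * ((‖u‖ : ℝ) : ℂ) ^ 2).re = -2 * ‖u‖ ^ 2 := by
      rw [← Complex.ofReal_pow, map_neg, map_ofNat]
      have : (-2 : ℂ) = ((-2 : ℝ) : ℂ) := by push_cast; rfl
      rw [this, Complex.re_ofReal_mul, Complex.ofReal_re]
    have h4 := h2.trans h3
    linarith
  · rw [inner_zero_left, Complex.zero_re] at h2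
    linarith

lemma re_inner_real_smul_left (r : ℝ) (v w : V) :
    (inner ℂ (r • v) w).re = r * (inner ℂ v w).re := by
  rw [← Complex.coe_smul, inner_smul_left, Complex.conj_ofReal, Complex.re_ofReal_mul]

namespace CliffordRelations

variable {ι : Type*} [Fintype ι] {A : Type*} [Ring A] [Algebra ℝ A] (G : ι → A)

lemma spinRep_add (w z : ι → ι → ℝ) :
    spinRep G (fun i j ↦ w i j + z i j) = spinRep G w + spinRep G z := by
  simp only [spinRep, add_smul, Finset.sum_add_distrib, smul_add]

lemma spinRep_sub (w z : ι → ι → ℝ) :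
    spinRep G (fun i j ↦ w i j - z i j) = spinRep G w - spinRep G z := by
  simp only [spinRep, sub_smul, Finset.sum_sub_distrib, smul_sub]

lemma spinRep_sum_smul (a : ι → ℝ) (w : ι → ι → ι → ℝ) :
    spinRep G (fun i j ↦ ∑ p, a p * w p i j) = ∑ p, a p • spinRep G (w p) := by
  simp only [spinRep, Finset.sum_smul, Finset.smul_sum, smul_smul]
  refine ((sum_cycle _).trans (sum_cycle _)).trans ?_
  refine Finset.sum_congr rfl fun p _ ↦ Finset.sum_congr rfl fun i _ ↦
    Finset.sum_congr rfl fun j _ ↦ ?_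
  congr 1
  ring

lemma vecRep_add (v w : ι → ℝ) : vecRep G (fun i ↦ v i + w i) = vecRep G v + vecRep G w := by
  simp only [vecRep, add_smul, Finset.sum_add_distrib]

lemma vecRep_sub (v w : ι → ℝ) : vecRep G (fun i ↦ v i - w i) = vecRep G v - vecRep G w := by
  simp only [vecRep, sub_smul, Finset.sum_sub_distrib]

lemma vecRep_sum_smul (a : ι → ℝ) (v : ι → ι → ℝ) :
    vecRep G (fun i ↦ ∑ p, a p * v p i) = ∑ p, a p • vecRep G (v p) := by
  simp only [vecRep, Finset.sum_smul, Finset.smul_sum, smul_smul]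
  exact Finset.sum_comm

end CliffordRelations

/-- Contracting the curvature identity of a spinor `u` with `∇_X u = -(1/2) h(X) u`. -/
lemma CliffordModule.curvature_contraction (c : CliffordModule m V) (u : V)
    {R : Fin m → Fin m → Fin m → Fin m → ℝ} {Q : Fin m → Fin m → Fin m → ℝ}
    {h : Fin m → Fin m → ℝ} (hR : ∀ k l i j, R k l i j = -R l k i j)
    (hR' : ∀ k l i j, R k l i j = -R k l j i)
    (hRc : ∀ k l i j, R k l i j + R l i k j + R i k l j = 0)
    (hQ : ∀ k l j, Q k l j = -Q l k j) (hQc : ∀ k l j, Q k l j + Q l j k + Q j k l = 0)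
    (hh : ∀ i j, h i j = h j i)
    (hu : ∀ k l, (spinRep c.gamma (R k l) + (1 / 2 : ℝ) • vecRep c.gamma (Q k l)
      + (1 / 4 : ℝ) • (vecRep c.gamma (h k) * vecRep c.gamma (h l)
        - vecRep c.gamma (h l) * vecRep c.gamma (h k)) : Module.End ℂ V) u = 0) :
    ((∑ k, ∑ l, R k l l k) + (∑ k, ∑ l, h k l ^ 2) - (∑ k, h k k) ^ 2) * ‖u‖ ^ 2 = 0 := by
  have hG := c.cliffordRelations
  set G : Fin m → Module.End ℂ V := c.gamma with hGdef
  have hsum : (∑ k, ∑ l, G k * G l * (spinRep G (R k l) + (1 / 2 : ℝ) • vecRep G (Q k l)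
      + (1 / 4 : ℝ) • (vecRep G (h k) * vecRep G (h l)
        - vecRep G (h l) * vecRep G (h k)))) u = 0 := by
    simp only [LinearMap.sum_apply, Module.End.mul_apply, hu, map_zero, Finset.sum_const_zero]
  -- For fixed last index `j`, the Bianchi identity is the cyclic hypothesis of `sum_triple`; the
  -- fourfold product collapses to a Ricci contraction.
  have h1 : ∑ k, ∑ l, G k * G l * spinRep G (R k l)
      = (1 / 2 : ℝ) • ∑ j, ∑ k, ∑ l, R k l k j • (G l * G j) := by
    have e1 : ∀ j, ∑ k, ∑ l, ∑ i, R k l i j • (G k * G l * G i)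
        = (2 : ℝ) • ∑ k, ∑ l, R k l k j • G l := fun j ↦
      hG.sum_triple (Q := fun k l i ↦ R k l i j) (fun k l i ↦ hR k l i j) fun k l i ↦ hRc k l i j
    have e2 : ∑ k, ∑ l, G k * G l * spinRep G (R k l)
        = (1 / 4 : ℝ) • ∑ j, (∑ k, ∑ l, ∑ i, R k l i j • (G k * G l * G i)) * G j := by
      simp only [spinRep, Finset.mul_sum, Finset.sum_mul, Finset.smul_sum, mul_smul_comm,
        smul_mul_assoc, mul_assoc]
      symm
      rw [Finset.sum_comm]
      refine Finset.sum_congr rfl fun k _ ↦ ?_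
      rw [Finset.sum_comm]
      refine Finset.sum_congr rfl fun l _ ↦ ?_
      rw [Finset.sum_comm]
    rw [e2]
    simp only [e1, smul_mul_assoc, Finset.sum_mul]
    rw [← Finset.smul_sum, smul_smul]
    norm_num
  -- The Codazzi term contracts to a vector, whose real expectation in `u` is zero by skewness.
  have h2 : ∑ k, ∑ l, G k * G l * ((1 / 2 : ℝ) • vecRep G (Q k l)) = ∑ k, ∑ l, Q k l k • G l := by
    have e1 := hG.sum_triple hQ hQc
    have e2 : ∑ k, ∑ l, G k * G l * ((1 / 2 : ℝ) • vecRep G (Q k l))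
        = (1 / 2 : ℝ) • ∑ k, ∑ l, ∑ j, Q k l j • (G k * G l * G j) := by
      simp only [vecRep, Finset.mul_sum, mul_smul_comm, Finset.smul_sum]
    rw [e2, e1, smul_smul]
    norm_num
  have h3 : ∑ k, ∑ l, G k * G l * ((1 / 4 : ℝ) • (vecRep G (h k) * vecRep G (h l)
        - vecRep G (h l) * vecRep G (h k)))
      = ((1 / 2) * ((∑ k, ∑ l, h k l ^ 2) - (∑ k, h k k) ^ 2)) • (1 : Module.End ℂ V) := by
    simp only [mul_smul_comm, ← Finset.smul_sum]
    rw [hG.vecRep_contraction hh, smul_smul]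
    congr 1
    ring
  simp only [mul_add, Finset.sum_add_distrib] at hsum
  rw [h1, h2, h3] at hsum
  have h4 := congrArg (fun w ↦ (inner ℂ w u).re) hsum
  simp only [LinearMap.add_apply, LinearMap.smul_apply, LinearMap.sum_apply, Module.End.mul_apply,
    Module.End.one_apply, inner_add_left, Complex.add_re, re_inner_real_smul_left, sum_inner,
    Complex.re_sum, hGdef, c.re_inner_gamma, c.re_inner_gamma_gamma, mul_zero,
    Finset.sum_const_zero, add_zero, inner_zero_left, Complex.zero_re, mul_ite,
    Finset.sum_ite_eq', Finset.mem_univ, if_true] at h4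
  have h5 : (inner ℂ u u).re = ‖u‖ ^ 2 := inner_self_eq_norm_sq (𝕜 := ℂ) u
  -- The real part retains only the diagonal of the Ricci contraction, and the sign is absorbed by
  -- the antisymmetry of the last two indices.
  have h6 : ∑ j, ∑ k, R k j k j * -‖u‖ ^ 2 = (∑ k, ∑ l, R k l l k) * ‖u‖ ^ 2 := by
    rw [Finset.sum_comm, Finset.sum_mul]
    refine Finset.sum_congr rfl fun k _ ↦ ?_
    rw [Finset.sum_mul]
    refine Finset.sum_congr rfl fun l _ ↦ ?_
    rw [hR' k l k l]
    ring
  rw [h5, h6] at h4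
  linarith

/-- The first order operator `-(Ω + (1/2) A)` with `Ω` the spin representation of the connection
form and `A` the Clifford multiplication by a row of the second fundamental form. -/
def killingOp {A : Type*} [Ring A] [Algebra ℝ A] (G : Fin m → A)
    (w : Fin m → Fin m → ℝ) (h : Fin m → ℝ) : A :=
  -(spinRep G w + (1 / 2 : ℝ) • vecRep G h)

/-- Pure algebra at one point: `dw k l` and `dh k l` stand for the derivatives of `w l` and `h l`
along `e k`, and `hu` is the identity du([e_k, e_l]) = e_k(e_l u) - e_l(e_k u) after insertion of
the equation for `u`. Collecting terms puts it in the form required by `curvature_contraction`. -/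
lemma CliffordModule.commutator_identity (c : CliffordModule m V) (u : V)
    {w : Fin m → Fin m → Fin m → ℝ} {dw : Fin m → Fin m → Fin m → Fin m → ℝ}
    {h : Fin m → Fin m → ℝ} {dh : Fin m → Fin m → Fin m → ℝ}
    {R : Fin m → Fin m → Fin m → Fin m → ℝ}
    (hw : ∀ k i j, w k i j = -w k j i) (hh : ∀ i j, h i j = h j i)
    (hdh : ∀ k i j, dh k i j = dh k j i)
    (hRw : ∀ k l i j, R k l i j = dw k l i j - dw l k i j
      + ∑ p, (w l i p * w k p j - w k i p * w l p j) - ∑ p, (w k l p - w l k p) * w p i j)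
    (hR : ∀ k l i j, R k l i j = -R l k i j) (hR' : ∀ k l i j, R k l i j = -R k l j i)
    (hRc : ∀ k l i j, R k l i j + R l i k j + R i k l j = 0)
    (hu : ∀ k l, ∑ p, (w k l p - w l k p) • killingOp (A := Module.End ℂ V) c.gamma (w p) (h p) u
      = killingOp (A := Module.End ℂ V) c.gamma (dw k l) (dh k l) u
          + killingOp (A := Module.End ℂ V) c.gamma (w l) (h l)
            (killingOp (A := Module.End ℂ V) c.gamma (w k) (h k) u)
        - (killingOp (A := Module.End ℂ V) c.gamma (dw l k) (dh l k) u
          + killingOp (A := Module.End ℂ V) c.gamma (w k) (h k)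
            (killingOp (A := Module.End ℂ V) c.gamma (w l) (h l) u))) :
    ((∑ k, ∑ l, R k l l k) + (∑ k, ∑ l, h k l ^ 2) - (∑ k, h k k) ^ 2) * ‖u‖ ^ 2 = 0 := by
  have hG := c.cliffordRelations
  set a : Fin m → Fin m → Fin m → ℝ := fun k l j ↦ ∑ i, h l i * w k i j with ha
  -- The Codazzi tensor (∇_k h)(e_l, e_j) - (∇_l h)(e_k, e_j) in the frame. Its cyclic sum vanishes
  -- by the symmetry of `h` alone, which is all that is used of it.
  set Q : Fin m → Fin m → Fin m → ℝ := fun k l j ↦ (dh k l j - dh l k j) + (a k l j - a l k j)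
    - ∑ p, (w k l p - w l k p) * h p j with hQdef
  have hQ : ∀ k l j, Q k l j = -Q l k j := by
    intro k l j
    simp only [hQdef, sub_mul, Finset.sum_sub_distrib]
    ring
  have hQc : ∀ k l j, Q k l j + Q l j k + Q j k l = 0 := by
    have e : ∀ k l j, ∑ p, w k l p * h p j = -a k j l := by
      intro k l j
      rw [ha, ← Finset.sum_neg_distrib]
      refine Finset.sum_congr rfl fun p _ ↦ ?_
      rw [hw k l p, hh p j]; ring
    intro k l j
    simp only [hQdef, sub_mul, Finset.sum_sub_distrib, e]
    rw [hdh k l j, hdh l k j, hdh j k l]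
    ring
  refine c.curvature_contraction u hR hR' hRc hQ hQc hh fun k l ↦ ?_
  set G : Fin m → Module.End ℂ V := c.gamma with hGdef
  have e1 : spinRep G (R k l) = spinRep G (dw k l) - spinRep G (dw l k)
      + (spinRep G (w k) * spinRep G (w l) - spinRep G (w l) * spinRep G (w k))
      - ∑ p, (w k l p - w l k p) • spinRep G (w p) := by
    rw [hG.spinRep_commutator_spinRep (hw k), ← spinRep_sum_smul, ← spinRep_sub, ← spinRep_add,
      ← spinRep_sub]
    congr 1
    funext i j
    exact hRw k l i j
  have e2 : vecRep G (Q k l) = vecRep G (dh k l) - vecRep G (dh l k)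
      + ((spinRep G (w k) * vecRep G (h l) - vecRep G (h l) * spinRep G (w k))
        - (spinRep G (w l) * vecRep G (h k) - vecRep G (h k) * spinRep G (w l)))
      - ∑ p, (w k l p - w l k p) • vecRep G (h p) := by
    rw [hG.spinRep_commutator_vecRep (hw k), hG.spinRep_commutator_vecRep (hw l),
      ← vecRep_sum_smul, ← vecRep_sub, ← vecRep_sub, ← vecRep_add, ← vecRep_sub]
  have e3 : spinRep G (R k l) + (1 / 2 : ℝ) • vecRep G (Q k l)
      + (1 / 4 : ℝ) • (vecRep G (h k) * vecRep G (h l) - vecRep G (h l) * vecRep G (h k))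
      = ∑ p, (w k l p - w l k p) • killingOp G (w p) (h p)
        - ((killingOp G (dw k l) (dh k l) + killingOp G (w l) (h l) * killingOp G (w k) (h k))
          - (killingOp G (dw l k) (dh l k)
            + killingOp G (w k) (h k) * killingOp G (w l) (h l))) := by
    have e4 : ∑ p, (w k l p - w l k p) • killingOp G (w p) (h p)
        = -(∑ p, (w k l p - w l k p) • spinRep G (w p))
          - (1 / 2 : ℝ) • ∑ p, (w k l p - w l k p) • vecRep G (h p) := by
      rw [Finset.smul_sum, ← Finset.sum_neg_distrib, ← Finset.sum_sub_distrib]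
      refine Finset.sum_congr rfl fun p _ ↦ ?_
      rw [killingOp]
      module
    rw [e1, e2, e4]
    simp only [killingOp, neg_mul_neg, add_mul, mul_add, smul_mul_assoc, mul_smul_comm]
    module
  rw [e3]
  have e5 := hu k l
  simp only [LinearMap.sub_apply, LinearMap.add_apply, LinearMap.sum_apply, LinearMap.smul_apply,
    Module.End.mul_apply]
  rw [e5, sub_self]

variable [FiniteDimensional ℂ V]

/-- A complex endomorphism of a finite dimensional space as a continuous real-linear map. -/
def endToCLM (T : Module.End ℂ V) : V →L[ℝ] V :=
  (LinearMap.toContinuousLinearMap T).restrictScalars ℝ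

section
variable {E : Type*} [NormedAddCommGroup E] [NormedSpace ℝ E]
  {H : Type*} [TopologicalSpace H] {I : ModelWithCorners ℝ E H}
  {M : Type*} [TopologicalSpace M] [ChartedSpace H M]

lemma mvfderiv_sum_smul_end {ι : Type*} [Fintype ι] (T : ι → Module.End ℂ V) {a : ι → M → ℝ}
    {u : M → V} {x : M} (ha : ∀ i, MDiffAt (a i) x) (hu : MDifferentiableAt I 𝓘(ℝ, V) u x) :
    MDifferentiableAt I 𝓘(ℝ, V) (fun y ↦ ∑ i, a i y • T i (u y)) x ∧
    ∀ X : TangentSpace I x, mvfderiv I (fun y ↦ ∑ i, a i y • T i (u y)) x X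
      = ∑ i, mvfderiv I (a i) x X • T i (u x) + ∑ i, a i x • T i (mvfderiv I u x X) := by
  have h := fun i ↦ mvfderiv_smul_clm (I := I) (endToCLM (T i)) (ha i) hu
  obtain ⟨h1, h2⟩ := mvfderiv_sum (I := I) Finset.univ fun i _ ↦ (h i).1
  refine ⟨h1, fun X ↦ ?_⟩
  rw [← Finset.sum_add_distrib]
  exact (h2 X).trans (Finset.sum_congr rfl fun i _ ↦ (h i).2 X)

lemma mvfderiv_killingOp (G : Fin m → Module.End ℂ V) {w : Fin m → Fin m → M → ℝ}
    {h : Fin m → M → ℝ} {u : M → V} {x : M} (hw : ∀ i j, MDiffAt (w i j) x)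
    (hh : ∀ i, MDiffAt (h i) x) (hu : MDifferentiableAt I 𝓘(ℝ, V) u x) (X : TangentSpace I x) :
    mvfderiv I (fun y ↦ killingOp G (fun i j ↦ w i j y) (fun i ↦ h i y) (u y)) x X
      = killingOp G (fun i j ↦ mvfderiv I (w i j) x X) (fun i ↦ mvfderiv I (h i) x X) (u x)
        + killingOp G (fun i j ↦ w i j x) (fun i ↦ h i x) (mvfderiv I u x X) := by
  -- The operator is written as one finite sum of scalar coefficients times fixed endomorphisms, to
  -- which the Leibniz rule applies at once.
  have key : ∀ (a : Fin m → Fin m → ℝ) (b : Fin m → ℝ) (v : V),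
      killingOp G a b v = ∑ s : (Fin m × Fin m) ⊕ Fin m,
        Sum.elim (fun p ↦ a p.1 p.2) b s
          • (Sum.elim (fun p ↦ (-(1 / 4) : ℝ) • (G p.1 * G p.2)) (fun i ↦ (-(1 / 2) : ℝ) • G i) s :
            Module.End ℂ V) v := by
    intro a b v
    simp only [Fintype.sum_sum_type, Sum.elim_inl, Sum.elim_inr, Fintype.sum_prod_type, killingOp,
      spinRep, vecRep, LinearMap.neg_apply, LinearMap.add_apply, LinearMap.smul_apply,
      LinearMap.sum_apply]
    rw [neg_add, Finset.smul_sum, Finset.smul_sum, ← Finset.sum_neg_distrib,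
      ← Finset.sum_neg_distrib]
    congr 1
    · refine Finset.sum_congr rfl fun i _ ↦ ?_
      rw [Finset.smul_sum, ← Finset.sum_neg_distrib]
      exact Finset.sum_congr rfl fun j _ ↦ by module
    · exact Finset.sum_congr rfl fun i _ ↦ by module
  have h1 := (mvfderiv_sum_smul_end (I := I)
    (Sum.elim (fun p : Fin m × Fin m ↦ (-(1 / 4) : ℝ) • (G p.1 * G p.2))
      (fun i ↦ (-(1 / 2) : ℝ) • G i))
    (a := Sum.elim (fun p ↦ w p.1 p.2) h) (x := x) (by
      rintro (p | i)
      · exact hw p.1 p.2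
      · exact hh i) hu).2 X
  have e1 : ∀ y (s : (Fin m × Fin m) ⊕ Fin m),
      Sum.elim (fun p : Fin m × Fin m ↦ w p.1 p.2 y) (fun i ↦ h i y) s
        = (Sum.elim (fun p : Fin m × Fin m ↦ w p.1 p.2) h s : M → ℝ) y := by
    rintro y (p | i) <;> rfl
  have e2 : ∀ (s : (Fin m × Fin m) ⊕ Fin m),
      Sum.elim (fun p : Fin m × Fin m ↦ mvfderiv I (w p.1 p.2) x X)
          (fun i ↦ mvfderiv I (h i) x X) s
        = mvfderiv I (Sum.elim (fun p : Fin m × Fin m ↦ w p.1 p.2) h s : M → ℝ) x X := by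
    rintro (p | i) <;> rfl
  simp only [key, e1, e2]
  exact h1

end

/-- If `∇_X u = -(1/2) h(X) ⬝ u` for a symmetric bilinear form `h`, then
`S = (tr h)² - |h|²` wherever `u` does not vanish. -/
lemma IsONFrameOn.scalar_identity {M : Type*} [TopologicalSpace M]
    [ChartedSpace (EuclideanSpace ℝ (Fin m)) M] [IsManifold (𝓡 m) ∞ M] {g : RiemMetric m M}
    {U : Set M} {e : Fin m → Π x : M, TangentSpace (𝓡 m) x} (he : IsONFrameOn g U e)
    (c : CliffordModule m V) {u : M → V} {h : Fin m → Fin m → M → ℝ}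
    (hu : ∀ y ∈ U, ContMDiffAt (𝓡 m) 𝓘(ℝ, V) ∞ u y)
    (hh : ∀ i j, ∀ y ∈ U, MDifferentiableAt (𝓡 m) 𝓘(ℝ, ℝ) (h i j) y)
    (hsymm : ∀ i j, ∀ y ∈ U, h i j y = h j i y)
    (hpar : ∀ k, ∀ y ∈ U, mvfderiv (𝓡 m) u y (e k y)
      = killingOp (A := Module.End ℂ V) c.gamma (fun i j ↦ connCoeff g e k i j y)
        (fun i ↦ h k i y) (u y))
    {x : M} (hx : x ∈ U) :
    ((∑ k, ∑ l, g.inner x (curvature g (e k) (e l) (e l) x) (e k x)) + (∑ k, ∑ l, h k l x ^ 2)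
      - (∑ k, h k k x) ^ 2) * ‖u x‖ ^ 2 = 0 := by
  have hux : ∀ y ∈ U, MDifferentiableAt (𝓡 m) 𝓘(ℝ, V) u y :=
    fun y hy ↦ (hu y hy).mdifferentiableAt (by simp)
  -- The equation holds on a neighbourhood, so it may be differentiated; the first derivative that
  -- reappears is eliminated with the equation again.
  have hsecond : ∀ k l, mvfderiv (𝓡 m) (fun y ↦ mvfderiv (𝓡 m) u y (e l y)) x (e k x)
      = killingOp (A := Module.End ℂ V) c.gamma
          (fun i j ↦ mvfderiv (𝓡 m) (connCoeff g e l i j) x (e k x))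
          (fun i ↦ mvfderiv (𝓡 m) (h l i) x (e k x)) (u x)
        + killingOp (A := Module.End ℂ V) c.gamma (fun i j ↦ connCoeff g e l i j x)
          (fun i ↦ h l i x) (killingOp (A := Module.End ℂ V) c.gamma
            (fun i j ↦ connCoeff g e k i j x) (fun i ↦ h k i x) (u x)) := by
    intro k l
    have e1 : (fun y ↦ mvfderiv (𝓡 m) u y (e l y)) =ᶠ[𝓝 x] fun y ↦
        killingOp (A := Module.End ℂ V) c.gamma (fun i j ↦ connCoeff g e l i j y)
          (fun i ↦ h l i y) (u y) := by
      filter_upwards [he.isOpen.mem_nhds hx] with y hy using hpar l y hy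
    rw [mvfderiv_congr_of_eventuallyEq e1, mvfderiv_killingOp (I := 𝓡 m) (m := m) c.gamma
      (w := connCoeff g e l) (h := h l) (fun i j ↦ he.mdiffAt_connCoeff hx l i j)
      (fun i ↦ hh l i x hx) (hux x hx), hpar k x hx]
  refine c.commutator_identity (u x) (w := fun k i j ↦ connCoeff g e k i j x)
    (dw := fun k l i j ↦ mvfderiv (𝓡 m) (connCoeff g e l i j) x (e k x))
    (h := fun k i ↦ h k i x) (dh := fun k l i ↦ mvfderiv (𝓡 m) (h l i) x (e k x))
    (R := fun k l i j ↦ g.inner x (curvature g (e k) (e l) (e i) x) (e j x))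
    (fun k i j ↦ he.connCoeff_antisymm hx k i j) (fun i j ↦ hsymm i j x hx) ?_
    (fun k l i j ↦ he.inner_curvature hx k l i j) (fun k l i j ↦ he.curvature_antisymm hx k l i j)
    (fun k l i j ↦ he.curvature_antisymm_right hx k l i j) ?_ ?_
  · intro k i j
    refine congrArg (fun L : TangentSpace (𝓡 m) x →L[ℝ] ℝ ↦ L (e k x))
      (mvfderiv_congr_of_eventuallyEq ?_)
    filter_upwards [he.isOpen.mem_nhds hx] with y hy using hsymm i j y hy
  · intro k l i j
    have := congrArg (fun Z ↦ g.inner x Z (e j x)) (he.curvature_bianchi hx k l i)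
    simpa only [map_add, add_apply, map_zero, zero_apply] using this
  · intro k l
    -- The integrability condition: the bracket is expanded in the frame, and its components are
    -- differences of connection coefficients.
    have h1 := mvfderiv_mlieBracket (I := 𝓡 m) (hu x hx) (he.mdiffAt hx k) (he.mdiffAt hx l)
    rw [hsecond k l, hsecond l k] at h1
    refine Eq.trans ?_ h1
    rw [← he.sum_inner_smul hx (mlieBracket (𝓡 m) (e k) (e l) x), map_sum]
    refine Finset.sum_congr rfl fun p _ ↦ ?_
    rw [map_smul, hpar p x hx]
    congr 1
    exact (he.structCoeff_eq hx k l p).symm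

end ParallelCurvature

/-! ### Unitarity of the spin action and its compatibility with the half spinors. -/

section SpinAlgebra

namespace CliffordModule

variable {m : ℕ} {V : Type*} [NormedAddCommGroup V] [InnerProductSpace ℂ V]

lemma mulVec_apply (c : CliffordModule m V) (v : Fin m → ℝ) :
    c.mulVec v = ∑ i, v i • c.gamma i := rfl

lemma clAction_ι (c : CliffordModule m V) (v : Fin m → ℝ) :
    c.clAction (CliffordAlgebra.ι (cliffordForm m) v) = c.mulVec v :=
  CliffordAlgebra.lift_ι_apply _ _ _

lemma inner_mulVec (c : CliffordModule m V) (v : Fin m → ℝ) (x y : V) :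
    inner ℂ (c.mulVec v x) y = -inner ℂ x (c.mulVec v y) := by
  simp only [mulVec_apply, LinearMap.sum_apply, LinearMap.smul_apply, sum_inner, inner_sum]
  rw [← Finset.sum_neg_distrib]
  refine Finset.sum_congr rfl fun i _ ↦ ?_
  rw [← Complex.coe_smul, ← Complex.coe_smul, inner_smul_left, inner_smul_right, c.skew]
  simp

/-- Both `star` and the adjoint reverse products and change the sign of vectors. Elements of the
spin group satisfy `star a * a = 1`, so they act isometrically. -/
lemma inner_clAction (c : CliffordModule m V) (a : Cl m) (x y : V) :
    inner ℂ (c.clAction a x) y = inner ℂ x (c.clAction (star a) y) := by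
  induction a using CliffordAlgebra.induction generalizing x y with
  | algebraMap r =>
    simp only [AlgHom.commutes, CliffordAlgebra.star_algebraMap, Module.algebraMap_end_apply]
    rw [← Complex.coe_smul, ← Complex.coe_smul, inner_smul_left, inner_smul_right]
    simp
  | ι v =>
    rw [CliffordAlgebra.star_ι, map_neg, clAction_ι, inner_mulVec, LinearMap.neg_apply,
      inner_neg_right]
  | mul a b ha hb =>
    rw [map_mul, star_mul, map_mul, Module.End.mul_apply, Module.End.mul_apply, ha, hb]
  | add a b ha hb =>
    rw [map_add, star_add, map_add, LinearMap.add_apply, LinearMap.add_apply, inner_add_left,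
      inner_add_right, ha, hb]

lemma norm_clAction_spin (c : CliffordModule m V) (a : Spin m) (x : V) :
    ‖c.clAction (a : Cl m) x‖ = ‖x‖ := by
  have h : inner ℂ (c.clAction (a : Cl m) x) (c.clAction (a : Cl m) x) = inner ℂ x x := by
    rw [inner_clAction, ← Module.End.mul_apply, ← map_mul, spinGroup.star_mul_self_of_mem a.2,
      map_one, Module.End.one_apply]
  rw [norm_eq_sqrt_re_inner (𝕜 := ℂ), h, ← norm_eq_sqrt_re_inner (𝕜 := ℂ)]

variable {n : ℕ}

/-- When `n + 1` is even each generator anticommutes with the volume element, so a product of two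
commutes with it and preserves its eigenspaces. -/
lemma gamma_gamma_mem (c : CliffordModule (n + 1) V) (ε : ℤˣ) (i j : Fin (n + 1)) {v : V}
    (hv : v ∈ c.hypersurfaceSpinors ε) :
    (c.gamma i * c.gamma j) v ∈ c.hypersurfaceSpinors ε := by
  unfold hypersurfaceSpinors at hv ⊢
  split_ifs at hv ⊢ with hn
  · trivial
  · have hm : Even (n + 1) := by rw [Nat.even_add_one]; exact hn
    rw [Module.End.mem_eigenspace_iff] at hv ⊢
    have hcomm : c.volumeElement * (c.gamma i * c.gamma j)
        = (c.gamma i * c.gamma j) * c.volumeElement := by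
      have h1 := c.gamma_mul_volumeElement hm i
      have h2 := c.gamma_mul_volumeElement hm j
      rw [mul_assoc, h2, mul_neg, ← mul_assoc _ c.volumeElement, h1, neg_mul, neg_neg, mul_assoc]
    rw [← Module.End.mul_apply, hcomm, Module.End.mul_apply, hv, map_smul]

variable [FiniteDimensional ℂ V]

/-- An operator preserving a subspace, together with its adjoint, commutes with the projection. -/
lemma orthogonalProjectionOnto_commute (W : Submodule ℂ V) {B B' : Module.End ℂ V}
    (hadj : ∀ x y, inner ℂ (B x) y = inner ℂ x (B' y)) (hB : ∀ x ∈ W, B x ∈ W)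
    (hB' : ∀ x ∈ W, B' x ∈ W) (x : V) :
    (W.orthogonalProjectionOnto (B x) : V) = B (W.orthogonalProjectionOnto x : V) := by
  rw [← W.starProjection_apply]
  refine Submodule.eq_starProjection_of_mem_of_inner_eq_zero (hB _ (Subtype.mem _)) fun w hw ↦ ?_
  rw [← map_sub, hadj]
  have := Submodule.sub_starProjection_mem_orthogonal (K := W) x
  rw [Submodule.mem_orthogonal'] at this
  exact this _ (hB' w hw)

lemma projection_gamma_gamma (c : CliffordModule (n + 1) V) (ε : ℤˣ) (i j : Fin (n + 1)) (x : V) :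
    ((c.hypersurfaceSpinors ε).orthogonalProjectionOnto (c.gamma i (c.gamma j x)) : V)
      = c.gamma i (c.gamma j ((c.hypersurfaceSpinors ε).orthogonalProjectionOnto x : V)) :=
  orthogonalProjectionOnto_commute (B := c.gamma i * c.gamma j) (B' := c.gamma j * c.gamma i) _
    (fun x y ↦ by simp only [Module.End.mul_apply, c.skew, neg_neg])
    (fun _ h ↦ c.gamma_gamma_mem ε i j h) (fun _ h ↦ c.gamma_gamma_mem ε j i h) x

lemma projection_mulVec_mulVec (c : CliffordModule (n + 1) V) (ε : ℤˣ) (v w : Fin (n + 1) → ℝ)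
    (x : V) :
    ((c.hypersurfaceSpinors ε).orthogonalProjectionOnto (c.mulVec v (c.mulVec w x)) : V)
      = c.mulVec v (c.mulVec w ((c.hypersurfaceSpinors ε).orthogonalProjectionOnto x : V)) := by
  have hs : ∀ (r : ℝ) (y : V),
      (c.hypersurfaceSpinors ε).orthogonalProjectionOnto (r • y)
        = r • (c.hypersurfaceSpinors ε).orthogonalProjectionOnto y := fun r y ↦ by
    rw [← Complex.coe_smul, map_smul, Complex.coe_smul]
  simp only [mulVec_apply, LinearMap.sum_apply, LinearMap.smul_apply, map_sum, hs,
    LinearMap.map_smul_of_tower, Submodule.coe_sum, Submodule.coe_smul_of_tower,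
    projection_gamma_gamma]

/-- The even subalgebra is generated by products of two vectors; such a product and its adjoint both
preserve the subspace, so they commute with the orthogonal projection. -/
lemma projection_clAction (c : CliffordModule (n + 1) V) (ε : ℤˣ) {a : Cl (n + 1)}
    (ha : a ∈ CliffordAlgebra.even (cliffordForm (n + 1))) (x : V) :
    ((c.hypersurfaceSpinors ε).orthogonalProjectionOnto (c.clAction a x) : V)
      = c.clAction a ((c.hypersurfaceSpinors ε).orthogonalProjectionOnto x : V) := by
  induction a, ha using CliffordAlgebra.even_induction generalizing x with
  | algebraMap r =>
    simp only [AlgHom.commutes, Module.algebraMap_end_apply]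
    rw [← Complex.coe_smul, map_smul]
    simp
  | add a b _ _ ha hb =>
    rw [map_add, LinearMap.add_apply, map_add, Submodule.coe_add, ha, hb, LinearMap.add_apply]
  | ι_mul_ι_mul v w a _ ha =>
    simp only [map_mul, Module.End.mul_apply, clAction_ι, projection_mulVec_mulVec, ha]

lemma induced_mulVec_coe (c : CliffordModule (n + 1) V) (ε : ℤˣ) (v : Fin n → ℝ)
    (x : c.hypersurfaceSpinors ε) :
    ((c.induced ε).mulVec v x : V)
      = c.mulVec (Fin.snoc (α := fun _ ↦ ℝ) v 0) (c.gamma (Fin.last n) x) := by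
  simp [mulVec_apply, LinearMap.sum_apply, Fin.sum_univ_castSucc, induced]

/-- In an even product the factors ν cancel in pairs: v·ν·w·ν = v·w, because ν anticommutes with `w`
and squares to `-1`. -/
lemma induced_clAction_coe (c : CliffordModule (n + 1) V) (ε : ℤˣ) {a : Cl n}
    (ha : a ∈ CliffordAlgebra.even (cliffordForm n)) (x : c.hypersurfaceSpinors ε) :
    ((c.induced ε).clAction a x : V) = c.clAction (clIncl n a) x := by
  induction a, ha using CliffordAlgebra.even_induction generalizing x with
  | algebraMap r =>
    simp only [AlgHom.commutes, Module.algebraMap_end_apply]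
    rfl
  | add a b _ _ ha hb =>
    simp only [map_add, LinearMap.add_apply, Submodule.coe_add, ha, hb]
  | ι_mul_ι_mul v w a _ ha =>
    simp only [map_mul, Module.End.mul_apply, clAction_ι, induced_mulVec_coe, ha, clIncl_ι]
    congr 1
    have h1 := congrArg c.clAction (clGen_last_anticomm w)
    simp only [map_mul, map_neg, clAction_ι, clGen] at h1
    have h2 : c.mulVec (Pi.single (Fin.last n) 1) = c.gamma (Fin.last n) := by
      simp [mulVec_apply, Pi.single_apply]
    rw [h2] at h1
    have h3 := congrArg (fun T : Module.End ℂ V ↦ T (c.gamma (Fin.last n) (c.clAction (clIncl n a) x))) h1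
    simp only [LinearMap.neg_apply, Module.End.mul_apply] at h3
    have h4 := c.cliffordRelations.sq (Fin.last n)
    have h5 : ∀ y, c.gamma (Fin.last n) (c.gamma (Fin.last n) y) = -y := fun y ↦ by
      rw [← Module.End.mul_apply, h4]; simp
    rw [h5, map_neg] at h3
    exact (neg_injective h3).symm

end CliffordModule
end SpinAlgebra

/-! ### Surjectivity of Spin(m) → SO(m). -/

section SpinCovering

variable {m : ℕ}

lemma cliffordForm_eq_neg_norm_sq (v : EuclideanSpace ℝ (Fin m)) :
    cliffordForm m v.ofLp = -‖v‖ ^ 2 := by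
  rw [cliffordForm_apply, EuclideanSpace.norm_sq_eq]
  simp [sq]

lemma ι_mul_self_of_norm_one {v : EuclideanSpace ℝ (Fin m)} (hv : ‖v‖ = 1) :
    CliffordAlgebra.ι (cliffordForm m) v.ofLp * CliffordAlgebra.ι (cliffordForm m) v.ofLp
      = -1 := by
  rw [CliffordAlgebra.ι_sq_scalar, cliffordForm_eq_neg_norm_sq, hv]
  simp

lemma ι_mem_pinGroup {v : EuclideanSpace ℝ (Fin m)} (hv : ‖v‖ = 1) :
    CliffordAlgebra.ι (cliffordForm m) v.ofLp ∈ pinGroup (cliffordForm m) := by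
  have h := ι_mul_self_of_norm_one hv
  rw [pinGroup.mem_iff]
  refine ⟨⟨⟨CliffordAlgebra.ι (cliffordForm m) v.ofLp, -CliffordAlgebra.ι (cliffordForm m) v.ofLp,
    by simp [h], by simp [h]⟩, Subgroup.subset_closure ⟨v.ofLp, rfl⟩, rfl⟩, ?_⟩
  rw [Unitary.mem_iff, CliffordAlgebra.star_ι]
  simp [h]

/-- The reflection in the hyperplane orthogonal to a unit vector is, up to sign, conjugation by
the vector in the Clifford algebra. -/
lemma ι_reflection {v : EuclideanSpace ℝ (Fin m)} (hv : ‖v‖ = 1) (x : EuclideanSpace ℝ (Fin m)) :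
    CliffordAlgebra.ι (cliffordForm m) ((ℝ ∙ v)ᗮ.reflection x).ofLp
      = -(CliffordAlgebra.ι (cliffordForm m) v.ofLp * CliffordAlgebra.ι (cliffordForm m) x.ofLp
          * star (CliffordAlgebra.ι (cliffordForm m) v.ofLp)) := by
  have h1 : CliffordAlgebra.ι (cliffordForm m) v.ofLp * CliffordAlgebra.ι (cliffordForm m) x.ofLp
      = -(CliffordAlgebra.ι (cliffordForm m) x.ofLp * CliffordAlgebra.ι (cliffordForm m) v.ofLp)
        - algebraMap ℝ _ (2 * inner ℝ v x) := by
    have h2 := CliffordAlgebra.ι_mul_ι_add_swap (Q := cliffordForm m) v.ofLp x.ofLp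
    have h3 : QuadraticMap.polar (cliffordForm m) v.ofLp x.ofLp = -(2 * inner ℝ v x) := by
      rw [QuadraticMap.polar, ← WithLp.ofLp_add]
      simp only [cliffordForm_eq_neg_norm_sq]
      rw [@norm_add_sq_real]
      ring
    rw [h3, map_neg] at h2
    rw [eq_sub_iff_add_eq, eq_neg_iff_add_eq_zero, ← neg_eq_iff_eq_neg.2 h2]
    abel
  have h4 := ι_mul_self_of_norm_one hv
  rw [Submodule.reflection_orthogonal_apply, Submodule.reflection_singleton_apply, hv, h1,
    CliffordAlgebra.star_ι]
  simp only [sub_mul, neg_mul, mul_neg, neg_neg, mul_assoc, h4, WithLp.ofLp_neg, WithLp.ofLp_sub,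
    WithLp.ofLp_smul, map_neg, map_sub, mul_one, ← Algebra.smul_def]
  simp only [RCLike.ofReal_one, one_pow, div_one, mul_smul, neg_sub]
  simp only [two_smul, map_add, map_smul]

/-- The product of the unit normals implements the product of reflections up to a sign `r`. The same
sign records the parity of the Clifford element and the determinant, so a positive determinant will
force the element to be even. -/
lemma exists_pin_of_reflections (l : List (EuclideanSpace ℝ (Fin m))) :
    ∃ s ∈ pinGroup (cliffordForm m), ∃ r : ℝ,
      ((r = 1 ∧ s ∈ CliffordAlgebra.evenOdd (cliffordForm m) 0)
        ∨ (r = -1 ∧ s ∈ CliffordAlgebra.evenOdd (cliffordForm m) 1)) ∧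
      LinearMap.det ((l.map fun v ↦ (ℝ ∙ v)ᗮ.reflection).prod.toLinearEquiv :
        EuclideanSpace ℝ (Fin m) →ₗ[ℝ] EuclideanSpace ℝ (Fin m)) = r ∧
      ∀ x, CliffordAlgebra.ι (cliffordForm m)
          ((l.map fun v ↦ (ℝ ∙ v)ᗮ.reflection).prod x).ofLp
        = r • (s * CliffordAlgebra.ι (cliffordForm m) x.ofLp * star s) := by
  induction l with
  | nil =>
    refine ⟨1, one_mem _, 1, Or.inl ⟨rfl, Submodule.one_le.1
      (CliffordAlgebra.one_le_evenOdd_zero _)⟩, ?_, fun x ↦ by simp⟩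
    exact LinearMap.det_id
  | cons v l ih =>
    obtain ⟨s, hs, r, hr, hdet, hx⟩ := ih
    set φ := (l.map fun v ↦ (ℝ ∙ v)ᗮ.reflection).prod
    have hcomp : LinearMap.det (((v :: l).map fun v ↦ (ℝ ∙ v)ᗮ.reflection).prod.toLinearEquiv :
        EuclideanSpace ℝ (Fin m) →ₗ[ℝ] EuclideanSpace ℝ (Fin m))
        = LinearMap.det ((ℝ ∙ v)ᗮ.reflection.toLinearEquiv :
          EuclideanSpace ℝ (Fin m) →ₗ[ℝ] EuclideanSpace ℝ (Fin m)) * r := by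
      rw [← hdet, ← LinearMap.det_comp, List.map_cons, List.prod_cons]
      rfl
    have happ : ∀ x, ((v :: l).map fun v ↦ (ℝ ∙ v)ᗮ.reflection).prod x
        = (ℝ ∙ v)ᗮ.reflection (φ x) := fun x ↦ by
      rw [List.map_cons, List.prod_cons]; rfl
    simp only [hcomp, happ]
    have hd := Submodule.det_reflection (ℝ ∙ v)ᗮ
    rw [Submodule.orthogonal_orthogonal] at hd
    -- The list may contain zero vectors, for which the reflection is the identity and nothing
    -- changes; other vectors are normalized without changing their line.
    by_cases hv : v = 0
    · refine ⟨s, hs, r, hr, ?_, fun x ↦ ?_⟩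
      · have h0 : Module.finrank ℝ (ℝ ∙ v) = 0 := by
          rw [hv, Submodule.span_zero_singleton, finrank_bot]
        rw [h0, pow_zero] at hd
        exact (congrArg (· * r) hd).trans (one_mul r)
      · rw [← hx, hv]
        congr 2
        rw [Submodule.reflection_eq_self_iff]
        simp
    · obtain ⟨w, hw, hspan⟩ : ∃ w : EuclideanSpace ℝ (Fin m), ‖w‖ = 1 ∧ (ℝ ∙ v) = ℝ ∙ w :=
        ⟨‖v‖⁻¹ • v, by
          rw [norm_smul, norm_inv, norm_norm, inv_mul_cancel₀ (norm_ne_zero_iff.2 hv)],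
          (Submodule.span_singleton_smul_eq
            (IsUnit.mk0 _ (inv_ne_zero (norm_ne_zero_iff.2 hv))) v).symm⟩
      rw [finrank_span_singleton hv, pow_one] at hd
      refine ⟨CliffordAlgebra.ι _ w.ofLp * s, mul_mem (ι_mem_pinGroup hw) hs, -r, ?_, ?_,
        fun x ↦ ?_⟩
      · have h1 := CliffordAlgebra.ι_mem_evenOdd_one (cliffordForm m) w.ofLp
        rcases hr with ⟨rfl, h⟩ | ⟨rfl, h⟩
        · have h2 := Submodule.mul_le.1 (CliffordAlgebra.evenOdd_mul_le (cliffordForm m) 1 0)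
            _ h1 _ h
          rw [add_zero] at h2
          exact Or.inr ⟨rfl, h2⟩
        · have h2 := Submodule.mul_le.1 (CliffordAlgebra.evenOdd_mul_le (cliffordForm m) 1 1)
            _ h1 _ h
          rw [CharTwo.add_self_eq_zero] at h2
          exact Or.inl ⟨neg_neg 1, h2⟩
      · exact (congrArg (· * r) hd).trans (neg_one_mul r)
      · simp only [hspan]
        rw [ι_reflection hw, hx, star_mul]
        simp only [mul_smul_comm, smul_mul_assoc, neg_smul, mul_assoc]

/-- The homomorphism `Spin(m) → SO(m)` is surjective. -/
theorem exists_spinMatrix_eq {A : Matrix (Fin m) (Fin m) ℝ}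
    (hA : A ∈ Matrix.orthogonalGroup (Fin m) ℝ) (hdet : 0 < A.det) :
    ∃ a : Spin m, spinMatrix a = A := by
  let φ : EuclideanSpace ℝ (Fin m) ≃ₗᵢ[ℝ] EuclideanSpace ℝ (Fin m) :=
    Unitary.linearIsometryEquiv ⟨Matrix.toEuclideanCLM (n := Fin m) (𝕜 := ℝ) A,
      Unitary.map_mem _ hA⟩
  have hφ : ∀ x, φ x = WithLp.toLp 2 (A.mulVec x.ofLp) := fun x ↦ rfl
  have hφdet : LinearMap.det (φ.toLinearEquiv :
      EuclideanSpace ℝ (Fin m) →ₗ[ℝ] EuclideanSpace ℝ (Fin m)) = A.det := by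
    rw [← LinearMap.det_toLin (EuclideanSpace.basisFun (Fin m) ℝ).toBasis A,
      ← Matrix.toEuclideanLin_eq_toLin_orthonormal]
    rfl
  -- The Cartan–Dieudonné theorem; the odd case is then excluded by the sign of the determinant.
  obtain ⟨l, -, hl⟩ := φ.reflections_generate_dim
  obtain ⟨s, hs, r, hr, hdet', hx⟩ := exists_pin_of_reflections l
  rw [← hl] at hdet' hx
  rw [hφdet] at hdet'
  rcases hr with ⟨rfl, he⟩ | ⟨rfl, -⟩
  · refine ⟨⟨s, spinGroup.mem_iff.2 ⟨hs, he⟩⟩, ?_⟩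
    apply Matrix.mulVec_injective
    funext v
    apply ι_cl_injective
    rw [spinMatrix_mulVec]
    simpa [hφ] using (hx (WithLp.toLp 2 v)).symm
  · linarith

end SpinCovering

/-! ### Transitivity of the spin group on the fibres of a spin structure. -/

section Fibre

variable {m : ℕ} {M : Type*} [TopologicalSpace M] [ChartedSpace (EuclideanSpace ℝ (Fin m)) M]
  [IsManifold (𝓡 m) ∞ M] {g : RiemMetric m M}
  {o : Π x : M, Orientation ℝ (TangentSpace (𝓡 m) x) (Fin m)}

/-- `Spin(m)` acts transitively on the positive orthonormal frames at a point. -/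
lemma ONFrame.exists_act_eq {u v : ONFrame g} (hu : u.IsPositive o) (hv : v.IsPositive o)
    (hb : u.base = v.base) : ∃ a : Spin m, u.act a = v := by
  obtain ⟨x, w, hw⟩ := v
  dsimp only at hb
  subst hb
  set v : ONFrame g := ⟨u.base, w, hw⟩
  -- The change of frame: orthogonal because both frames are orthonormal, of positive determinant
  -- because both are positive.
  let A : Matrix (Fin m) (Fin m) ℝ := u.basis.toMatrix v.basis
  have hub : ∀ i, u.basis i = u.vec i := fun i ↦ by simp [ONFrame.basis]
  have hvb : ∀ i, v.basis i = w i := fun i ↦ by simp [ONFrame.basis, v]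
  have hA : ∀ j, w j = ∑ i, A i j • u.vec i := fun j ↦ by
    have := u.basis.sum_toMatrix_smul_self v.basis j
    simp only [hub, hvb] at this
    exact this.symm
  have hdet : 0 < A.det := by
    have h1 : u.basis.orientation = v.basis.orientation := hu.trans hv.symm
    rw [u.basis.orientation_eq_iff_det_pos] at h1
    exact h1
  have horth : A ∈ Matrix.orthogonalGroup (Fin m) ℝ := by
    rw [Matrix.mem_orthogonalGroup_iff']
    ext j k
    have := hw j k
    rw [hA j, hA k] at this
    simp only [map_sum, map_smul, sum_apply, smul_apply, u.orthonormal,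
      smul_eq_mul, mul_ite, mul_one, mul_zero, Finset.sum_ite_eq', Finset.mem_univ, if_true] at this
    change (Matrix.transpose A * A) j k = (1 : Matrix (Fin m) (Fin m) ℝ) j k
    rw [Matrix.mul_apply, Matrix.one_apply, ← this]
    simp [mul_comm]
  obtain ⟨a, ha⟩ := exists_spinMatrix_eq horth hdet
  exact ⟨a, u.act_eq a w (fun j ↦ by rw [ha]; exact hA j) hw⟩

variable [NeZero m]

/-- Transitivity on frames determines the group element up to the deck transformation, which is
itself the action of `-1`. Spin-invariant functions of a spinor therefore descend to the manifold.
-/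
lemma SpinStructure.exists_act_eq (S : SpinStructure g o) {p q : S.P}
    (hb : (S.frame p).base = (S.frame q).base) : ∃ a : Spin m, q = S.act p a := by
  obtain ⟨a, ha⟩ := ONFrame.exists_act_eq ((S.range_frame _).1 ⟨p, rfl⟩)
    ((S.range_frame _).1 ⟨q, rfl⟩) hb
  rw [← S.frame_act, S.frame_eq_iff] at ha
  rcases ha with h | h
  · exact ⟨a, h⟩
  · exact ⟨a * spinNegOne m, by rw [h, S.act_mul]⟩

end Fibre

/-! ### The complex volume element as an involution. -/

section VolumeElement

namespace CliffordModule

variable {m : ℕ} {V : Type*} [NormedAddCommGroup V] [InnerProductSpace ℂ V]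

/-- Moving the first of k + 1 generators past the other k gives `(-1)^k`, and its square another
`-1`; the exponents add up to a triangular number. -/
lemma prod_gamma_mul_self (c : CliffordModule m V) {l : List (Fin m)} (hl : l.Nodup) :
    (l.map c.gamma).prod * (l.map c.gamma).prod
      = (-1 : ℂ) ^ ((l.length + 1).choose 2) • (1 : Module.End ℂ V) := by
  induction l with
  | nil => simp
  | cons i l ih =>
    obtain ⟨hi, hl⟩ := List.nodup_cons.1 hl
    have hc : l.countP (· ≠ i) = l.length := List.countP_eq_length.2 fun j hj ↦ by
      have : j ≠ i := fun h ↦ hi (h ▸ hj)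
      simpa using this
    have h1 := c.gamma_mul_prod i l
    rw [hc] at h1
    have h2 : (l.map c.gamma).prod * c.gamma i
        = (-1 : ℂ) ^ l.length • (c.gamma i * (l.map c.gamma).prod) := by
      rw [h1, smul_smul, ← mul_pow]; simp
    simp only [List.map_cons, List.prod_cons, List.length_cons]
    calc c.gamma i * (l.map c.gamma).prod * (c.gamma i * (l.map c.gamma).prod)
        = c.gamma i * ((l.map c.gamma).prod * c.gamma i) * (l.map c.gamma).prod := by
          simp only [mul_assoc]
      _ = (-1 : ℂ) ^ l.length • ((c.gamma i * c.gamma i)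
            * ((l.map c.gamma).prod * (l.map c.gamma).prod)) := by
          rw [h2, mul_smul_comm, smul_mul_assoc]; simp only [mul_assoc]
      _ = _ := by
          rw [c.cliffordRelations.sq, ih hl, Nat.choose_succ_succ' (l.length + 1) 1,
            Nat.choose_one_right, pow_add, pow_succ, neg_mul, one_mul]
          simp only [mul_neg_one, smul_neg, neg_smul, smul_smul, neg_mul]

/-- For m = 2j the power of i contributes `(-1)^j` and the generators `(-1)^(j(2j+1))`, with even
total exponent. -/
lemma volumeElement_mul_self (c : CliffordModule m V) (hm : Even m) :
    c.volumeElement * c.volumeElement = 1 := by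
  obtain ⟨j, rfl⟩ := hm
  have h1 : (j + j + 1).choose 2 = j * (2 * j + 1) := by
    rw [Nat.choose_two_right]
    apply Nat.div_eq_of_eq_mul_left (by norm_num)
    simp only [Nat.add_sub_cancel]
    ring
  have h2 : (j + j + 1) / 2 = j := by omega
  rw [volumeElement, smul_mul_smul_comm, c.prod_gamma_mul_self (List.nodup_finRange _),
    List.length_finRange, h1, h2, smul_smul, ← mul_pow, Complex.I_mul_I, ← pow_add,
    show j + j * (2 * j + 1) = 2 * (j * j + j) by ring, pow_mul]
  simp

lemma exists_projection_ne_zero {n : ℕ} [FiniteDimensional ℂ V] (c : CliffordModule (n + 1) V)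
    {v : V} (hv : v ≠ 0) :
    ∃ ε : ℤˣ, (c.hypersurfaceSpinors ε).orthogonalProjectionOnto v ≠ 0 := by
  by_contra! h
  have horth : ∀ ε : ℤˣ, ∀ w ∈ c.hypersurfaceSpinors ε, inner ℂ w v = 0 := fun ε ↦
    (Submodule.mem_orthogonal _ _).1 (Submodule.orthogonalProjectionOnto_eq_zero_iff.1 (h ε))
  by_cases hn : Even n
  · have := horth 1 v (by simp [hypersurfaceSpinors, hn])
    exact hv (inner_self_eq_zero.1 this)
  · have hsq := c.volumeElement_mul_self (by rw [Nat.even_add_one]; exact hn)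
    have hsq' : ∀ w, c.volumeElement (c.volumeElement w) = w := fun w ↦ by
      rw [← Module.End.mul_apply, hsq, Module.End.one_apply]
    -- As the volume element is an involution, `v ± ωv` are eigenvectors for `±1`. If both
    -- projections vanished, `v` would be orthogonal to both, hence to their sum `2v`.
    have h1 := horth 1 (v + c.volumeElement v) (by
      rw [hypersurfaceSpinors, if_neg hn, Module.End.mem_eigenspace_iff, map_add, hsq']
      simp [add_comm])
    have h2 := horth (-1) (v - c.volumeElement v) (by
      rw [hypersurfaceSpinors, if_neg hn, Module.End.mem_eigenspace_iff, map_sub, hsq']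
      simp)
    rw [inner_add_left] at h1
    rw [inner_sub_left] at h2
    have h3 : (2 : ℂ) * inner ℂ v v = 0 := by linear_combination h1 + h2
    exact hv (inner_self_eq_zero.1 ((mul_eq_zero.1 h3).resolve_left two_ne_zero))

end CliffordModule

end VolumeElement

/-! ### Derivatives of lengths, and functions with zero derivative. -/

section ConstantLength

variable {m : ℕ} {M : Type*} [TopologicalSpace M] [ChartedSpace (EuclideanSpace ℝ (Fin m)) M]
  [IsManifold (𝓡 m) ∞ M]

lemma isLocallyConstant_of_mvfderiv_eq_zero {G : M → ℝ}
    (hG : ∀ x, MDifferentiableAt (𝓡 m) 𝓘(ℝ, ℝ) G x) (hG' : ∀ x X, mvfderiv (𝓡 m) G x X = 0) :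
    IsLocallyConstant G := by
  rw [IsLocallyConstant.iff_eventually_eq]
  intro x
  obtain ⟨r, hr, hball⟩ := Metric.isOpen_iff.1 (isOpen_extChartAt_target (I := 𝓡 m) x)
    (extChartAt (𝓡 m) x x) (mem_extChartAt_target x)
  have hsymm : ∀ z ∈ (extChartAt (𝓡 m) x).target,
      MDifferentiableAt 𝓘(ℝ, EuclideanSpace ℝ (Fin m)) (𝓡 m) (extChartAt (𝓡 m) x).symm z :=
    fun z hz ↦ ((contMDiffOn_extChartAt_symm (n := ∞) x).contMDiffAt
      ((isOpen_extChartAt_target x).mem_nhds hz)).mdifferentiableAt (by simp)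
  have hdiff : ∀ z ∈ (extChartAt (𝓡 m) x).target,
      DifferentiableAt ℝ (fun z ↦ G ((extChartAt (𝓡 m) x).symm z)) z := fun z hz ↦
    (MDifferentiableAt.comp z (hG _) (hsymm z hz)).differentiableAt
  have hzero : ∀ z ∈ (extChartAt (𝓡 m) x).target,
      fderiv ℝ (fun z ↦ G ((extChartAt (𝓡 m) x).symm z)) z = 0 := fun z hz ↦ by
    ext w
    have h1 := mvfderiv_comp_mfderiv (I := 𝓘(ℝ, EuclideanSpace ℝ (Fin m))) (hG _) (hsymm z hz) w
    rw [hG'] at h1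
    rw [← mfderiv_eq_fderiv]
    exact h1
  have hconst := @fun a b ↦ Metric.isOpen_ball.is_const_of_fderiv_eq_zero
    (convex_ball (extChartAt (𝓡 m) x x) r).isPreconnected
    (fun z hz ↦ (hdiff z (hball hz)).differentiableWithinAt) (fun z hz ↦ hzero z (hball hz))
    (x := a) (y := b)
  filter_upwards [(continuousAt_extChartAt (I := 𝓡 m) x).preimage_mem_nhds (Metric.ball_mem_nhds _ hr),
    extChartAt_source_mem_nhds (I := 𝓡 m) x] with y hy hys
  have := hconst _ _ hy (Metric.mem_ball_self hr)
  rwa [(extChartAt (𝓡 m) x).left_inv hys, extChartAt_to_inv] at this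

variable {V : Type*} [NormedAddCommGroup V] [InnerProductSpace ℂ V]

lemma mvfderiv_norm_sq {u : M → V} {x : M} (hu : MDifferentiableAt (𝓡 m) 𝓘(ℝ, V) u x) :
    MDifferentiableAt (𝓡 m) 𝓘(ℝ, ℝ) (fun y ↦ ‖u y‖ ^ 2) x ∧
    ∀ X, mvfderiv (𝓡 m) (fun y ↦ ‖u y‖ ^ 2) x X
      = 2 * (inner ℂ (mvfderiv (𝓡 m) u x X : V) (u x)).re := by
  -- The real part of the Hermitian product is the real inner product of the same norm.
  let : InnerProductSpace ℝ V := InnerProductSpace.complexToReal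
  have hn := (hasStrictFDerivAt_norm_sq (u x)).hasFDerivAt
  refine ⟨MDifferentiableAt.comp (I' := 𝓘(ℝ, V)) x (g := fun v ↦ ‖v‖ ^ 2)
    hn.differentiableAt.mdifferentiableAt hu, fun X ↦ ?_⟩
  have h1 : ∀ w : V, mvfderiv 𝓘(ℝ, V) (fun v : V ↦ ‖v‖ ^ 2) (u x) w
      = 2 * (inner ℂ w (u x)).re := fun w ↦ by
    have h2 : mvfderiv 𝓘(ℝ, V) (fun v : V ↦ ‖v‖ ^ 2) (u x) w = (2 • innerSL ℝ (u x)) w := by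
      rw [← hn.fderiv, ← mfderiv_eq_fderiv]
      rfl
    rw [h2]
    simp only [smul_apply, innerSL_apply_apply, nsmul_eq_mul, Nat.cast_ofNat]
    rw [real_inner_comm]
    rfl
  exact (mvfderiv_comp_mfderiv (I' := 𝓘(ℝ, V)) (u := fun v ↦ ‖v‖ ^ 2) (f := u)
    hn.differentiableAt.mdifferentiableAt hu X).trans (h1 _)

/-- Products of two distinct generators are skew, so the spin connection term does not change
lengths. -/
lemma re_inner_spin_rotation (c : CliffordModule m V) {w : Fin m → Fin m → ℝ}
    (hw : ∀ i, w i i = 0) (u : V) :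
    (inner ℂ (∑ i, ∑ j, w i j • c.gamma i (c.gamma j u)) u).re = 0 := by
  simp only [sum_inner, Complex.re_sum, re_inner_real_smul_left, c.re_inner_gamma_gamma]
  simp [hw]

variable [NeZero m] {g : RiemMetric m M}
  {o : Π x : M, Orientation ℝ (TangentSpace (𝓡 m) x) (Fin m)} {S : SpinStructure g o}

namespace LocalSpinFrame

lemma isONFrameOn (s : LocalSpinFrame S) : IsONFrameOn g s.dom s.vec where
  isOpen := s.isOpen_dom
  smooth := s.smooth_vec
  orthonormal x hx i j := (s.frame_lift x hx).choose i j

lemma base_frame_lift (s : LocalSpinFrame S) {x : M} (hx : x ∈ s.dom) :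
    (S.frame (s.lift x)).base = x := by
  obtain ⟨h, h'⟩ := s.frame_lift x hx
  rw [h']

end LocalSpinFrame

lemma IsSpinorField.contMDiffAt {c : CliffordModule m V} {ψ : S.P → V} (hψ : IsSpinorField S c ψ)
    (s : LocalSpinFrame S) {x : M} (hx : x ∈ s.dom) :
    ContMDiffAt (𝓡 m) 𝓘(ℝ, V) ∞ (fun x ↦ ψ (s.lift x)) x :=
  (hψ.smooth s).contMDiffAt (s.isOpen_dom.mem_nhds hx)

lemma IsParallelSpinor.mvfderiv_eq {c : CliffordModule m V} {Φ : S.P → V}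
    (hΦ : IsParallelSpinor S c Φ) (s : LocalSpinFrame S) {x : M} (hx : x ∈ s.dom)
    (X : TangentSpace (𝓡 m) x) :
    mvfderiv (𝓡 m) (fun y ↦ Φ (s.lift y)) x X
      = -((1 / 4 : ℝ) • ∑ i, ∑ j, g.inner x (leviCivita g (s.vec i) x X) (s.vec j x) •
        c.gamma i (c.gamma j (Φ (s.lift x)))) :=
  eq_neg_of_add_eq_zero_left (hΦ s x hx X)

end ConstantLength

/-! ### The projection of a parallel spinor has constant length on the ambient manifold. -/

section ProjectedLength

variable {n : ℕ} {N : Type*} [TopologicalSpace N]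
  [ChartedSpace (EuclideanSpace ℝ (Fin (n + 1))) N] [IsManifold (𝓡 (n + 1)) ∞ N]
  {g : RiemMetric (n + 1) N}
  {o : Π x : N, Orientation ℝ (TangentSpace (𝓡 (n + 1)) x) (Fin (n + 1))} {S : SpinStructure g o}
  {V : Type*} [NormedAddCommGroup V] [InnerProductSpace ℂ V] [FiniteDimensional ℂ V]

/-- The orthogonal projection to the spinors of a hypersurface, as a real-linear operator. -/
def CliffordModule.projectionCLM (c : CliffordModule (n + 1) V) (ε : ℤˣ) :
    V →L[ℝ] c.hypersurfaceSpinors ε :=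
  ((c.hypersurfaceSpinors ε).orthogonalProjectionOnto).restrictScalars ℝ

lemma CliffordModule.projectionCLM_apply (c : CliffordModule (n + 1) V) (ε : ℤˣ) (v : V) :
    c.projectionCLM ε v = (c.hypersurfaceSpinors ε).orthogonalProjectionOnto v := rfl

lemma CliffordModule.projectionCLM_gamma_gamma (c : CliffordModule (n + 1) V) (ε : ℤˣ)
    (i j : Fin (n + 1)) (v : V) :
    (c.projectionCLM ε (c.gamma i (c.gamma j v)) : V)
      = c.gamma i (c.gamma j (c.projectionCLM ε v : V)) :=
  c.projection_gamma_gamma ε i j v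

/-- The projection of a parallel spinor satisfies the same equation as the spinor. -/
lemma IsParallelSpinor.mvfderiv_projection {c : CliffordModule (n + 1) V} {Φ : S.P → V}
    (hΦ : IsParallelSpinor S c Φ) (hΦs : IsSpinorField S c Φ) (ε : ℤˣ) (s : LocalSpinFrame S)
    {x : N} (hx : x ∈ s.dom) (X : TangentSpace (𝓡 (n + 1)) x) :
    (mvfderiv (𝓡 (n + 1)) (fun y ↦ c.projectionCLM ε (Φ (s.lift y))) x X : V)
      = -((1 / 4 : ℝ) • ∑ i, ∑ j, g.inner x (leviCivita g (s.vec i) x X) (s.vec j x) •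
        c.gamma i (c.gamma j (c.projectionCLM ε (Φ (s.lift x)) : V))) := by
  have hd : MDifferentiableAt (𝓡 (n + 1)) 𝓘(ℝ, V) (fun y ↦ Φ (s.lift y)) x :=
    (hΦs.contMDiffAt s hx).mdifferentiableAt (by simp)
  have h1 := mvfderiv_clm_comp (c.projectionCLM ε) hd X
  rw [hΦ.mvfderiv_eq s hx] at h1
  refine (congrArg Subtype.val h1).trans ?_
  simp only [map_neg, map_smul, map_sum, Submodule.coe_neg, Submodule.coe_smul_of_tower,
    Submodule.coe_sum, CliffordModule.projectionCLM_gamma_gamma]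

/-- The square of the length of the projection of a spinor field. -/
def projectedLength (c : CliffordModule (n + 1) V) (ε : ℤˣ) (Φ : S.P → V) (y : N) : ℝ :=
  ‖c.projectionCLM ε (Φ ((spinFrameAt S y).lift y))‖ ^ 2

lemma mem_dom_spinFrameAt {m : ℕ} [NeZero m] {M : Type*} [TopologicalSpace M]
    [ChartedSpace (EuclideanSpace ℝ (Fin m)) M] [IsManifold (𝓡 m) ∞ M] {g : RiemMetric m M}
    {o : Π x : M, Orientation ℝ (TangentSpace (𝓡 m) x) (Fin m)} (S : SpinStructure g o) (x : M) :
    x ∈ (spinFrameAt S x).dom :=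
  (exists_localSpinFrame S x).choose_spec

/-- Two points over the same base point differ by a spin element; being even it commutes with the
projection, and it acts isometrically. -/
lemma norm_projection_eq {c : CliffordModule (n + 1) V} (ε : ℤˣ) {Φ : S.P → V}
    (hΦ : IsSpinorField S c Φ) {p q : S.P} (hb : (S.frame p).base = (S.frame q).base) :
    ‖c.projectionCLM ε (Φ p)‖ = ‖c.projectionCLM ε (Φ q)‖ := by
  obtain ⟨a, rfl⟩ := S.exists_act_eq hb
  rw [hΦ.equivariant, c.projectionCLM_apply, c.projectionCLM_apply,
    Submodule.coe_norm ((c.hypersurfaceSpinors ε).orthogonalProjectionOnto (Φ p)),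
    Submodule.coe_norm ((c.hypersurfaceSpinors ε).orthogonalProjectionOnto (c.clAction _ _)),
    c.projection_clAction ε (spinGroup.mem_even (a⁻¹ : Spin (n + 1)).2),
    c.norm_clAction_spin]

lemma norm_projection_sq_eq {c : CliffordModule (n + 1) V} (ε : ℤˣ) {Φ : S.P → V}
    (hΦ : IsSpinorField S c Φ) (p : S.P) :
    ‖c.projectionCLM ε (Φ p)‖ ^ 2 = projectedLength c ε Φ (S.frame p).base := by
  rw [projectedLength, norm_projection_eq ε hΦ]
  exact ((spinFrameAt S _).base_frame_lift (mem_dom_spinFrameAt S _)).symm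

/-- The length of the projection of a parallel spinor is constant. -/
theorem projectedLength_const [ConnectedSpace N] {c : CliffordModule (n + 1) V} (ε : ℤˣ)
    {Φ : S.P → V} (hΦ : IsSpinorField S c Φ) (hpar : IsParallelSpinor S c Φ) (y z : N) :
    projectedLength c ε Φ y = projectedLength c ε Φ z := by
  have key : ∀ x, MDifferentiableAt (𝓡 (n + 1)) 𝓘(ℝ, ℝ) (projectedLength c ε Φ) x ∧
      ∀ X, mvfderiv (𝓡 (n + 1)) (projectedLength c ε Φ) x X = 0 := by
    intro x
    set s := spinFrameAt S x
    have hx : x ∈ s.dom := mem_dom_spinFrameAt S x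
    -- The definition uses a different chosen frame at each point; independence of the lift replaces
    -- it by a single frame near `x`, where it can be differentiated.
    have hev : projectedLength c ε Φ =ᶠ[𝓝 x] fun y ↦ ‖c.projectionCLM ε (Φ (s.lift y))‖ ^ 2 := by
      filter_upwards [s.isOpen_dom.mem_nhds hx] with y hy
      rw [norm_projection_sq_eq ε hΦ, s.base_frame_lift hy]
    have hd : MDifferentiableAt (𝓡 (n + 1)) 𝓘(ℝ, c.hypersurfaceSpinors ε)
        (fun y ↦ c.projectionCLM ε (Φ (s.lift y))) x :=
      MDifferentiableAt.comp (I' := 𝓘(ℝ, V)) x (g := c.projectionCLM ε)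
        (c.projectionCLM ε).mdifferentiableAt
        ((hΦ.contMDiffAt s hx).mdifferentiableAt (by simp))
    obtain ⟨h1, h2⟩ := mvfderiv_norm_sq hd
    refine ⟨h1.congr_of_eventuallyEq hev, fun X ↦ ?_⟩
    rw [mvfderiv_congr_of_eventuallyEq hev, h2]
    have h3 := hpar.mvfderiv_projection hΦ ε s hx X
    refine (congrArg (fun v : V ↦ 2 * (inner ℂ v (c.projectionCLM ε (Φ (s.lift x)) : V)).re) h3).trans ?_
    have h4 : ∀ i, g.inner x (leviCivita g (s.vec i) x X) (s.vec i x) = 0 := fun i ↦ by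
      rw [s.isONFrameOn.inner_leviCivita hx]
      refine Finset.sum_eq_zero fun k _ ↦ ?_
      have := s.isONFrameOn.connCoeff_antisymm hx k i i
      rw [show connCoeff g s.vec k i i x = 0 by linarith, mul_zero]
    simp only [inner_neg_left, Complex.neg_re, re_inner_real_smul_left]
    rw [re_inner_spin_rotation c h4]
    simp
  have hloc := isLocallyConstant_of_mvfderiv_eq_zero (fun x ↦ (key x).1) (fun x ↦ (key x).2)
  exact hloc.apply_eq_of_isPreconnected isPreconnected_univ trivial trivial

end ProjectedLength

/-! ### Equivariance of the restricted spinor, its nonvanishing for some sign, and the absence of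
zeros. -/

section Restriction

variable {n : ℕ} [NeZero n]
  {M : Type*} [TopologicalSpace M] [ChartedSpace (EuclideanSpace ℝ (Fin n)) M]
  [IsManifold (𝓡 n) ∞ M]
  {N : Type*} [TopologicalSpace N] [ChartedSpace (EuclideanSpace ℝ (Fin (n + 1))) N]
  [IsManifold (𝓡 (n + 1)) ∞ N] {gM : RiemMetric n M}
  {oM : Π x : M, Orientation ℝ (TangentSpace (𝓡 n) x) (Fin n)} {gN : RiemMetric (n + 1) N}
  {oN : Π x : N, Orientation ℝ (TangentSpace (𝓡 (n + 1)) x) (Fin (n + 1))}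
  {V : Type*} [NormedAddCommGroup V] [InnerProductSpace ℂ V] [FiniteDimensional ℂ V]
  {S : SpinStructure gN oN} {f : OrientedHypersurface gM oM gN oN}

/-- Spin(n) lies in the even subalgebra. There the induced action is the ambient one along `clIncl`,
and the ambient one commutes with the projection. -/
lemma restrictSpinor_equivariant {c : CliffordModule (n + 1) V} (ε : ℤˣ) {Φ : S.P → V}
    (hΦ : IsSpinorField S c Φ) (q : (S.induced f).P) (a : Spin n) :
    restrictSpinor S f c ε Φ ((S.induced f).act q a)
      = (c.induced ε).clAction (a⁻¹ : Spin n) (restrictSpinor S f c ε Φ q) := by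
  apply Subtype.ext
  rw [c.induced_clAction_coe ε (spinGroup.mem_even (a⁻¹ : Spin n).2)]
  have h1 : clIncl n ((a⁻¹ : Spin n) : Cl n) = ((spinIncl a)⁻¹ : Spin (n + 1)) :=
    clIncl_star (a : Cl n)
  have h2 : Φ (((S.induced f).act q a).1.2)
      = c.clAction ((spinIncl a)⁻¹ : Spin (n + 1)) (Φ q.1.2) := hΦ.equivariant q.1.2 (spinIncl a)
  rw [h1, restrictSpinor, h2,
    c.projection_clAction ε (spinGroup.mem_even ((spinIncl a)⁻¹ : Spin (n + 1)).2)]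
  rfl

lemma restrictSpinor_ne_zero_forall [ConnectedSpace N] {c : CliffordModule (n + 1) V} {ε : ℤˣ}
    {Φ : S.P → V} (hΦ : IsSpinorField S c Φ) (hpar : IsParallelSpinor S c Φ)
    (h : restrictSpinor S f c ε Φ ≠ 0) (q : (S.induced f).P) :
    restrictSpinor S f c ε Φ q ≠ 0 := by
  obtain ⟨q₀, hq₀⟩ := Function.ne_iff.1 h
  intro hq
  apply hq₀
  have h1 : ‖restrictSpinor S f c ε Φ q₀‖ ^ 2 = ‖restrictSpinor S f c ε Φ q‖ ^ 2 := by
    have e1 := norm_projection_sq_eq (c := c) ε hΦ q₀.1.2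
    have e2 := norm_projection_sq_eq (c := c) ε hΦ q.1.2
    exact e1.trans ((projectedLength_const ε hΦ hpar _ _).trans e2.symm)
  rw [hq] at h1
  simpa using h1

/-- `Φ` is only known to be nonzero somewhere on `N`, perhaps away from the hypersurface; constancy
of the projected length carries the nonzero projection to a point of `M`. -/
lemma exists_restrictSpinor_ne_zero [Nonempty M] [ConnectedSpace N] {c : CliffordModule (n + 1) V}
    {Φ : S.P → V} (hΦ : IsSpinorField S c Φ) (hpar : IsParallelSpinor S c Φ) (hΦ0 : Φ ≠ 0) :
    ∃ ε : ℤˣ, restrictSpinor S f c ε Φ ≠ 0 := by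
  obtain ⟨p, hp⟩ := Function.ne_iff.1 hΦ0
  obtain ⟨ε, hε⟩ := c.exists_projection_ne_zero hp
  refine ⟨ε, fun h0 ↦ hε ?_⟩
  obtain ⟨x⟩ := ‹Nonempty M›
  have hq := congrFun h0 ((spinFrameAt (S.induced f) x).lift x)
  set q := (spinFrameAt (S.induced f) x).lift x
  have e1 := norm_projection_sq_eq (c := c) ε hΦ q.1.2
  have e2 := norm_projection_sq_eq (c := c) ε hΦ p
  have e3 := e2.trans ((projectedLength_const ε hΦ hpar _ _).trans e1.symm)
  have e4 : c.projectionCLM ε (Φ q.1.2) = 0 := hq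
  rw [e4, norm_zero, zero_pow two_ne_zero] at e3
  exact norm_eq_zero.1 (pow_eq_zero_iff two_ne_zero |>.1 e3)

end Restriction

/-! ### Local retractions onto an immersed submanifold. -/

section Retraction

variable {m k : ℕ}
  {M : Type*} [TopologicalSpace M] [ChartedSpace (EuclideanSpace ℝ (Fin m)) M]
  [IsManifold (𝓡 m) ∞ M]
  {N : Type*} [TopologicalSpace N] [ChartedSpace (EuclideanSpace ℝ (Fin k)) N]
  [IsManifold (𝓡 k) ∞ N]

/-- A smooth map which is an immersion at a point has a smooth local left inverse there. -/
theorem exists_local_retraction {f : M → N} (hf : ContMDiff (𝓡 m) (𝓡 k) ∞ f) {x : M}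
    (hinj : Function.Injective (mfderiv (𝓡 m) (𝓡 k) f x)) :
    ∃ (W : Set N) (r : N → M), IsOpen W ∧ f x ∈ W ∧ ContMDiffOn (𝓡 k) (𝓡 m) ∞ r W ∧
      ∀ᶠ y in 𝓝 x, r (f y) = y := by
  set φ := extChartAt (𝓡 m) x
  set ψ := extChartAt (𝓡 k) (f x)
  set ξ := φ x
  have hxξ : φ.symm ξ = x := extChartAt_to_inv x
  have hφs : ∀ z ∈ φ.target, ContMDiffAt 𝓘(ℝ, EuclideanSpace ℝ (Fin m)) (𝓡 m) ∞ φ.symm z :=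
    fun z hz ↦ (contMDiffOn_extChartAt_symm x).contMDiffAt ((isOpen_extChartAt_target x).mem_nhds hz)
  have hψ : ∀ z ∈ ψ.source, ContMDiffAt (𝓡 k) 𝓘(ℝ, EuclideanSpace ℝ (Fin k)) ∞ ψ z :=
    fun z hz ↦ contMDiffAt_extChartAt' (by rwa [← extChartAt_source (𝓡 k)])
  set D : Set (EuclideanSpace ℝ (Fin m)) := φ.target ∩ φ.symm ⁻¹' (f ⁻¹' ψ.source) with hD
  have hDo : IsOpen D := (continuousOn_extChartAt_symm x).isOpen_inter_preimage
    (isOpen_extChartAt_target x) (hf.continuous.isOpen_preimage _ (isOpen_extChartAt_source (f x)))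
  have hξD : ξ ∈ D := ⟨mem_extChartAt_target x, by
    change f (φ.symm ξ) ∈ ψ.source
    rw [hxξ]; exact mem_extChartAt_source (f x)⟩
  set F : EuclideanSpace ℝ (Fin m) → EuclideanSpace ℝ (Fin k) := fun z ↦ ψ (f (φ.symm z))
  have hF : ∀ z ∈ D, ContDiffAt ℝ ∞ F z := fun z hz ↦
    ((hψ _ hz.2).comp z ((hf _).comp z (hφs z hz.1))).contDiffAt
  set L : EuclideanSpace ℝ (Fin m) →L[ℝ] EuclideanSpace ℝ (Fin k) := fderiv ℝ F ξ
  have hL : Function.Injective L := by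
    have h1 : L = (mfderiv (𝓡 k) 𝓘(ℝ, EuclideanSpace ℝ (Fin k)) ψ (f (φ.symm ξ))).comp
        ((mfderiv (𝓡 m) (𝓡 k) f (φ.symm ξ)).comp
          (mfderiv 𝓘(ℝ, EuclideanSpace ℝ (Fin m)) (𝓡 m) φ.symm ξ)) := by
      have e1 := mfderiv_comp ξ ((hf (φ.symm ξ)).mdifferentiableAt (by simp))
        ((hφs ξ hξD.1).mdifferentiableAt (by simp))
      have e2 := mfderiv_comp ξ ((hψ _ hξD.2).mdifferentiableAt (by simp))
        (((hf _).comp ξ (hφs ξ hξD.1)).mdifferentiableAt (by simp))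
      have e3 : L = mfderiv 𝓘(ℝ, EuclideanSpace ℝ (Fin m)) 𝓘(ℝ, EuclideanSpace ℝ (Fin k)) F ξ :=
        mfderiv_eq_fderiv.symm
      rw [e3]
      refine e2.trans ?_
      rw [e1]
      rfl
    rw [h1]
    have hmid : Function.Injective (mfderiv (𝓡 m) (𝓡 k) f (φ.symm ξ)) := by rwa [hxξ]
    exact fun v w hvw ↦ (isInvertible_mfderiv_extChartAt_symm (mem_extChartAt_target x)).injective
      (hmid ((isInvertible_mfderiv_extChartAt hξD.2).injective hvw))
  obtain ⟨P, hP⟩ := L.toLinearMap.exists_leftInverse_of_injective (LinearMap.ker_eq_bot.2 hL)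
  -- Composing with a linear left inverse `P` of the derivative gives a map between spaces of equal
  -- dimension with derivative the identity at `ξ`, to which the inverse function theorem applies.
  set G : EuclideanSpace ℝ (Fin m) → EuclideanSpace ℝ (Fin m) :=
    fun z ↦ LinearMap.toContinuousLinearMap P (F z)
  have hG : ∀ z ∈ D, ContDiffAt ℝ ∞ G z := fun z hz ↦
    (LinearMap.toContinuousLinearMap P).contDiff.contDiffAt.comp z (hF z hz)
  have hG' : HasFDerivAt G ((ContinuousLinearEquiv.refl ℝ (EuclideanSpace ℝ (Fin m)) :
      EuclideanSpace ℝ (Fin m) ≃L[ℝ] EuclideanSpace ℝ (Fin m)) :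
      EuclideanSpace ℝ (Fin m) →L[ℝ] EuclideanSpace ℝ (Fin m)) ξ := by
    have h1 := (LinearMap.toContinuousLinearMap P).hasFDerivAt.comp ξ
      ((hF ξ hξD).differentiableAt (by simp)).hasFDerivAt
    refine h1.congr_fderiv ?_
    ext1 v
    exact LinearMap.congr_fun hP v
  set Θ := (hG ξ hξD).toOpenPartialHomeomorph G hG' (by simp)
  have hΘ : ∀ z, Θ z = G z := fun z ↦ rfl
  have hξΘ : ξ ∈ Θ.source := (hG ξ hξD).mem_toOpenPartialHomeomorph_source hG' (by simp)
  -- The inverse has to be smooth on an open set, not just at one point, so the points where the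
  -- derivative of `G` is invertible are cut out; they form an open set.
  set D' : Set (EuclideanSpace ℝ (Fin m)) := D ∩ fderiv ℝ G ⁻¹'
    Set.range ((↑) : (EuclideanSpace ℝ (Fin m) ≃L[ℝ] EuclideanSpace ℝ (Fin m)) → _)
  have hD'o : IsOpen D' := by
    have h1 : ContinuousOn (fderiv ℝ G) D :=
      ContDiffOn.continuousOn_fderiv_of_isOpen (n := ∞)
        (fun z hz ↦ (hG z hz).contDiffWithinAt) hDo (by simp)
    exact h1.isOpen_inter_preimage hDo ContinuousLinearEquiv.isOpen
  have hξD' : ξ ∈ D' := ⟨hξD, ⟨_, hG'.fderiv.symm⟩⟩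
  set T : Set (EuclideanSpace ℝ (Fin m)) := Θ.target ∩ Θ.symm ⁻¹' D'
  have hTo : IsOpen T := Θ.continuousOn_symm.isOpen_inter_preimage Θ.open_target hD'o
  have hsymm : ∀ z ∈ T, ContDiffAt ℝ ∞ Θ.symm z := by
    rintro z ⟨hz, hz', ⟨e, he⟩⟩
    refine Θ.contDiffAt_symm (f₀' := e) hz ?_ (hG _ hz')
    rw [he]
    exact ((hG _ hz').differentiableAt (by simp)).hasFDerivAt
  have hξT : G ξ ∈ T := by
    refine ⟨Θ.map_source hξΘ, ?_⟩
    change Θ.symm (Θ ξ) ∈ D'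
    rw [Θ.left_inv hξΘ]; exact hξD'
  -- `Q` makes sense off the image of `f` and agrees with `G ∘ φ` along it; following it by the
  -- inverse of `G` and of the chart `φ` gives the retraction.
  set Q : N → EuclideanSpace ℝ (Fin m) := fun z ↦ LinearMap.toContinuousLinearMap P (ψ z)
  have hQ : ∀ z ∈ ψ.source, ContMDiffAt (𝓡 k) 𝓘(ℝ, EuclideanSpace ℝ (Fin m)) ∞ Q z :=
    fun z hz ↦ (LinearMap.toContinuousLinearMap P).contDiff.contDiffAt.contMDiffAt.comp z (hψ z hz)
  have hGQ : ∀ y ∈ φ.source, G (φ y) = Q (f y) := fun y hy ↦ by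
    simp only [G, F, Q, φ.left_inv hy]
  refine ⟨ψ.source ∩ Q ⁻¹' T, fun z ↦ φ.symm (Θ.symm (Q z)),
    ContinuousOn.isOpen_inter_preimage (fun z hz ↦ (hQ z hz).continuousAt.continuousWithinAt)
      (isOpen_extChartAt_source (f x)) hTo, ⟨mem_extChartAt_source (f x), ?_⟩, ?_, ?_⟩
  · change Q (f x) ∈ T
    rw [← hGQ x (mem_extChartAt_source x)]
    exact hξT
  · rintro z ⟨hz, hz'⟩
    exact (((hφs _ hz'.2.1.1).comp (Q z) (hsymm _ hz').contMDiffAt).comp z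
      (hQ z hz)).contMDiffWithinAt
  · filter_upwards [extChartAt_source_mem_nhds (I := 𝓡 m) x,
      (continuousAt_extChartAt (I := 𝓡 m) x).preimage_mem_nhds (Θ.open_source.mem_nhds hξΘ)]
      with y hy hy'
    rw [← hGQ y hy, ← hΘ, Θ.left_inv hy', φ.left_inv hy]

end Retraction

/-! ### Extension of frames along an immersion. -/

section ExtendFrame

variable {m k : ℕ}
  {M : Type*} [TopologicalSpace M] [ChartedSpace (EuclideanSpace ℝ (Fin m)) M]
  [IsManifold (𝓡 m) ∞ M]
  {N : Type*} [TopologicalSpace N] [ChartedSpace (EuclideanSpace ℝ (Fin k)) N]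
  [IsManifold (𝓡 k) ∞ N]

lemma contMDiffAt_inner_along (g : RiemMetric k N) {f : M → N} {x : M}
    {X Y : Π y : M, TangentSpace (𝓡 k) (f y)}
    (hf : ContMDiffAt (𝓡 m) (𝓡 k) ∞ f x)
    (hX : ContMDiffAt (𝓡 m) (𝓡 k).tangent ∞ (fun y ↦ (⟨f y, X y⟩ : TangentBundle (𝓡 k) N)) x)
    (hY : ContMDiffAt (𝓡 m) (𝓡 k).tangent ∞ (fun y ↦ (⟨f y, Y y⟩ : TangentBundle (𝓡 k) N)) x) :
    ContMDiffAt (𝓡 m) 𝓘(ℝ, ℝ) ∞ (fun y ↦ g.inner (f y) (X y) (Y y)) x := by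
  have : ContMDiffAt (𝓡 m) ((𝓡 k).prod 𝓘(ℝ)) ∞
      (fun y ↦ TotalSpace.mk' ℝ (E := Bundle.Trivial N ℝ) (f y) (g.inner (f y) (X y) (Y y))) x := by
    apply ContMDiffAt.clm_bundle_apply₂ (F₁ := EuclideanSpace ℝ (Fin k))
      (F₂ := EuclideanSpace ℝ (Fin k))
    · exact (g.contMDiff (f x)).comp x hf
    · exact hX
    · exact hY
  simp only [contMDiffAt_totalSpace] at this
  exact this.2

/-- An orthonormal frame along an immersion is, locally, the restriction of an orthonormal frame
of the ambient manifold. -/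
theorem exists_extend_frame (g : RiemMetric k N) {f : M → N} (hf : ContMDiff (𝓡 m) (𝓡 k) ∞ f)
    {x : M} (hinj : Function.Injective (mfderiv (𝓡 m) (𝓡 k) f x)) {U : Set M} (hU : IsOpen U)
    (hx : x ∈ U) {X : Fin k → Π y : M, TangentSpace (𝓡 k) (f y)}
    (hX : ∀ i, ContMDiffOn (𝓡 m) (𝓡 k).tangent ∞
      (fun y ↦ (⟨f y, X i y⟩ : TangentBundle (𝓡 k) N)) U)
    (hon : ∀ y ∈ U, ∀ i j, g.inner (f y) (X i y) (X j y) = if i = j then 1 else 0) :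
    ∃ (W : Set N) (e : Fin k → Π z : N, TangentSpace (𝓡 k) z), IsONFrameOn g W e ∧ f x ∈ W ∧
      ∀ᶠ y in 𝓝 x, ∀ i, e i (f y) = X i y := by
  obtain ⟨W₁, r, hW₁, hxW₁, hr, hrf⟩ := exists_local_retraction hf hinj
  obtain ⟨W₂, E, hW₂, hxW₂, hE, hEon⟩ :=
    exists_orthonormal_frame g (m := k) (finrank_euclideanSpace_fin (𝕜 := ℝ)) (f x)
  have hEf : IsONFrameOn g W₂ E := ⟨hW₂, hE, hEon⟩
  set U' : Set M := U ∩ f ⁻¹' W₂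
  have hU' : IsOpen U' := hU.inter (hf.continuous.isOpen_preimage _ hW₂)
  have hxU' : x ∈ U' := ⟨hx, hxW₂⟩
  -- The coefficients of the given frame in an ambient frame `E` are functions on `M`; composed with
  -- the retraction they become functions on `N`.
  set A : Fin k → Fin k → M → ℝ := fun i j y ↦ g.inner (f y) (X i y) (E j (f y))
  have hA : ∀ i j, ∀ y ∈ U', ContMDiffAt (𝓡 m) 𝓘(ℝ, ℝ) ∞ (A i j) y := fun i j y hy ↦
    contMDiffAt_inner_along g (hf y) ((hX i).contMDiffAt (hU.mem_nhds hy.1))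
      (ContMDiffAt.comp y (hEf.contMDiffAt hy.2 j) (hf y))
  have hrx : r (f x) = x := hrf.self_of_nhds
  set W : Set N := (W₁ ∩ r ⁻¹' U') ∩ W₂
  have hW : IsOpen W := (hr.continuousOn.isOpen_inter_preimage hW₁ hU').inter hW₂
  refine ⟨W, fun i z ↦ ∑ j, A i j (r z) • E j z, ⟨hW, fun i ↦ ?_, fun z hz i j ↦ ?_⟩,
    ⟨⟨hxW₁, by rwa [Set.mem_preimage, hrx]⟩, hxW₂⟩, ?_⟩
  · refine ContMDiffOn.sum_section fun j _ ↦ ContMDiffOn.smul_section (fun z hz ↦ ?_)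
      ((hE j).mono Set.inter_subset_right)
    exact (ContMDiffAt.comp z (hA i j _ hz.1.2)
      (hr.contMDiffAt (hW₁.mem_nhds hz.1.1))).contMDiffWithinAt
  -- The coefficient matrix at `r z` is orthogonal because `X` is orthonormal there, and an
  -- orthogonal matrix applied to the orthonormal `E` at `z` gives an orthonormal frame.
  · have h1 := hon (r z) hz.1.2.1 i j
    rw [hEf.inner_eq_sum hz.1.2.2] at h1
    simp only [map_sum, map_smul, sum_apply, smul_apply, smul_eq_mul, hEon z hz.2]
    simpa [A, mul_comm] using h1
  · filter_upwards [hrf, hU'.mem_nhds hxU'] with y hy hyU i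
    rw [hy]
    exact hEf.sum_inner_smul hyU.2 (X i y)

end ExtendFrame

/-! ### Lifting frame fields to the spin structure. -/

section Lift

variable {m : ℕ} {M : Type*} [TopologicalSpace M] [ChartedSpace (EuclideanSpace ℝ (Fin m)) M]
  [IsManifold (𝓡 m) ∞ M] [NeZero m] {g : RiemMetric m M}
  {o : Π x : M, Orientation ℝ (TangentSpace (𝓡 m) x) (Fin m)}

/-- A frame field lifts to the spin structure, with prescribed value at a point. -/
theorem SpinStructure.exists_lift (S : SpinStructure g o) {U : Set M}
    {e : Fin m → Π x : M, TangentSpace (𝓡 m) x} (he : IsONFrameOn g U e) {x : M} (hx : x ∈ U)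
    {p : S.P} (hp : S.frame p = ⟨x, fun i ↦ e i x, he.orthonormal x hx⟩) :
    ∃ t : LocalSpinFrame S, x ∈ t.dom ∧ t.dom ⊆ U ∧ t.vec = e ∧
      ∃ Ω : Set S.P, IsOpen Ω ∧ p ∈ Ω ∧
        ∀ y ∈ t.dom, ∀ q ∈ Ω, S.frame q = S.frame (t.lift y) → t.lift y = q := by
  classical
  obtain ⟨φ, hpφ, hφ⟩ := S.isLocalHomeomorph_frame p
  let τ : M → ONFrame g := fun y ↦
    if h : y ∈ U then ⟨y, fun i ↦ e i y, he.orthonormal y h⟩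
    else ⟨x, fun i ↦ e i x, he.orthonormal x hx⟩
  have hτ : ∀ y (h : y ∈ U), τ y = ⟨y, fun i ↦ e i y, he.orthonormal y h⟩ := fun y h ↦ dif_pos h
  have hτc : ContinuousOn τ U := by
    rw [ONFrame.continuousOn_iff]
    refine ⟨continuousOn_id.congr fun y hy ↦ by rw [hτ y hy]; rfl, fun i ↦ ?_⟩
    exact (he.smooth i).continuousOn.congr fun y hy ↦ by rw [hτ y hy]
  have hmem : τ x ∈ φ.target := by
    rw [hτ x hx, ← hp, hφ]; exact φ.map_source hpφ
  refine ⟨⟨U ∩ τ ⁻¹' φ.target, hτc.isOpen_inter_preimage he.isOpen φ.open_target, e,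
    fun i ↦ (he.smooth i).mono Set.inter_subset_left, fun y ↦ φ.symm (τ y), ?_, ?_⟩, ⟨hx, hmem⟩,
    Set.inter_subset_left, rfl, φ.source, φ.open_source, hpφ, ?_⟩
  · exact φ.continuousOn_symm.comp (hτc.mono Set.inter_subset_left) fun y hy ↦ hy.2
  · rintro y ⟨hy, hy'⟩
    refine ⟨he.orthonormal y hy, ?_⟩
    rw [← hτ y hy, hφ]
    exact φ.right_inv hy'
  -- On the source of `φ` the covering is injective, so a point of that sheet over the same frame is
  -- the value of the section. This identifies lifts near the point and not only at it.
  · rintro y ⟨hy, hy'⟩ q hq hqy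
    replace hqy : φ q = φ (φ.symm (τ y)) := by
      rw [← hφ]; exact hqy
    exact (φ.injOn hq (φ.map_target hy') hqy).symm

end Lift

/-! ### Spin frames of the ambient manifold adapted to the hypersurface. -/

section AdaptedFrame

variable {n : ℕ} [NeZero n]
  {M : Type*} [TopologicalSpace M] [ChartedSpace (EuclideanSpace ℝ (Fin n)) M]
  [IsManifold (𝓡 n) ∞ M]
  {N : Type*} [TopologicalSpace N] [ChartedSpace (EuclideanSpace ℝ (Fin (n + 1))) N]
  [IsManifold (𝓡 (n + 1)) ∞ N] {gM : RiemMetric n M}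
  {oM : Π x : M, Orientation ℝ (TangentSpace (𝓡 n) x) (Fin n)} {gN : RiemMetric (n + 1) N}
  {oN : Π x : N, Orientation ℝ (TangentSpace (𝓡 (n + 1)) x) (Fin (n + 1))}

lemma CoorientedImmersion.mfderiv_injective (f : CoorientedImmersion gM gN) (x : M) :
    Function.Injective (mfderiv (𝓡 n) (𝓡 (n + 1)) f.map x) := by
  rw [injective_iff_map_eq_zero]
  intro X hX
  by_contra hne
  have h1 := f.isometric x X X
  rw [hX] at h1
  have h2 := gM.pos x X hne
  rw [← h1] at h2
  simp at h2

/-- The frame field `t` of the ambient manifold restricts, near `x`, to the frame field `s` of the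
hypersurface, completed by the unit normal. -/
structure IsAdaptedAt {f : CoorientedImmersion gM gN} (s : Fin n → Π x : M, TangentSpace (𝓡 n) x)
    (t : Fin (n + 1) → Π z : N, TangentSpace (𝓡 (n + 1)) z) (x : M) : Prop where
  tangent : ∀ i, t i.castSucc (f.map x) = mfderiv (𝓡 n) (𝓡 (n + 1)) f.map x (s i x)
  normal : t (Fin.last n) (f.map x) = f.normal x

/-- This brings spinors on `M` and on `N` into a common trivialization: a spin frame of the induced
structure is, near each point, the restriction of an ambient spin frame, with matching lifts. -/
theorem exists_adapted_frame (S : SpinStructure gN oN) (f : OrientedHypersurface gM oM gN oN)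
    (s : LocalSpinFrame (S.induced f)) {x : M} (hx : x ∈ s.dom) :
    ∃ t : LocalSpinFrame S, ∀ᶠ y in 𝓝 x, y ∈ s.dom ∧ f.map y ∈ t.dom ∧
      IsAdaptedAt (f := f.toCoorientedImmersion) s.vec t.vec y ∧
      t.lift (f.map y) = (s.lift y).1.2 := by
  set X : Fin (n + 1) → Π y : M, TangentSpace (𝓡 (n + 1)) (f.map y) :=
    Fin.snoc (α := fun _ ↦ Π y : M, TangentSpace (𝓡 (n + 1)) (f.map y))
      (fun i y ↦ mfderiv (𝓡 n) (𝓡 (n + 1)) f.map y (s.vec i y)) f.normal with hXdef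
  have hX : ∀ i, ContMDiffOn (𝓡 n) (𝓡 (n + 1)).tangent ∞
      (fun y ↦ (⟨f.map y, X i y⟩ : TangentBundle (𝓡 (n + 1)) N)) s.dom := by
    intro i
    refine Fin.lastCases ?_ (fun i ↦ ?_) i
    · simp only [hXdef, Fin.snoc_last]
      exact f.smooth_normal.contMDiffOn
    · simp only [hXdef, Fin.snoc_castSucc]
      exact (f.smooth_map.contMDiff_tangentMap (m := ∞) (by simp)).comp_contMDiffOn
        (s.smooth_vec i)
  have hext : ∀ y (hy : y ∈ s.dom), ∃ h : ∀ i j, gN.inner (f.map y) (X i y) (X j y)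
      = if i = j then 1 else 0,
      S.frame (s.lift y).1.2 = ⟨f.map y, fun i ↦ X i y, h⟩ := by
    intro y hy
    obtain ⟨h1, h2⟩ := s.frame_lift y hy
    have h3 : f.extendFrame ⟨y, fun i ↦ s.vec i y, h1⟩ = S.frame (s.lift y).1.2 := by
      rw [← (s.lift y).2]
      exact congrArg f.extendFrame h2.symm
    have h4 : (f.extendFrame ⟨y, fun i ↦ s.vec i y, h1⟩).vec = fun i ↦ X i y := by
      funext i
      refine Fin.lastCases ?_ (fun i ↦ ?_) i
      · simp [CoorientedImmersion.extendFrame, hXdef]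
      · simp [CoorientedImmersion.extendFrame, hXdef]
    have h5 := (f.extendFrame ⟨y, fun i ↦ s.vec i y, h1⟩).orthonormal
    rw [h4] at h5
    refine ⟨h5, ?_⟩
    rw [← h3]
    exact ONFrame.ext rfl h4
  obtain ⟨W, e, he, hxW, heX⟩ := exists_extend_frame gN f.smooth_map (f.mfderiv_injective x)
    s.isOpen_dom hx hX fun y hy ↦ (hext y hy).choose
  have hframe : ∀ y, y ∈ s.dom → (∀ i, e i (f.map y) = X i y) → ∀ hyW : f.map y ∈ W,
      S.frame (s.lift y).1.2
        = ⟨f.map y, fun i ↦ e i (f.map y), he.orthonormal _ hyW⟩ := by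
    intro y hy h hyW
    rw [(hext y hy).choose_spec]
    exact ONFrame.ext rfl (funext fun i ↦ (h i).symm)
  obtain ⟨t, hxt, htW, rfl, Ω, hΩ, hxΩ, hlift⟩ := S.exists_lift he hxW
    (hframe x hx heX.self_of_nhds hxW)
  -- By continuity the ambient component of the lift stays in the sheet `Ω`, so it cannot differ
  -- from `t.lift` by the deck transformation `-1`.
  have hcont : ContinuousAt (fun y ↦ (s.lift y).1.2) x :=
    (continuous_snd.comp continuous_subtype_val).continuousAt.comp
      (s.continuousOn_lift.continuousAt (s.isOpen_dom.mem_nhds hx))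
  refine ⟨t, ?_⟩
  filter_upwards [heX, s.isOpen_dom.mem_nhds hx,
    f.smooth_map.continuous.continuousAt.preimage_mem_nhds (t.isOpen_dom.mem_nhds hxt),
    hcont.preimage_mem_nhds (hΩ.mem_nhds hxΩ)] with y hy hys hyt hyΩ
  refine ⟨hys, hyt, ⟨fun i ↦ ?_, ?_⟩, hlift _ hyt _ hyΩ ?_⟩
  · rw [hy]; simp [hXdef]
  · rw [hy]; simp [hXdef]
  · rw [hframe y hys hy (htW hyt)]
    obtain ⟨h, h'⟩ := t.frame_lift _ hyt
    rw [h']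

end AdaptedFrame

/-! ### Vector fields related by a map, and derivatives along a map. -/

section RelatedFields

variable {m k : ℕ}
  {M : Type*} [TopologicalSpace M] [ChartedSpace (EuclideanSpace ℝ (Fin m)) M]
  [IsManifold (𝓡 m) ∞ M]
  {N : Type*} [TopologicalSpace N] [ChartedSpace (EuclideanSpace ℝ (Fin k)) N]
  [IsManifold (𝓡 k) ∞ N]

lemma mdifferentiableAt_coord {Y : Π z : N, TangentSpace (𝓡 k) z} {z : N}
    (hY : VectorFieldMDiffAt Y z) :
    MDifferentiableAt (𝓡 k) 𝓘(ℝ, EuclideanSpace ℝ (Fin k))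
      (fun z' ↦ (trivializationAt (EuclideanSpace ℝ (Fin k)) (TangentSpace (𝓡 k)) z
        (⟨z', Y z'⟩ : TangentBundle (𝓡 k) N)).2) z :=
  ((mdifferentiableAt_totalSpace _ _).1 hY).2

/-- Differentiability of a field at a point, a condition in the trivialization, thereby becomes
differentiability of the derivatives of the chart along it. -/
lemma coord_eq_mvfderiv (Y : Π z : N, TangentSpace (𝓡 k) z) {z z' : N}
    (hz : z' ∈ (chartAt (EuclideanSpace ℝ (Fin k)) z).source) :
    (trivializationAt (EuclideanSpace ℝ (Fin k)) (TangentSpace (𝓡 k)) z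
        (⟨z', Y z'⟩ : TangentBundle (𝓡 k) N)).2 = mvfderiv (𝓡 k) (extChartAt (𝓡 k) z) z' (Y z') := by
  have h := TangentBundle.continuousLinearMapAt_trivializationAt (I := 𝓡 k) hz
  have h2 := congrArg (fun L ↦ L (Y z')) h
  refine Eq.trans ?_ h2
  rw [Trivialization.continuousLinearMapAt_apply, Trivialization.linearMapAt_apply, if_pos]
  simpa using hz

/-- The bracket of vector fields related by a map is related to the bracket. -/
theorem mlieBracket_related {f : M → N} {x : M} (hf : ContMDiff (𝓡 m) (𝓡 k) ∞ f)
    {X X' : Π y : M, TangentSpace (𝓡 m) y} {Y Y' : Π z : N, TangentSpace (𝓡 k) z}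
    (hX : VectorFieldMDiffAt X x) (hX' : VectorFieldMDiffAt X' x)
    (hY : VectorFieldMDiffAt Y (f x)) (hY' : VectorFieldMDiffAt Y' (f x))
    (h : ∀ᶠ y in 𝓝 x, Y (f y) = mfderiv (𝓡 m) (𝓡 k) f y (X y))
    (h' : ∀ᶠ y in 𝓝 x, Y' (f y) = mfderiv (𝓡 m) (𝓡 k) f y (X' y)) :
    mlieBracket (𝓡 k) Y Y' (f x) = mfderiv (𝓡 m) (𝓡 k) f x (mlieBracket (𝓡 m) X X' x) := by
  -- Both brackets are tested on the chart `u` and on `u ∘ f`, via their commutator formula;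
  -- injectivity of the derivative of `u` then gives the claim.
  set u := extChartAt (𝓡 k) (f x)
  have hu : ContMDiffAt (𝓡 k) 𝓘(ℝ, EuclideanSpace ℝ (Fin k)) ∞ u (f x) := contMDiffAt_extChartAt
  have hfd : ∀ y, MDifferentiableAt (𝓡 m) (𝓡 k) f y := fun y ↦ (hf y).mdifferentiableAt (by simp)
  have hsrc : ∀ᶠ z in 𝓝 (f x), z ∈ (chartAt (EuclideanSpace ℝ (Fin k)) (f x)).source :=
    (chartAt _ (f x)).open_source.mem_nhds (mem_chart_source _ _)
  have hud : ∀ z ∈ (chartAt (EuclideanSpace ℝ (Fin k)) (f x)).source,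
      MDifferentiableAt (𝓡 k) 𝓘(ℝ, EuclideanSpace ℝ (Fin k)) u z := fun z hz ↦
    (contMDiffAt_extChartAt' (n := ∞) hz).mdifferentiableAt (by simp)
  have hfs := (hf x).continuousAt.eventually hsrc
  have key : ∀ {A : Π y : M, TangentSpace (𝓡 m) y} {B : Π z : N, TangentSpace (𝓡 k) z}
      {A' : Π y : M, TangentSpace (𝓡 m) y} {B' : Π z : N, TangentSpace (𝓡 k) z},
      VectorFieldMDiffAt B (f x) →
      (∀ᶠ y in 𝓝 x, B (f y) = mfderiv (𝓡 m) (𝓡 k) f y (A y)) →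
      (∀ᶠ y in 𝓝 x, B' (f y) = mfderiv (𝓡 m) (𝓡 k) f y (A' y)) →
      mvfderiv (𝓡 m) (fun y ↦ mvfderiv (𝓡 m) (fun y ↦ u (f y)) y (A y)) x (A' x)
        = mvfderiv (𝓡 k) (fun z ↦ mvfderiv (𝓡 k) u z (B z)) (f x) (B' (f x)) := by
    intro A B A' B' hB hAB hAB'
    have e1 : (fun y ↦ mvfderiv (𝓡 m) (fun y ↦ u (f y)) y (A y))
        =ᶠ[𝓝 x] fun y ↦ mvfderiv (𝓡 k) u (f y) (B (f y)) := by
      filter_upwards [hAB, hfs] with y hy hys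
      rw [mvfderiv_comp_mfderiv (hud _ hys) (hfd y), hy]
    have hd : MDifferentiableAt (𝓡 k) 𝓘(ℝ, EuclideanSpace ℝ (Fin k))
        (fun z ↦ mvfderiv (𝓡 k) u z (B z)) (f x) := by
      refine (mdifferentiableAt_coord hB).congr_of_eventuallyEq ?_
      filter_upwards [hsrc] with z hz
      exact (coord_eq_mvfderiv B hz).symm
    rw [mvfderiv_congr_of_eventuallyEq e1, hAB'.self_of_nhds]
    exact mvfderiv_comp_mfderiv (u := fun z ↦ mvfderiv (𝓡 k) u z (B z)) hd (hfd x) _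
  have h1 := mvfderiv_mlieBracket (I := 𝓡 k) hu hY hY'
  have h2 := mvfderiv_mlieBracket (I := 𝓡 m) (u := fun y ↦ u (f y)) (hu.comp x (hf x)) hX hX'
  rw [key hY' h' h, key hY h h', ← h1,
    mvfderiv_comp_mfderiv (hud _ hsrc.self_of_nhds) (hfd x)] at h2
  exact ((isInvertible_mfderiv_extChartAt (mem_extChartAt_source (I := 𝓡 k) (f x))).injective h2).symm

/-- The derivative along a map of the restriction of a vector field `Y` is the Levi-Civita
derivative of `Y`. -/
theorem covAlong_eq_leviCivita {n : ℕ}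
    {M : Type*} [TopologicalSpace M] [ChartedSpace (EuclideanSpace ℝ (Fin n)) M]
    {N : Type*} [TopologicalSpace N] [ChartedSpace (EuclideanSpace ℝ (Fin (n + 1))) N]
    [IsManifold (𝓡 (n + 1)) ∞ N] (g : RiemMetric (n + 1) N) {f : M → N} {x : M}
    (hf : MDifferentiableAt (𝓡 n) (𝓡 (n + 1)) f x)
    {V : Π y : M, TangentSpace (𝓡 (n + 1)) (f y)} {Y : Π z : N, TangentSpace (𝓡 (n + 1)) z}
    (hY : VectorFieldMDiffAt Y (f x)) (h : ∀ᶠ y in 𝓝 x, Y (f y) = V y)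
    (X : TangentSpace (𝓡 n) x) :
    covAlong g f V x X = leviCivita g Y (f x) (mfderiv (𝓡 n) (𝓡 (n + 1)) f x X) := by
  set T := trivializationAt (EuclideanSpace ℝ (Fin (n + 1))) (TangentSpace (𝓡 (n + 1))) (f x)
    with hT
  have hbase : ∀ᶠ z in 𝓝 (f x), z ∈ T.baseSet :=
    T.open_baseSet.mem_nhds (FiberBundle.mem_baseSet_trivializationAt' _)
  set w : N → EuclideanSpace ℝ (Fin (n + 1)) :=
    fun z ↦ (T (⟨z, Y z⟩ : TangentBundle (𝓡 (n + 1)) N)).2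
  have hw : MDifferentiableAt (𝓡 (n + 1)) 𝓘(ℝ, EuclideanSpace ℝ (Fin (n + 1))) w (f x) :=
    mdifferentiableAt_coord hY
  let b := (EuclideanSpace.basisFun (Fin (n + 1)) ℝ).toBasis
  have hb : ∀ v : EuclideanSpace ℝ (Fin (n + 1)), v = ∑ a, v a • b a := fun v ↦ by
    conv_lhs => rw [← b.sum_repr v]
    simp [b]
  -- Expanding `Y` in the coordinate frame, the Leibniz rule produces exactly the two terms of
  -- `covAlong`: the derivative of the components, and the connection on the field with components
  -- frozen at `f x`.
  set B : Fin (n + 1) → Π z : N, TangentSpace (𝓡 (n + 1)) z := T.localFrame b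
  have hB : ∀ a, VectorFieldMDiffAt (B a) (f x) := fun a ↦
    (contMDiffAt_localFrame_of_mem (I := 𝓡 (n + 1)) (n := ∞) T b a
      hbase.self_of_nhds).mdifferentiableAt (by simp)
  have hsymm : ∀ z ∈ T.baseSet, ∀ v : EuclideanSpace ℝ (Fin (n + 1)),
      T.symm z v = ∑ a, v a • B a z := by
    intro z hz v
    have hBz : ∀ a, B a z = T.symmₗ ℝ z (b a) := fun a ↦ by
      simp only [B, T.localFrame_apply_of_mem_baseSet b hz, Trivialization.basisAt,
        Module.Basis.map_apply]
      exact (T.symmₗ_apply hz (b a)).symm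
    simp only [hBz, ← map_smul, ← map_sum, ← hb]
    exact (T.symmₗ_apply hz v).symm
  have hwa : ∀ a, MDifferentiableAt (𝓡 (n + 1)) 𝓘(ℝ, ℝ) (fun z ↦ w z a) (f x) := fun a ↦
    MDifferentiableAt.comp (I' := 𝓘(ℝ, EuclideanSpace ℝ (Fin (n + 1)))) (f x)
      (g := (EuclideanSpace.proj a : EuclideanSpace ℝ (Fin (n + 1)) →L[ℝ] ℝ))
      (ContinuousLinearMap.mdifferentiableAt _) hw
  have hwa' : ∀ a v, mvfderiv (𝓡 (n + 1)) (fun z ↦ w z a) (f x) v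
      = (mvfderiv (𝓡 (n + 1)) w (f x) v : EuclideanSpace ℝ (Fin (n + 1))) a := fun a v ↦
    mvfderiv_clm_comp (EuclideanSpace.proj a : EuclideanSpace ℝ (Fin (n + 1)) →L[ℝ] ℝ) hw v
  have hYB : ∀ᶠ z in 𝓝 (f x), Y z = ∑ a, w z a • B a z := by
    filter_upwards [hbase] with z hz
    exact (T.symm_apply_apply_mk hz (Y z)).symm.trans (hsymm z hz (w z))
  obtain ⟨h1, h2⟩ := leviCivita_sum_smul g Finset.univ hwa hB
  obtain ⟨h3, h4⟩ := leviCivita_sum_smul g Finset.univ (a := fun a _ ↦ w (f x) a)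
    (fun a ↦ mdifferentiableAt_const) hB
  have h4' : ∀ v, leviCivita g (fun z ↦ ∑ a, w (f x) a • B a z) (f x) v
      = ∑ a, w (f x) a • leviCivita g (B a) (f x) v := fun v ↦ by
    rw [h4]
    refine Finset.sum_congr rfl fun a _ ↦ ?_
    rw [mvfderiv_const, zero_apply, zero_smul, add_zero]
  have hsec : (fun z ↦ T.symm z (w (f x)))
      =ᶠ[𝓝 (f x)] fun z ↦ ∑ a, w (f x) a • B a z := by
    filter_upwards [hbase] with z hz
    exact hsymm z hz _
  have h5 : VectorFieldMDiffAt (fun z ↦ T.symm z (w (f x))) (f x) := by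
    refine h3.congr_of_eventuallyEq ?_
    filter_upwards [hsec] with z hz
    exact congrArg (fun v ↦ (⟨z, v⟩ : TangentBundle (𝓡 (n + 1)) N)) hz
  have hV : (fun y ↦ (T (⟨f y, V y⟩ : TangentBundle (𝓡 (n + 1)) N)).2) =ᶠ[𝓝 x] fun y ↦ w (f y) := by
    filter_upwards [h] with y hy
    rw [← hy]
  have hV₀ : (T (⟨f x, V x⟩ : TangentBundle (𝓡 (n + 1)) N)).2 = w (f x) := hV.self_of_nhds
  change T.symm (f x) (mvfderiv (𝓡 n) (fun y ↦ (T (⟨f y, V y⟩ : TangentBundle (𝓡 (n + 1)) N)).2) x X)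
    + leviCivita g (fun z ↦ T.symm z ((T (⟨f x, V x⟩ : TangentBundle (𝓡 (n + 1)) N)).2)) (f x)
      (mfderiv (𝓡 n) (𝓡 (n + 1)) f x X) = _
  rw [hV₀, mvfderiv_congr_of_eventuallyEq hV, mvfderiv_comp_mfderiv hw hf,
    leviCivita_congr g h5 h3 hsec, leviCivita_congr g hY h1 hYB, h2, h4',
    hsymm _ hbase.self_of_nhds, Finset.sum_add_distrib]
  simp only [hwa']
  exact add_comm _ _

end RelatedFields

/-! ### Connection coefficients in adapted frames and the second fundamental form. -/

section AdaptedGeometry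

variable {n : ℕ}
  {M : Type*} [TopologicalSpace M] [ChartedSpace (EuclideanSpace ℝ (Fin n)) M]
  [IsManifold (𝓡 n) ∞ M]
  {N : Type*} [TopologicalSpace N] [ChartedSpace (EuclideanSpace ℝ (Fin (n + 1))) N]
  [IsManifold (𝓡 (n + 1)) ∞ N] {gM : RiemMetric n M} {gN : RiemMetric (n + 1) N}
  {f : CoorientedImmersion gM gN} {U : Set M} {W : Set N}
  {s : Fin n → Π x : M, TangentSpace (𝓡 n) x}
  {t : Fin (n + 1) → Π z : N, TangentSpace (𝓡 (n + 1)) z} {x : M}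

/-- The frame `t` is adapted to the frame `s` in a neighbourhood of `x`. -/
structure AdaptedNear (f : CoorientedImmersion gM gN) (U : Set M) (W : Set N)
    (s : Fin n → Π x : M, TangentSpace (𝓡 n) x)
    (t : Fin (n + 1) → Π z : N, TangentSpace (𝓡 (n + 1)) z) (x : M) : Prop where
  source : IsONFrameOn gM U s
  target : IsONFrameOn gN W t
  eventually : ∀ᶠ y in 𝓝 x, y ∈ U ∧ f.map y ∈ W ∧ IsAdaptedAt (f := f) s t y

namespace AdaptedNear

lemma mem_source (h : AdaptedNear f U W s t x) : x ∈ U := h.eventually.self_of_nhds.1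

lemma mem_target (h : AdaptedNear f U W s t x) : f.map x ∈ W := h.eventually.self_of_nhds.2.1

lemma tangent (h : AdaptedNear f U W s t x) (i : Fin n) :
    t i.castSucc (f.map x) = mfderiv (𝓡 n) (𝓡 (n + 1)) f.map x (s i x) :=
  h.eventually.self_of_nhds.2.2.tangent i

lemma normal (h : AdaptedNear f U W s t x) : t (Fin.last n) (f.map x) = f.normal x :=
  h.eventually.self_of_nhds.2.2.normal

lemma eventually_adaptedNear (h : AdaptedNear f U W s t x) :
    ∀ᶠ y in 𝓝 x, AdaptedNear f U W s t y := by
  filter_upwards [eventually_eventually_nhds.2 h.eventually] with y hy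
  exact ⟨h.source, h.target, hy⟩

lemma mlieBracket_eq (h : AdaptedNear f U W s t x) (k i : Fin n) :
    mlieBracket (𝓡 (n + 1)) (t k.castSucc) (t i.castSucc) (f.map x)
      = mfderiv (𝓡 n) (𝓡 (n + 1)) f.map x (mlieBracket (𝓡 n) (s k) (s i) x) :=
  mlieBracket_related f.smooth_map (h.source.mdiffAt h.mem_source k)
    (h.source.mdiffAt h.mem_source i) (h.target.mdiffAt h.mem_target _)
    (h.target.mdiffAt h.mem_target _) (h.eventually.mono fun _ hy ↦ hy.2.2.tangent k)
    (h.eventually.mono fun _ hy ↦ hy.2.2.tangent i)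

lemma structCoeff_castSucc (h : AdaptedNear f U W s t x) (k i j : Fin n) :
    structCoeff gN t k.castSucc i.castSucc j.castSucc (f.map x) = structCoeff gM s k i j x := by
  rw [structCoeff, h.mlieBracket_eq, h.tangent, f.isometric]
  rfl

/-- Brackets of fields tangent to the hypersurface are tangent to it; this is why the second
fundamental form is symmetric. -/
lemma structCoeff_last (h : AdaptedNear f U W s t x) (k i : Fin n) :
    structCoeff gN t k.castSucc i.castSucc (Fin.last n) (f.map x) = 0 := by
  rw [structCoeff, h.mlieBracket_eq, h.normal, f.normal_orth]

/-- The tangential part of the ambient connection is the intrinsic one: only tangential structure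
coefficients enter Koszul's formula for these components, and they agree. -/
lemma connCoeff_castSucc (h : AdaptedNear f U W s t x) (k i j : Fin n) :
    connCoeff gN t k.castSucc i.castSucc j.castSucc (f.map x) = connCoeff gM s k i j x := by
  rw [h.source.connCoeff_eq h.mem_source, h.target.connCoeff_eq h.mem_target]
  simp only [h.structCoeff_castSucc]

lemma connCoeff_last_symm (h : AdaptedNear f U W s t x) (k i : Fin n) :
    connCoeff gN t k.castSucc i.castSucc (Fin.last n) (f.map x)
      = connCoeff gN t i.castSucc k.castSucc (Fin.last n) (f.map x) := by
  have h1 := h.structCoeff_last k i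
  rw [h.target.structCoeff_eq h.mem_target] at h1
  linarith

/-- The derivative of ν along the map is that of its extension `t (Fin.last n)`; antisymmetry of the
coefficients absorbs the minus sign in the definition of h. -/
lemma secondFundamentalForm_eq (h : AdaptedNear f U W s t x) (k i : Fin n) :
    f.secondFundamentalForm x (s k x) (s i x)
      = connCoeff gN t k.castSucc i.castSucc (Fin.last n) (f.map x) := by
  rw [h.target.connCoeff_antisymm h.mem_target, CoorientedImmersion.secondFundamentalForm,
    covAlong_eq_leviCivita gN ((f.smooth_map x).mdifferentiableAt (by simp))
      (h.target.mdiffAt h.mem_target (Fin.last n))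
      (h.eventually.mono fun _ hy ↦ hy.2.2.normal), connCoeff, h.tangent, h.tangent]

lemma contMDiffAt_secondFundamentalForm (h : AdaptedNear f U W s t x) (k i : Fin n) :
    ContMDiffAt (𝓡 n) 𝓘(ℝ, ℝ) ∞ (fun y ↦ f.secondFundamentalForm y (s k y) (s i y)) x := by
  refine ((h.target.contMDiffAt_connCoeff h.mem_target k.castSucc i.castSucc
    (Fin.last n)).comp x (f.smooth_map x)).congr_of_eventuallyEq ?_
  filter_upwards [h.eventually_adaptedNear] with y hy
  exact hy.secondFundamentalForm_eq k i

lemma secondFundamentalForm_symm (h : AdaptedNear f U W s t x) (k i : Fin n) :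
    f.secondFundamentalForm x (s k x) (s i x) = f.secondFundamentalForm x (s i x) (s k x) := by
  rw [h.secondFundamentalForm_eq, h.secondFundamentalForm_eq, h.connCoeff_last_symm]

end AdaptedNear

namespace CoorientedImmersion

/-- Bilinearity, in the form used for passing to components in a frame; the derivative of the normal
is linear in its direction by construction. -/
lemma secondFundamentalForm_sum (f : CoorientedImmersion gM gN) (x : M) {ι κ : Type*} [Fintype ι]
    [Fintype κ] (a : ι → ℝ) (b : κ → ℝ) (X : ι → TangentSpace (𝓡 n) x)
    (Y : κ → TangentSpace (𝓡 n) x) :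
    f.secondFundamentalForm x (∑ i, a i • X i) (∑ j, b j • Y j)
      = ∑ i, ∑ j, a i * b j * f.secondFundamentalForm x (X i) (Y j) := by
  obtain ⟨L, hL⟩ : ∃ L : TangentSpace (𝓡 n) x →ₗ[ℝ] TangentSpace (𝓡 (n + 1)) (f.map x),
      ∀ Z, covAlong gN f.map f.normal x Z = L Z := by
    set T := trivializationAt (EuclideanSpace ℝ (Fin (n + 1))) (TangentSpace (𝓡 (n + 1))) (f.map x)
    exact ⟨T.symmₗ ℝ (f.map x) ∘ₗ (mvfderiv (𝓡 n) (fun y ↦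
      (T (⟨f.map y, f.normal y⟩ : TangentBundle (𝓡 (n + 1)) N)).2) x).toLinearMap
      + (leviCivita gN (fun z ↦ T.symm z
        (T (⟨f.map x, f.normal x⟩ : TangentBundle (𝓡 (n + 1)) N)).2) (f.map x)).toLinearMap ∘ₗ
        (mfderiv (𝓡 n) (𝓡 (n + 1)) f.map x).toLinearMap, fun Z ↦ congrArg (· + _)
          (T.symmₗ_apply (FiberBundle.mem_baseSet_trivializationAt' _) _).symm⟩
  simp only [secondFundamentalForm, hL, map_sum, map_smul, sum_apply, smul_apply, smul_eq_mul,
    ← Finset.sum_neg_distrib, Finset.mul_sum]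
  rw [Finset.sum_comm]
  refine Finset.sum_congr rfl fun i _ ↦ Finset.sum_congr rfl fun j _ ↦ ?_
  ring

end CoorientedImmersion

/-- In an adapted frame, the Clifford action of the connection form of the ambient manifold is
that of the hypersurface together with that of the second fundamental form. -/
lemma CliffordModule.coe_killingOp_induced {V : Type*} [NormedAddCommGroup V]
    [InnerProductSpace ℂ V] (c : CliffordModule (n + 1) V) (ε : ℤˣ)
    {w : Fin (n + 1) → Fin (n + 1) → ℝ} (hw : ∀ i j, w i j = -w j i)
    (u : c.hypersurfaceSpinors ε) :
    (killingOp (A := Module.End ℂ (c.hypersurfaceSpinors ε)) (c.induced ε).gamma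
        (fun i j ↦ w i.castSucc j.castSucc) (fun i ↦ w i.castSucc (Fin.last n)) u : V)
      = -((1 / 4 : ℝ) • ∑ i, ∑ j, w i j • c.gamma i (c.gamma j (u : V))) := by
  have hG : ∀ (i : Fin n) (v : c.hypersurfaceSpinors ε),
      ((c.induced ε).gamma i v : V) = c.gamma i.castSucc (c.gamma (Fin.last n) (v : V)) :=
    fun i v ↦ rfl
  have hsq : ∀ v, c.gamma (Fin.last n) (c.gamma (Fin.last n) v) = -v := fun v ↦ by
    rw [← Module.End.mul_apply, c.cliffordRelations.sq]; simp
  have hanti : ∀ (i : Fin n) v, c.gamma (Fin.last n) (c.gamma i.castSucc v)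
      = -c.gamma i.castSucc (c.gamma (Fin.last n) v) := fun i v ↦ by
    rw [eq_neg_iff_add_eq_zero]
    simpa [(Fin.castSucc_lt_last _).ne'] using c.anticomm (Fin.last n) i.castSucc v
  have hll : w (Fin.last n) (Fin.last n) = 0 := by linarith [hw (Fin.last n) (Fin.last n)]
  -- The mixed terms with ν on the left and on the right coincide, both the coefficient and the
  -- product changing sign; this doubles `1/4` to the `1/2` of `killingOp`.
  have hlast : ∀ j : Fin n, w (Fin.last n) j.castSucc = -w j.castSucc (Fin.last n) :=
    fun j ↦ hw _ _
  simp only [killingOp, CliffordRelations.spinRep, CliffordRelations.vecRep, LinearMap.neg_apply, LinearMap.add_apply,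
    LinearMap.smul_apply, LinearMap.sum_apply, Module.End.mul_apply, Submodule.coe_neg,
    Submodule.coe_add, Submodule.coe_smul_of_tower, Submodule.coe_sum, hG, hanti, hsq, map_neg,
    neg_neg, Fin.sum_univ_castSucc, hll, hlast, zero_smul, add_zero, Finset.sum_add_distrib,
    smul_neg, neg_smul, neg_zero]
  module

end AdaptedGeometry

/-! ### Dependence on signs and on the choice of the orthonormal frame. -/

section FrameSigns

variable {m : ℕ} {M : Type*} [TopologicalSpace M] [ChartedSpace (EuclideanSpace ℝ (Fin m)) M]
  [IsManifold (𝓡 m) ∞ M] {g : RiemMetric m M} {U : Set M}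
  {e : Fin m → Π x : M, TangentSpace (𝓡 m) x} {x : M}

/-- Traces and scalar curvature are defined through a chosen frame that may be negatively oriented
and so need not lift to the spin structure; reversing its first vector repairs this. -/
lemma ONFrame.exists_sign_isPositive [NeZero m]
    (o : Π x : M, Orientation ℝ (TangentSpace (𝓡 m) x) (Fin m)) (u : ONFrame g) :
    ∃ w : Fin m → ℝ, (∀ i, w i * w i = 1) ∧
      ∀ h, (⟨u.base, fun i ↦ w i • u.vec i, h⟩ : ONFrame g).IsPositive o := by
  by_cases hp : u.IsPositive o
  · exact ⟨1, by simp, fun h ↦ by simpa using hp⟩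
  let w : Fin m → ℝˣ := Function.update 1 0 (-1)
  refine ⟨fun i ↦ w i, fun i ↦ ?_, fun h ↦ ?_⟩
  · by_cases hi : i = 0
    · subst hi; simp [w]
    · simp [w, hi]
  · have h1 := (u.basis.orientation_eq_or_eq_neg (o u.base)).resolve_left (fun h ↦ hp h.symm)
    rw [← Module.Basis.orientation_neg_single u.basis 0] at h1
    unfold ONFrame.IsPositive
    rw [h1]
    congr 1
    apply Module.Basis.eq_of_apply_eq
    intro i
    rw [Module.Basis.unitsSMul_apply]
    simp only [ONFrame.basis, coe_basisOfLinearIndependentOfCardEqFinrank']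
    rfl

lemma exists_isONFrameOn_onFieldAt (g : RiemMetric m M) (x : M) :
    ∃ W, x ∈ W ∧ IsONFrameOn g W (onFieldAt g x) := by
  have h := (exists_orthonormal_frame g (m := m)
    (finrank_euclideanSpace_fin (𝕜 := ℝ)) x).choose_spec.choose_spec
  exact ⟨_, h.2.1, h.1, h.2.2.1, h.2.2.2⟩

namespace IsONFrameOn

lemma mono (he : IsONFrameOn g U e) {W : Set M} (hW : IsOpen W) (h : W ⊆ U) : IsONFrameOn g W e where
  isOpen := hW
  smooth i := (he.smooth i).mono h
  orthonormal y hy := he.orthonormal y (h hy)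

lemma sign_smul (he : IsONFrameOn g U e) {w : Fin m → ℝ} (hw : ∀ i, w i * w i = 1) :
    IsONFrameOn g U (fun i y ↦ w i • e i y) where
  isOpen := he.isOpen
  smooth i := ContMDiffOn.const_smul_section (he.smooth i)
  orthonormal y hy i j := by
    simp only [map_smul, smul_apply, smul_eq_mul, he.orthonormal y hy i j]
    split_ifs with hij
    · subst hij; rw [mul_one, hw]
    · simp

lemma connCoeff_smul (he : IsONFrameOn g U e) (hx : x ∈ U) (w : Fin m → ℝ) (k i j : Fin m) :
    connCoeff g (fun i y ↦ w i • e i y) k i j x = w k * w i * w j * connCoeff g e k i j x := by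
  have h := leviCivita_fun_smul g (a := fun _ ↦ w i) mdifferentiableAt_const (he.mdiffAt hx i)
  rw [connCoeff, h, mvfderiv_const]
  simp only [connCoeff, add_apply, smul_apply, map_smul, smul_eq_mul,
    ContinuousLinearMap.smulRight_apply, zero_apply, zero_smul, add_zero]
  ring

/-- The trace of a bilinear form does not depend on the orthonormal frame. -/
lemma metricTrace_eq {x : M} (he : IsONFrameOn g U e) (hx : x ∈ U)
    {T : TangentSpace (𝓡 m) x → TangentSpace (𝓡 m) x → ℝ}
    (hT : ∀ (a b : Fin m → ℝ) (X Y : Fin m → TangentSpace (𝓡 m) x),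
      T (∑ i, a i • X i) (∑ j, b j • Y j) = ∑ i, ∑ j, a i * b j * T (X i) (Y j)) :
    metricTrace g x T = ∑ k, T (e k x) (e k x) := by
  obtain ⟨W, hxW, hW⟩ := exists_isONFrameOn_onFieldAt g x
  have h1 : ∀ i, T (onFieldAt g x i x) (onFieldAt g x i x) = ∑ k, ∑ l,
      g.inner x (e k x) (onFieldAt g x i x) * g.inner x (e l x) (onFieldAt g x i x)
        * T (e k x) (e l x) := fun i ↦ by
    conv_lhs => rw [← he.sum_inner_smul hx (onFieldAt g x i x), hT]
    simp only [g.symm x (onFieldAt g x i x)]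
  rw [metricTrace, Finset.sum_congr rfl fun i _ ↦ h1 i, Finset.sum_comm]
  refine Finset.sum_congr rfl fun k _ ↦ ?_
  rw [Finset.sum_comm]
  simp only [← Finset.sum_mul, ← hW.inner_eq_sum hxW, he.orthonormal x hx]
  simp

end IsONFrameOn

/-- Changing the signs of the generators of a Clifford module. -/
def CliffordModule.signed {V : Type*} [NormedAddCommGroup V] [InnerProductSpace ℂ V]
    (c : CliffordModule m V) (w : Fin m → ℝ) (hw : ∀ i, w i * w i = 1) : CliffordModule m V where
  gamma i := (w i : ℂ) • c.gamma i
  anticomm i j v := by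
    have h := congrArg (fun z ↦ ((w i : ℂ) * w j) • z) (c.anticomm i j v)
    simp only [smul_add, smul_smul, LinearMap.smul_apply, map_smul] at h ⊢
    rw [mul_comm (w j : ℂ), h]
    split_ifs with hij
    · subst hij
      rw [smul_smul, ← Complex.ofReal_mul, hw]; simp
    · simp
  skew i v u := by
    simp [c.skew]

/-- A reversal of frame vectors can be absorbed in the Clifford generators, so the integrability
argument also applies to frames of the wrong orientation. -/
lemma CliffordModule.killingOp_signed {V : Type*} [NormedAddCommGroup V] [InnerProductSpace ℂ V]
    (c : CliffordModule m V) {w : Fin m → ℝ} (hw : ∀ i, w i * w i = 1) (a : Fin m → Fin m → ℝ)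
    (b : Fin m → ℝ) (v : V) :
    killingOp (A := Module.End ℂ V) c.gamma (fun i j ↦ w i * w j * a i j) (fun i ↦ w i * b i) v
      = killingOp (A := Module.End ℂ V) (c.signed w hw).gamma a b v := by
  simp only [killingOp, CliffordRelations.spinRep, CliffordRelations.vecRep, LinearMap.neg_apply,
    LinearMap.add_apply, LinearMap.smul_apply, LinearMap.sum_apply, Module.End.mul_apply,
    CliffordModule.signed, Complex.coe_smul, LinearMap.map_smul_of_tower, smul_smul]
  simp only [mul_comm, mul_left_comm]

end FrameSigns

/-! ### The equation satisfied by the restriction of a parallel spinor. -/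

section Hypersurface

variable {n : ℕ} [NeZero n]
  {M : Type*} [TopologicalSpace M] [ChartedSpace (EuclideanSpace ℝ (Fin n)) M]
  [IsManifold (𝓡 n) ∞ M]
  {N : Type*} [TopologicalSpace N] [ChartedSpace (EuclideanSpace ℝ (Fin (n + 1))) N]
  [IsManifold (𝓡 (n + 1)) ∞ N] {gM : RiemMetric n M}
  {oM : Π x : M, Orientation ℝ (TangentSpace (𝓡 n) x) (Fin n)} {gN : RiemMetric (n + 1) N}
  {oN : Π x : N, Orientation ℝ (TangentSpace (𝓡 (n + 1)) x) (Fin (n + 1))}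
  {V : Type*} [NormedAddCommGroup V] [InnerProductSpace ℂ V] [FiniteDimensional ℂ V]
  {S : SpinStructure gN oN} {f : OrientedHypersurface gM oM gN oN}
  {c : CliffordModule (n + 1) V} {Φ : S.P → V}

lemma LocalSpinFrame.exists_adaptedNear (s : LocalSpinFrame (S.induced f)) {x : M}
    (hx : x ∈ s.dom) (c : CliffordModule (n + 1) V) (ε : ℤˣ) (Φ : S.P → V) :
    ∃ t : LocalSpinFrame S, AdaptedNear f.toCoorientedImmersion s.dom t.dom s.vec t.vec x ∧
      (fun y ↦ restrictSpinor S f c ε Φ (s.lift y))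
        =ᶠ[𝓝 x] fun y ↦ c.projectionCLM ε (Φ (t.lift (f.map y))) := by
  obtain ⟨t, ht⟩ := exists_adapted_frame S f s hx
  refine ⟨t, ⟨s.isONFrameOn, t.isONFrameOn, ht.mono fun y hy ↦ ⟨hy.1, hy.2.1, hy.2.2.1⟩⟩, ?_⟩
  filter_upwards [ht] with y hy
  rw [hy.2.2.2]
  rfl

lemma IsSpinorField.contMDiffAt_projection {ε : ℤˣ} (hΦ : IsSpinorField S c Φ)
    (t : LocalSpinFrame S) {z : N} (hz : z ∈ t.dom) :
    ContMDiffAt (𝓡 (n + 1)) 𝓘(ℝ, c.hypersurfaceSpinors ε) ∞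
      (fun y ↦ c.projectionCLM ε (Φ (t.lift y))) z :=
  ContMDiffAt.comp (I' := 𝓘(ℝ, V)) z (g := c.projectionCLM ε)
    (c.projectionCLM ε).contMDiff.contMDiffAt (hΦ.contMDiffAt t hz)

/-- The restriction of a spinor field to a hypersurface is a spinor field. -/
theorem IsSpinorField.restrictSpinor (hΦ : IsSpinorField S c Φ) (ε : ℤˣ) :
    IsSpinorField (S.induced f) (c.induced ε) (restrictSpinor S f c ε Φ) where
  equivariant := restrictSpinor_equivariant ε hΦ
  smooth s x hx := by
    obtain ⟨t, ht, htu⟩ := s.exists_adaptedNear hx c ε Φ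
    have h : ContMDiffAt (𝓡 n) 𝓘(ℝ, c.hypersurfaceSpinors ε) ∞
        (fun y ↦ c.projectionCLM ε (Φ (t.lift (f.map y)))) x :=
      ContMDiffAt.comp (I' := 𝓡 (n + 1)) x
        (g := fun z ↦ c.projectionCLM ε (Φ (t.lift z))) (hΦ.contMDiffAt_projection t ht.mem_target)
        (f.smooth_map x)
    exact (h.congr_of_eventuallyEq htu).contMDiffWithinAt

/-- In a local spin frame, the restriction `ψ` of a parallel spinor field satisfies
`∇_X ψ = -(1/2) h(X) ⬝ ψ`, where `h` is the second fundamental form. -/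
theorem IsParallelSpinor.mvfderiv_restrictSpinor (hpar : IsParallelSpinor S c Φ)
    (hΦ : IsSpinorField S c Φ) (ε : ℤˣ) (s : LocalSpinFrame (S.induced f)) {x : M}
    (hx : x ∈ s.dom) (k : Fin n) :
    mvfderiv (𝓡 n) (fun y ↦ restrictSpinor S f c ε Φ (s.lift y)) x (s.vec k x)
      = killingOp (A := Module.End ℂ (c.hypersurfaceSpinors ε)) (c.induced ε).gamma
          (fun i j ↦ connCoeff gM s.vec k i j x)
          (fun i ↦ f.secondFundamentalForm x (s.vec k x) (s.vec i x))
          (restrictSpinor S f c ε Φ (s.lift x)) := by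
  obtain ⟨t, ht, htu⟩ := s.exists_adaptedNear hx c ε Φ
  have hd : MDifferentiableAt (𝓡 (n + 1)) 𝓘(ℝ, c.hypersurfaceSpinors ε)
      (fun z ↦ c.projectionCLM ε (Φ (t.lift z))) (f.map x) :=
    (hΦ.contMDiffAt_projection t ht.mem_target).mdifferentiableAt (by simp)
  have hux : restrictSpinor S f c ε Φ (s.lift x) = c.projectionCLM ε (Φ (t.lift (f.map x))) :=
    htu.self_of_nhds
  rw [mvfderiv_congr_of_eventuallyEq htu, hux]
  refine (mvfderiv_comp_mfderiv (u := fun z ↦ c.projectionCLM ε (Φ (t.lift z))) hd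
    ((f.smooth_map x).mdifferentiableAt (by simp)) _).trans ?_
  -- The image of `s.vec k` under the differential is a vector of the ambient frame, so the parallel
  -- equation is read off from connection coefficients, which split into those of `M` and h.
  rw [← ht.tangent]
  apply Subtype.ext
  refine (hpar.mvfderiv_projection hΦ ε t ht.mem_target _).trans ?_
  have h := c.coe_killingOp_induced ε
    (w := fun i j ↦ connCoeff gN t.vec k.castSucc i j (f.map x))
    (fun i j ↦ ht.target.connCoeff_antisymm ht.mem_target _ i j)
    (c.projectionCLM ε (Φ (t.lift (f.map x))))
  simp only [ht.connCoeff_castSucc, ← ht.secondFundamentalForm_eq] at h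
  exact h.symm

lemma LocalSpinFrame.secondFundamentalForm_symm (s : LocalSpinFrame (S.induced f)) {x : M}
    (hx : x ∈ s.dom) (k i : Fin n) :
    f.secondFundamentalForm x (s.vec k x) (s.vec i x)
      = f.secondFundamentalForm x (s.vec i x) (s.vec k x) := by
  obtain ⟨t, ht⟩ := exists_adapted_frame S f s hx
  exact AdaptedNear.secondFundamentalForm_symm (f := f.toCoorientedImmersion)
    ⟨s.isONFrameOn, t.isONFrameOn, ht.mono fun y hy ↦ ⟨hy.1, hy.2.1, hy.2.2.1⟩⟩ k i

end Hypersurface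

/-- The Clifford contraction of a symmetric bilinear form is minus its trace. -/
lemma CliffordModule.sum_gamma_gamma {m : ℕ} {V : Type*} [NormedAddCommGroup V]
    [InnerProductSpace ℂ V] (c : CliffordModule m V) {h : Fin m → Fin m → ℝ}
    (hh : ∀ i j, h i j = h j i) (v : V) :
    ∑ k, ∑ i, h k i • c.gamma k (c.gamma i v) = -((∑ k, h k k) • v) := by
  have h1 : ∑ k, ∑ i, h k i • c.gamma k (c.gamma i v)
      = ∑ k, ∑ i, h k i • c.gamma i (c.gamma k v) := by
    rw [Finset.sum_comm]
    exact Finset.sum_congr rfl fun i _ ↦ Finset.sum_congr rfl fun k _ ↦ by rw [hh]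
  have h2 : ∑ k, ∑ i, h k i • c.gamma k (c.gamma i v)
      + ∑ k, ∑ i, h k i • c.gamma i (c.gamma k v) = (-2 : ℝ) • ((∑ k, h k k) • v) := by
    simp only [← Finset.sum_add_distrib, ← smul_add, c.anticomm, smul_ite, smul_zero,
      Finset.sum_ite_eq, Finset.mem_univ, if_true, Finset.sum_smul, Finset.smul_sum]
    refine Finset.sum_congr rfl fun k _ ↦ ?_
    rw [smul_comm (-2 : ℝ), ← Complex.coe_smul (-2 : ℝ) v]
    norm_num
  rw [← h1, ← two_smul ℝ] at h2
  refine smul_right_injective _ (two_ne_zero (α := ℝ)) (h2.trans ?_)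
  module

lemma killingOp_smul {m : ℕ} {A : Type*} [Ring A] [Algebra ℝ A] (G : Fin m → A) (r : ℝ)
    (w : Fin m → Fin m → ℝ) (h : Fin m → ℝ) :
    r • killingOp G w h = killingOp G (fun i j ↦ r * w i j) (fun i ↦ r * h i) := by
  simp only [killingOp, CliffordRelations.spinRep, CliffordRelations.vecRep, mul_smul,
    ← Finset.smul_sum]
  module

/-! ### The spinorial connection in a local spin frame. -/

section Nabla

variable {m : ℕ} [NeZero m] {V : Type*} [NormedAddCommGroup V] [InnerProductSpace ℂ V]
  {M : Type*} [TopologicalSpace M] [ChartedSpace (EuclideanSpace ℝ (Fin m)) M]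
  [IsManifold (𝓡 m) ∞ M] {g : RiemMetric m M}
  {o : Π x : M, Orientation ℝ (TangentSpace (𝓡 m) x) (Fin m)} {S : SpinStructure g o}

namespace LocalSpinFrame

lemma nabla_sum (s : LocalSpinFrame S) (c : CliffordModule m V) (ψ : S.P → V) (x : M)
    (a : Fin m → ℝ) (X : Fin m → TangentSpace (𝓡 m) x) :
    s.nabla c ψ x (∑ k, a k • X k) = ∑ k, a k • s.nabla c ψ x (X k) := by
  have h : ∀ i j, g.inner x (leviCivita g (s.vec i) x (∑ k, a k • X k)) (s.vec j x)
      = ∑ k, a k * g.inner x (leviCivita g (s.vec i) x (X k)) (s.vec j x) := fun i j ↦ by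
    simp only [map_sum, map_smul, sum_apply, smul_apply, smul_eq_mul]
  have h' : mvfderiv (𝓡 m) (fun y ↦ ψ (s.lift y)) x (∑ k, a k • X k)
      = ∑ k, a k • mvfderiv (𝓡 m) (fun y ↦ ψ (s.lift y)) x (X k) :=
    (map_sum _ _ _).trans (Finset.sum_congr rfl fun k _ ↦ map_smul _ _ _)
  simp only [nabla, h, h', smul_add, Finset.sum_add_distrib, Finset.sum_smul, mul_smul]
  congr 1
  simp only [smul_comm _ (1 / 4 : ℝ), ← Finset.smul_sum]
  congr 1
  simp only [Finset.smul_sum]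
  exact Finset.sum_comm_cycle

/-- A spinor field with `∇_X ψ = -(1/2) h(X) ⬝ ψ` in a local spin frame. -/
lemma nabla_eq_of_mvfderiv_eq (s : LocalSpinFrame S) (c : CliffordModule m V) (ψ : S.P → V)
    {x : M} {h : Fin m → Fin m → ℝ}
    (hu : ∀ k, mvfderiv (𝓡 m) (fun y ↦ ψ (s.lift y)) x (s.vec k x)
      = killingOp (A := Module.End ℂ V) c.gamma (fun i j ↦ connCoeff g s.vec k i j x) (h k)
        (ψ (s.lift x))) (k : Fin m) :
    s.nabla c ψ x (s.vec k x) = -((1 / 2 : ℝ) • ∑ i, h k i • c.gamma i (ψ (s.lift x))) := by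
  rw [nabla, hu]
  simp only [killingOp, CliffordRelations.spinRep, CliffordRelations.vecRep, LinearMap.neg_apply,
    LinearMap.add_apply, LinearMap.smul_apply, LinearMap.sum_apply, Module.End.mul_apply,
    connCoeff]
  abel

lemma mul_vec (s : LocalSpinFrame S) (c : CliffordModule m V) {x : M} (hx : x ∈ s.dom)
    (k : Fin m) (v : V) : s.mul c x (s.vec k x) v = c.gamma k v := by
  simp [mul, s.isONFrameOn.orthonormal x hx]

end LocalSpinFrame

end Nabla

/-! ### Energy-momentum tensor, Dirac operator and scalar curvature of the hypersurface. -/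

section Hypersurface

variable {n : ℕ} [NeZero n]
  {M : Type*} [TopologicalSpace M] [ChartedSpace (EuclideanSpace ℝ (Fin n)) M]
  [IsManifold (𝓡 n) ∞ M]
  {N : Type*} [TopologicalSpace N] [ChartedSpace (EuclideanSpace ℝ (Fin (n + 1))) N]
  [IsManifold (𝓡 (n + 1)) ∞ N] {gM : RiemMetric n M}
  {oM : Π x : M, Orientation ℝ (TangentSpace (𝓡 n) x) (Fin n)} {gN : RiemMetric (n + 1) N}
  {oN : Π x : N, Orientation ℝ (TangentSpace (𝓡 (n + 1)) x) (Fin (n + 1))}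
  {V : Type*} [NormedAddCommGroup V] [InnerProductSpace ℂ V] [FiniteDimensional ℂ V]
  {S : SpinStructure gN oN} {f : OrientedHypersurface gM oM gN oN}
  {c : CliffordModule (n + 1) V} {Φ : S.P → V}

lemma IsParallelSpinor.nabla_restrictSpinor (hpar : IsParallelSpinor S c Φ)
    (hΦ : IsSpinorField S c Φ) (ε : ℤˣ) (s : LocalSpinFrame (S.induced f)) {x : M}
    (hx : x ∈ s.dom) (k : Fin n) :
    s.nabla (c.induced ε) (restrictSpinor S f c ε Φ) x (s.vec k x)
      = -((1 / 2 : ℝ) • ∑ i, f.secondFundamentalForm x (s.vec k x) (s.vec i x) •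
        (c.induced ε).gamma i (restrictSpinor S f c ε Φ (s.lift x))) :=
  s.nabla_eq_of_mvfderiv_eq (c.induced ε) (restrictSpinor S f c ε Φ)
    (hpar.mvfderiv_restrictSpinor hΦ ε s hx) k

/-- The energy-momentum tensor of the restriction of a parallel spinor field is half the second
fundamental form. -/
theorem IsParallelSpinor.two_mul_energyMomentum (hpar : IsParallelSpinor S c Φ)
    (hΦ : IsSpinorField S c Φ) {ε : ℤˣ} (h0 : ∀ q, restrictSpinor S f c ε Φ q ≠ 0) (x : M)
    (X Y : TangentSpace (𝓡 n) x) :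
    2 * energyMomentum (S.induced f) (c.induced ε) (restrictSpinor S f c ε Φ) x X Y
      = f.secondFundamentalForm x X Y := by
  set s := spinFrameAt (S.induced f) x with hs
  have hx : x ∈ s.dom := mem_dom_spinFrameAt _ x
  set u := restrictSpinor S f c ε Φ (s.lift x) with hu
  -- This holds before symmetrization: inserting the equation for ∇_Y ψ, only the products of equal
  -- generators have nonzero real part, and the two minus signs cancel.
  have key : ∀ X Y : TangentSpace (𝓡 n) x,
      (inner ℂ (s.mul (c.induced ε) x X
        (s.nabla (c.induced ε) (restrictSpinor S f c ε Φ) x Y)) u).re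
      = (1 / 2) * f.secondFundamentalForm x X Y * ‖u‖ ^ 2 := by
    intro X Y
    conv_rhs => rw [← s.isONFrameOn.sum_inner_smul hx X, ← s.isONFrameOn.sum_inner_smul hx Y,
      f.secondFundamentalForm_sum]
    conv_lhs => rw [← s.isONFrameOn.sum_inner_smul hx Y, s.nabla_sum]
    simp only [hpar.nabla_restrictSpinor hΦ ε s hx, ← hu, LocalSpinFrame.mul, map_sum, map_neg,
      LinearMap.map_smul_of_tower, sum_inner, Complex.re_sum, re_inner_real_smul_left,
      inner_neg_left, Complex.neg_re, (c.induced ε).re_inner_gamma_gamma, Finset.mul_sum,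
      Finset.sum_mul]
    refine Finset.sum_congr rfl fun i _ ↦ Finset.sum_congr rfl fun j _ ↦ ?_
    simp only [mul_ite, mul_zero, Finset.sum_ite_eq, Finset.mem_univ, if_true]
    rw [s.secondFundamentalForm_symm hx j i]
    ring
  have hne : ‖u‖ ≠ 0 := norm_ne_zero_iff.2 (h0 _)
  have hsymm : f.secondFundamentalForm x Y X = f.secondFundamentalForm x X Y := by
    rw [← s.isONFrameOn.sum_inner_smul hx X, ← s.isONFrameOn.sum_inner_smul hx Y,
      f.secondFundamentalForm_sum, f.secondFundamentalForm_sum, Finset.sum_comm]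
    refine Finset.sum_congr rfl fun i _ ↦ Finset.sum_congr rfl fun j _ ↦ ?_
    rw [s.secondFundamentalForm_symm hx j i]
    ring
  change 2 * ((1 / 2) * (inner ℂ (s.mul (c.induced ε) x X
      (s.nabla (c.induced ε) (restrictSpinor S f c ε Φ) x Y)
    + s.mul (c.induced ε) x Y
      (s.nabla (c.induced ε) (restrictSpinor S f c ε Φ) x X)) u).re / ‖u‖ ^ 2) = _
  rw [inner_add_left, Complex.add_re, key, key, hsymm]
  field_simp
  ring

lemma OrientedHypersurface.sum_secondFundamentalForm (f : OrientedHypersurface gM oM gN oN)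
    {U : Set M} {e : Fin n → Π x : M, TangentSpace (𝓡 n) x} (he : IsONFrameOn gM U e) {x : M}
    (hx : x ∈ U) :
    ∑ k, f.secondFundamentalForm x (e k x) (e k x) = n * f.meanCurvature x := by
  have h := he.metricTrace_eq hx (T := f.secondFundamentalForm x) (f.secondFundamentalForm_sum x)
  have hn : (n : ℝ) ≠ 0 := Nat.cast_ne_zero.2 (NeZero.ne n)
  rw [← h, CoorientedImmersion.meanCurvature]
  field_simp

/-- The Dirac operator on the restriction of a parallel spinor field. -/
theorem IsParallelSpinor.dirac_restrictSpinor (hpar : IsParallelSpinor S c Φ)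
    (hΦ : IsSpinorField S c Φ) (ε : ℤˣ) (s : LocalSpinFrame (S.induced f)) {x : M}
    (hx : x ∈ s.dom) :
    ∑ i, s.mul (c.induced ε) x (s.vec i x)
        (s.nabla (c.induced ε) (restrictSpinor S f c ε Φ) x (s.vec i x))
      = (n * f.meanCurvature x / 2) • restrictSpinor S f c ε Φ (s.lift x) := by
  have h := (c.induced ε).sum_gamma_gamma (s.secondFundamentalForm_symm hx)
    (restrictSpinor S f c ε Φ (s.lift x))
  simp only [s.mul_vec _ hx, hpar.nabla_restrictSpinor hΦ ε s hx, map_neg, map_sum,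
    LinearMap.map_smul_of_tower, Finset.sum_neg_distrib, ← Finset.smul_sum]
  rw [h, f.sum_secondFundamentalForm s.isONFrameOn hx]
  module

/-- The traced Gauss equation for a hypersurface carrying the restriction of a parallel spinor
field. -/
theorem IsParallelSpinor.scalarCurvature_eq (hpar : IsParallelSpinor S c Φ)
    (hΦ : IsSpinorField S c Φ) {ε : ℤˣ} (h0 : ∀ q, restrictSpinor S f c ε Φ q ≠ 0) (x : M) :
    scalarCurvature gM x = (n * f.meanCurvature x) ^ 2
      - metricNormSq gM x (f.secondFundamentalForm x) := by
  obtain ⟨W, hxW, hW⟩ := exists_isONFrameOn_onFieldAt gM x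
  set E := onFieldAt gM x with hE
  -- The frame `E` of the definition of the scalar curvature is corrected to a positive frame
  -- `t.vec`, along which the spinor can be lifted.
  obtain ⟨w, hw, hpos⟩ := ONFrame.exists_sign_isPositive oM
    (⟨x, fun i ↦ E i x, hW.orthonormal x hxW⟩ : ONFrame gM)
  obtain ⟨p, hp⟩ := ((S.induced f).range_frame _).2
    (hpos ((hW.sign_smul hw).orthonormal x hxW))
  obtain ⟨t, hxt, htW, htE, -⟩ := (S.induced f).exists_lift (hW.sign_smul hw) hxW hp
  have hvec : ∀ i y, t.vec i y = w i • E i y := fun i y ↦ by rw [htE]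
  have hEvec : ∀ i y, E i y = w i • t.vec i y := fun i y ↦ by
    rw [hvec, smul_smul, hw, one_smul]
  have hEt := hW.mono t.isOpen_dom htW
  have hsff : ∀ k l y, f.secondFundamentalForm y (E k y) (E l y)
      = w k * w l * f.secondFundamentalForm y (t.vec k y) (t.vec l y) := fun k l y ↦ by
    have := f.secondFundamentalForm_sum y (ι := Unit) (κ := Unit) (fun _ ↦ w k) (fun _ ↦ w l)
      (fun _ ↦ t.vec k y) (fun _ ↦ t.vec l y)
    simpa [hEvec] using this
  -- The spinor is lifted along `t`, but the identity is taken in the frame `E` with correspondingly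
  -- signed generators, so that its curvature sum is the definition of the scalar curvature.
  have h := hEt.scalar_identity ((c.induced ε).signed w hw)
    (u := fun y ↦ restrictSpinor S f c ε Φ (t.lift y))
    (h := fun k l y ↦ f.secondFundamentalForm y (E k y) (E l y))
    (fun y hy ↦ (hΦ.restrictSpinor ε).contMDiffAt t hy) (fun k l y hy ↦ ?_)
    (fun k l y hy ↦ ?_) (fun k y hy ↦ ?_) hxt
  · have h1 := (mul_eq_zero.1 h).resolve_right (pow_ne_zero _ (norm_ne_zero_iff.2 (h0 _)))
    rw [f.sum_secondFundamentalForm hW hxW] at h1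
    rw [scalarCurvature, metricNormSq, ← hE]
    linarith
  · obtain ⟨t', ht', -⟩ := t.exists_adaptedNear hy c ε Φ
    simp only [hsff]
    exact mdifferentiableAt_const.mul
      ((ht'.contMDiffAt_secondFundamentalForm k l).mdifferentiableAt (by simp))
  · simp only [hsff, t.secondFundamentalForm_symm hy k l, mul_comm (w k)]
  -- The equation is known in the direction `t.vec k`; the signs brought in by the change of frame
  -- cancel because each squares to one.
  · refine (congrArg _ (hEvec k y)).trans ((map_smul _ (w k) _).trans ?_)
    rw [hpar.mvfderiv_restrictSpinor hΦ ε t hy, ← CliffordModule.killingOp_signed,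
      ← LinearMap.smul_apply, killingOp_smul]
    congr 2
    · funext i j
      rw [htE, hW.connCoeff_smul (htW hy)]
      linear_combination w i * w j * connCoeff gM E k i j y * hw k
    · funext i
      rw [hsff]
      linear_combination -w k * f.secondFundamentalForm y (t.vec k y) (t.vec i y) * hw i

end Hypersurface

end

/-- Let `f` be a compact oriented hypersurface `M` of dimension `n ≥ 1` with constant mean curvature
`H` in a connected Riemannian spin manifold `N` of dimension `n + 1` carrying a nonzero parallel
spinor field `Φ`. Its restriction `ψ` to `M` (for odd `n`, the restriction of its part of
chirality `ε`, which is nonzero for at least one sign `ε`) is a nowhere vanishing eigenspinor of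
the Dirac operator of `M`, its eigenvalue satisfies `lam² = inf (S / 4 + |T|²)`, and
`2 T = h`, where `T` is the energy-momentum tensor of `ψ`. -/
theorem proposition2p2 {n : ℕ} [NeZero n]
    {M : Type*} [TopologicalSpace M] [ChartedSpace (EuclideanSpace ℝ (Fin n)) M]
    [IsManifold (𝓡 n) ∞ M] [T2Space M] [CompactSpace M] [Nonempty M]
    {N : Type*} [TopologicalSpace N] [ChartedSpace (EuclideanSpace ℝ (Fin (n + 1))) N]
    [IsManifold (𝓡 (n + 1)) ∞ N] [T2Space N] [SecondCountableTopology N] [ConnectedSpace N]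
    (gM : RiemMetric n M) (oM : Π x : M, Orientation ℝ (TangentSpace (𝓡 n) x) (Fin n))
    (gN : RiemMetric (n + 1) N)
    (oN : Π y : N, Orientation ℝ (TangentSpace (𝓡 (n + 1)) y) (Fin (n + 1)))
    (S : SpinStructure gN oN)
    {V : Type*} [NormedAddCommGroup V] [InnerProductSpace ℂ V] [FiniteDimensional ℂ V]
    (c : CliffordModule (n + 1) V) (hc : c.IsIrreducible)
    (f : OrientedHypersurface gM oM gN oN) (H : ℝ) (hH : ∀ x, f.meanCurvature x = H)
    (Φ : S.P → V) (hΦ : IsSpinorField S c Φ) (hpar : IsParallelSpinor S c Φ) (hΦ0 : Φ ≠ 0) :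
    (∃ ε : ℤˣ, restrictSpinor S f c ε Φ ≠ 0) ∧
    ∀ ε : ℤˣ, restrictSpinor S f c ε Φ ≠ 0 →
      IsSpinorField (S.induced f) (c.induced ε) (restrictSpinor S f c ε Φ) ∧
      (∀ q, restrictSpinor S f c ε Φ q ≠ 0) ∧
      (∃ lam : ℝ,
        IsDiracEigenspinor (S.induced f) (c.induced ε) (restrictSpinor S f c ε Φ) lam ∧
        IsGLB (Set.range fun x ↦ (1 / 4) * scalarCurvature gM x
          + metricNormSq gM x
            (energyMomentum (S.induced f) (c.induced ε) (restrictSpinor S f c ε Φ) x)) (lam ^ 2)) ∧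
      ∀ (x : M) (X Y : TangentSpace (𝓡 n) x),
        2 * energyMomentum (S.induced f) (c.induced ε) (restrictSpinor S f c ε Φ) x X Y
          = f.secondFundamentalForm x X Y := by
  refine ⟨exists_restrictSpinor_ne_zero hΦ hpar hΦ0, fun ε hε ↦ ?_⟩
  have h0 := restrictSpinor_ne_zero_forall hΦ hpar hε
  have hT := hpar.two_mul_energyMomentum hΦ h0
  refine ⟨hΦ.restrictSpinor ε, h0, ⟨n * H / 2, fun s x hx ↦ ?_, ?_⟩, hT⟩
  · rw [hpar.dirac_restrictSpinor hΦ ε s hx, hH]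
  -- With 4|T|² = |h|² and S = (nH)² - |h|² the terms in h cancel; the infimum is that of a constant
  -- function on a nonempty manifold.
  · have hconst : ∀ x, (1 / 4) * scalarCurvature gM x + metricNormSq gM x
        (energyMomentum (S.induced f) (c.induced ε) (restrictSpinor S f c ε Φ) x)
        = (n * H / 2) ^ 2 := by
      intro x
      have h1 : metricNormSq gM x (f.secondFundamentalForm x) = 4 * metricNormSq gM x
          (energyMomentum (S.induced f) (c.induced ε) (restrictSpinor S f c ε Φ) x) := by
        simp only [metricNormSq, ← hT, mul_pow, Finset.mul_sum]
        norm_num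
      rw [hpar.scalarCurvature_eq hΦ h0, hH, h1]
      ring
    simp only [hconst, Set.range_const]
    exact isGLB_singleton
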